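/- **Setting.** Let $\nu>0$, $T>0$, $\mathbb T^3=[0,1]^3$ (periodic), with Fourier coefficients $\hat f(k)$, $k\in\mathbb Z^3$, with respect to the modes $e^{2\pi i k\cdot x}$; write $L^p_x=L^p(\mathbb T^3)$. Let $\varphi:\mathbb R^3\to[0,1]$ be smooth and radial with $\varphi(x)=1$ for $|x|<1$ and $\varphi(x)=0$ for $|x|\ge 2$. Let $\Lambda:(0,T]\to(0,\infty)$ be smooth and strictly decreasing, with $\Lambda\ge c$ for some constant $c>0$, $\Lambda(t)\to+\infty$ as $t\to0^+$, and $\Lambda(t)\le t^{-1/8}$ on $(0,T]$. For $t\in(0,T]$ set $\widehat{\mathbb P_{<\Lambda(t)}f}(k)=\varphi(k/\Lambda(t))\hat f(k)$ and $\mathbb P_{\ge\Lambda(t)}=\mathrm{Id}-\mathbb P_{<\Lambda(t)}$; at $t=0$ set $\mathbb P_{<\Lambda}=\mathrm{Id}$, $\mathbb P_{\ge\Lambda}=0$. The $\Lambda$-NSE on $[0,T]\times\mathbb T^3$ is $$\partial_t u-\nu\Delta u+\mathbb P_{<\Lambda(t)}\big(\mathbb P_{<\Lambda(t)}u\cdot\nabla\,\mathbb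 P_{<\Lambda(t)}u\big)+\nabla p=0,\qquad \operatorname{div}u=0,\qquad u(0)=v_0 .\tag{1}$$ Let $(\Omega,\mathcal F,(\mathcal F_t)_{t\ge0},\mathbb P)$ be a filtered probability space. A *probabilistically strong and analytically weak solution* of (1) is an $(\mathcal F_t)$-adapted $L^2_x$-valued process $v$ on $[0,T]$ such that, $\mathbb P$-a.s., $v\in C([0,T];L^2_x)$, $v(t)$ is mean-free and weakly divergence-free for all $t\in[0,T]$, and for every divergence-free $\psi\in C^\infty(\mathbb T^3;\mathbb R^3)$ and $t\in[0,T]$ $$\int v(t)\cdot\psi\,dx=\int v_0\cdot\psi\,dx+\int_0^t\!\int \Big(\nu\, v\cdot\Delta\psi-\mathbb P_{<\Lambda(s)}\big(\mathbb P_{<\Lambda(s)}v\cdot\nabla\,\mathbb P_{<\Lambda(s)}v\big)\cdot\psi\Big)dx\,ds .$$ The *Leray–Hopf class* is defined in the same way with continuity in $L^2_x$ weakened to weak continuity, and with the energy inequality (3) below required $\mathbb P$-a.s. (here $\|\nabla v\|_{L^2_x}=\infty$ if $v\notin H^1$, so (3) includes $v\in L^2(0,T;H^1)$). **Theorem (global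 well-posedness of the $\Lambda$-NSE).** Let $v_0$ be an $\mathcal F_0$-measurable $L^2_x$-valued random variable which is $\mathbb P$-a.s. divergence-free and mean-free and satisfies $\|v_0\|_{L^2_x}\le M$ $\mathbb P$-a.s. for a deterministic constant $M\ge1$. Then there is a process $\widetilde u$ on $[0,T]$ such that the following hold. (i) $\widetilde u$ is adapted and is a probabilistically strong and analytically weak solution of (1). $\mathbb P$-a.s., $\widetilde u(0)=v_0$; $\widetilde u$ is smooth on $(0,T]\times\mathbb T^3$ and satisfies (1) pointwise there with a smooth pressure $p$; $\widetilde u(t)\to v_0$ strongly in $L^2_x$ as $t\to0^+$; and $$\tfrac12\|\widetilde u(t)\|_{L^2_x}^2+\nu\int_0^t\|\nabla\widetilde u(s)\|_{L^2_x}^2\,ds=\tfrac12\|v_0\|_{L^2_x}^2,\qquad t\in[0,T].\tag{2}$$ Moreover, for every $1\le\rho<\infty$, $\|\widetilde u-v_0\|_{L^\rho(\Omega;C([0,T_*];L^2_x))}\to0$ as $T_*\to0^+$. (ii) Every probabilistically strong and analytically weak solution $v$ of (1) such that $\mathbb P$-a.s. $$\tfrac12\|v(t)\|_{L^2_x}^2+\nu\int_0^t\|\nabla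 v(s)\|_{L^2_x}^2\,ds\le\tfrac12\|v_0\|_{L^2_x}^2,\qquad t\in[0,T],\tag{3}$$ coincides with $\widetilde u$: $\mathbb P$-a.s., $v(t)=\widetilde u(t)$ for all $t\in[0,T]$. Likewise, every solution in the Leray–Hopf class coincides with $\widetilde u$. (iii) With $a\mathring\otimes b=a\otimes b-\tfrac13(a\cdot b)\mathrm{Id}$, the map $t\mapsto\mathbb P_{\ge\Lambda(t)}\big(\mathbb P_{<\Lambda(t)}\widetilde u(t)\mathring\otimes\mathbb P_{<\Lambda(t)}\widetilde u(t)\big)$ is $\mathbb P$-a.s. in $C([0,T];L^1_x)$, and for every $1\le\rho<\infty$ $$\big\|\mathbb P_{\ge\Lambda}\big(\mathbb P_{<\Lambda}\widetilde u\,\mathring\otimes\,\mathbb P_{<\Lambda}\widetilde u\big)\big\|_{L^\rho(\Omega;C([0,T_*];L^1_x))}\to0\qquad\text{as }T_*\to0^+ .$$ -/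

import Mathlib

open MeasureTheory ProbabilityTheory Filter Set Topology
open scoped NNReal ENNReal

namespace LambdaNSE

/-- The torus `𝕋³ = (ℝ/ℤ)³`, that is `[0,1]³` with opposite faces identified. -/
abbrev T3 : Type := UnitAddTorus (Fin 3)

/-- Vectors in `ℝ³` with the Euclidean norm. -/
abbrev E3 : Type := EuclideanSpace ℝ (Fin 3)

/-- Real `3 × 3` matrices with the Frobenius (Hilbert–Schmidt) norm. -/
abbrev M3 : Type := EuclideanSpace ℝ (Fin 3 × Fin 3)

/-- Lebesgue measure on the torus (of total mass one). -/
noncomputable def vol : Measure T3 :=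
  Measure.pi fun _ : Fin 3 => (AddCircle.haarAddCircle : Measure UnitAddCircle)

noncomputable instance : IsProbabilityMeasure vol := by
  unfold vol; infer_instance

/-- The Hilbert space `L²(𝕋³; ℝ³)`. -/
abbrev L2 : Type := Lp E3 2 vol

/-! ### Differential calculus on the torus -/

section Calculus

variable {F : Type*} [NormedAddCommGroup F] [NormedSpace ℝ F]

/-- The covering map `ℝ³ → 𝕋³`. -/
def proj (y : E3) : T3 := fun i => (y i : UnitAddCircle)

open scoped ContDiff in
/-- `C^∞` functions on the torus: those whose periodic lift to `ℝ³` is `C^∞`. -/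
def Smooth (f : T3 → F) : Prop := ContDiff ℝ ∞ fun y : E3 => f (proj y)

open scoped ContDiff in
/-- `C^∞` functions on `(0,T] × 𝕋³` (one-sided in time at `T`). -/
def SmoothPosTime (T : ℝ) (f : ℝ → T3 → F) : Prop :=
  ContDiffOn ℝ ∞ (fun z : ℝ × E3 => f z.1 (proj z.2)) (Ioc 0 T ×ˢ univ)

/-- The partial derivative `∂_j f` on the torus. -/
noncomputable def pd (j : Fin 3) (f : T3 → F) (x : T3) : F :=
  deriv (fun s : ℝ => f (x + Pi.single j (s : UnitAddCircle))) 0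

/-- The Laplacian `Δ f = ∑_j ∂_j ∂_j f`. -/
noncomputable def lap (f : T3 → F) (x : T3) : F := ∑ j, pd j (pd j f) x

/-- The gradient of a scalar function. -/
noncomputable def grad (f : T3 → ℝ) (x : T3) : E3 := WithLp.toLp 2 fun j => pd j f x

/-- The divergence of a vector field. -/
noncomputable def dvg (w : T3 → E3) (x : T3) : ℝ := ∑ j, pd j w x j

end Calculus

/-! ### Function spaces -/

/-- `v` is divergence free in the sense of distributions. -/
def WeaklyDivFree (v : L2) : Prop :=
  ∀ θ : T3 → ℝ, Smooth θ → ∫ x, inner ℝ (v x) (grad θ x) ∂vol = 0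

/-- `v` has zero spatial mean. -/
def MeanFree (v : L2) : Prop := ∫ x, v x ∂vol = 0

/-- The `k`-th Fourier coefficient, `∫ f(x) e^{-2πi k·x} dx`, of a real function on the torus. -/
noncomputable def fourierCoef (f : T3 → ℝ) (k : Fin 3 → ℤ) : ℂ :=
  UnitAddTorus.mFourierCoeff (fun x => (f x : ℂ)) k

/-- `‖∇ v‖²_{L²} = ∑_k |2πk|² |v̂(k)|²`, with value `∞` when `v` is not in `H¹`. -/
noncomputable def gradSq (v : L2) : ℝ≥0∞ :=
  ∑' k : Fin 3 → ℤ, ENNReal.ofReal ((2 * Real.pi) ^ 2 * ∑ i, (k i : ℝ) ^ 2) *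
    ∑ i, ‖fourierCoef (fun x => v x i) k‖ₑ ^ 2

/-! ### The frequency truncation -/

open scoped ContDiff in
/-- The conditions on the profile `φ` of the frequency cut-off. -/
structure IsCutoff (φ : E3 → ℝ) : Prop where
  smooth : ContDiff ℝ ∞ φ
  mem_Icc : ∀ x, φ x ∈ Icc (0 : ℝ) 1
  radial : ∀ x y : E3, ‖x‖ = ‖y‖ → φ x = φ y
  eq_one : ∀ x : E3, ‖x‖ < 1 → φ x = 1
  eq_zero : ∀ x : E3, 2 ≤ ‖x‖ → φ x = 0

open scoped ContDiff in
/-- The conditions on the time-dependent truncation wavenumber `Λ : (0,T] → ℝ⁺`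
(its values outside `(0,T]` play no role). -/
structure IsWavenumber (T : ℝ) (Λ : ℝ → ℝ) : Prop where
  smooth : ContDiffOn ℝ ∞ Λ (Ioc 0 T)
  strictAnti : StrictAntiOn Λ (Ioc 0 T)
  lower : ∃ c : ℝ, 0 < c ∧ ∀ t ∈ Ioc 0 T, c ≤ Λ t
  tendsto : Tendsto Λ (𝓝[>] 0) atTop
  upper : ∀ t ∈ Ioc 0 T, Λ t ≤ t ^ (-(1 / 8) : ℝ)

/-- A frequency `k ∈ ℤ³` seen as a vector of `ℝ³`. -/
noncomputable def freq (k : Fin 3 → ℤ) : E3 := WithLp.toLp 2 fun i => (k i : ℝ)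

/-- The operator with Fourier multiplier `φ(k/L)`, `0 < L`, on real functions. The series has only
finitely many nonzero terms, and its sum is real since `φ` is even. -/
noncomputable def lowPass (φ : E3 → ℝ) (L : ℝ) (f : T3 → ℝ) (x : T3) : ℝ :=
  (∑' k : Fin 3 → ℤ,
    (φ (L⁻¹ • freq k) : ℂ) * fourierCoef f k * UnitAddTorus.mFourier k x).re

/-- `P_{<Λ(t)}` on real functions. At `t = 0`, where `Λ = +∞`, it is the identity. -/
noncomputable def lowS (φ : E3 → ℝ) (Λ : ℝ → ℝ) (t : ℝ) (f : T3 → ℝ) : T3 → ℝ :=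
  if 0 < t then lowPass φ (Λ t) f else f

/-- `P_{≥Λ(t)} = Id - P_{<Λ(t)}` on real functions. -/
noncomputable def highS (φ : E3 → ℝ) (Λ : ℝ → ℝ) (t : ℝ) (f : T3 → ℝ) : T3 → ℝ :=
  fun x => f x - lowS φ Λ t f x

/-- `P_{<Λ(t)}` on vector fields, componentwise. -/
noncomputable def low (φ : E3 → ℝ) (Λ : ℝ → ℝ) (t : ℝ) (w : T3 → E3) : T3 → E3 :=
  fun x => WithLp.toLp 2 fun i => lowS φ Λ t (fun y => w y i) x

/-- The nonlinearity `P_{<Λ(t)} ((P_{<Λ(t)} w · ∇) P_{<Λ(t)} w)`. -/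
noncomputable def nonlin (φ : E3 → ℝ) (Λ : ℝ → ℝ) (t : ℝ) (w : T3 → E3) : T3 → E3 :=
  low φ Λ t fun x => ∑ j, low φ Λ t w x j • pd j (low φ Λ t w) x

/-- The entries of the traceless tensor product `a ⊗̊ b = a ⊗ b - (1/3) (a · b) Id`. -/
noncomputable def tracelessTensor (a b : E3) (i j : Fin 3) : ℝ :=
  a i * b j - if i = j then (∑ l, a l * b l) / 3 else 0

/-- `P_{≥Λ(t)} (P_{<Λ(t)} w ⊗̊ P_{<Λ(t)} w)`. It vanishes identically at `t = 0`. -/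
noncomputable def highModes (φ : E3 → ℝ) (Λ : ℝ → ℝ) (t : ℝ) (w : T3 → E3) : T3 → M3 :=
  fun x => WithLp.toLp 2 fun p =>
    highS φ Λ t (fun y => tracelessTensor (low φ Λ t w y) (low φ Λ t w y) p.1 p.2) x

/-! ### Solutions (for a fixed `ω`) -/

/-- `v : [0,T] → L²` is divergence free and mean free at all times and satisfies the `Λ`-NSE with
initial datum `v₀`, tested against divergence-free smooth fields. -/
structure SolvesWeakly (ν T : ℝ) (φ : E3 → ℝ) (Λ : ℝ → ℝ) (v₀ : L2) (v : ℝ → L2) : Prop where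
  divFree : ∀ t ∈ Icc 0 T, WeaklyDivFree (v t)
  meanFree : ∀ t ∈ Icc 0 T, MeanFree (v t)
  equation : ∀ ψ : T3 → E3, Smooth ψ → (∀ x, dvg ψ x = 0) → ∀ t ∈ Icc 0 T,
    ∫ x, inner ℝ (v t x) (ψ x) ∂vol = ∫ x, inner ℝ (v₀ x) (ψ x) ∂vol +
      ∫ s in (0 : ℝ)..t, (ν * ∫ x, inner ℝ (v s x) (lap ψ x) ∂vol -
        ∫ x, inner ℝ (nonlin φ Λ s (v s) x) (ψ x) ∂vol)

/-- Analytically weak solutions: in `C([0,T]; L²)`. -/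
structure IsWeakSolution (ν T : ℝ) (φ : E3 → ℝ) (Λ : ℝ → ℝ) (v₀ : L2) (v : ℝ → L2) : Prop
    extends SolvesWeakly ν T φ Λ v₀ v where
  continuousOn : ContinuousOn v (Icc 0 T)

/-- `v` satisfies the energy inequality
`½‖v(t)‖² + ν ∫₀ᵗ ‖∇v(s)‖² ds ≤ ½‖v₀‖²` on `[0,T]`; in particular `v ∈ L²(0,T;H¹)`. -/
def EnergyInequality (ν T : ℝ) (v₀ : L2) (v : ℝ → L2) : Prop :=
  ∀ t ∈ Icc 0 T, ENNReal.ofReal (‖v t‖ ^ 2 / 2) +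
    ENNReal.ofReal ν * ∫⁻ s in Ioc 0 t, gradSq (v s) ≤ ENNReal.ofReal (‖v₀‖ ^ 2 / 2)

/-- `v` satisfies the energy balance
`½‖v(t)‖² + ν ∫₀ᵗ ‖∇v(s)‖² ds = ½‖v₀‖²` on `[0,T]`. -/
def EnergyBalance (ν T : ℝ) (v₀ : L2) (v : ℝ → L2) : Prop :=
  ∀ t ∈ Icc 0 T, ENNReal.ofReal (‖v t‖ ^ 2 / 2) +
    ENNReal.ofReal ν * ∫⁻ s in Ioc 0 t, gradSq (v s) = ENNReal.ofReal (‖v₀‖ ^ 2 / 2)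

/-- Leray–Hopf solutions: weak solutions in `C_w([0,T]; L²) ∩ L²(0,T; H¹)` which satisfy the
energy inequality. -/
structure IsLerayHopf (ν T : ℝ) (φ : E3 → ℝ) (Λ : ℝ → ℝ) (v₀ : L2) (v : ℝ → L2) : Prop
    extends SolvesWeakly ν T φ Λ v₀ v where
  weaklyContinuousOn : ∀ w : L2, ContinuousOn (fun t => (inner ℝ w (v t) : ℝ)) (Icc 0 T)
  energy : EnergyInequality ν T v₀ v

/-- `v` is smooth for positive times and solves the `Λ`-NSE pointwise on `(0,T] × 𝕋³`, with a smooth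
pressure `p`. -/
def IsSmoothSolution (ν T : ℝ) (φ : E3 → ℝ) (Λ : ℝ → ℝ) (v : ℝ → L2) : Prop :=
  ∃ (U : ℝ → T3 → E3) (p : ℝ → T3 → ℝ),
    (∀ t ∈ Ioc 0 T, v t =ᵐ[vol] U t) ∧ SmoothPosTime T U ∧ SmoothPosTime T p ∧
    ∀ t ∈ Ioc 0 T, ∀ x : T3, dvg (U t) x = 0 ∧
      derivWithin (fun s => U s x) (Ioc 0 T) t - ν • lap (U t) x + nonlin φ Λ t (U t) x
        + grad (p t) x = 0

/-! ### Random fields -/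

section Random

variable {Ω : Type*} {mΩ : MeasurableSpace Ω}

/-- The process `u` is adapted on `[0,T]` to the filtration `𝓕`. -/
def AdaptedOn (𝓕 : Filtration ℝ≥0 mΩ) (T : ℝ) (u : ℝ → Ω → L2) : Prop :=
  ∀ t : ℝ≥0, (t : ℝ) ≤ T → StronglyMeasurable[𝓕 t] (u t)

/-- For random time-dependent fields `f`, the norm of `L^ρ(Ω; C([0,τ]; L^q(𝕋³)))`,
`(𝔼 sup_{t ∈ [0,τ]} ‖f(t)‖_{L^q}^ρ)^{1/ρ}`. -/
noncomputable def normLC {F : Type*} [NormedAddCommGroup F] (P : Measure Ω) (ρ τ : ℝ) (q : ℝ≥0∞)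
    (f : ℝ → Ω → T3 → F) : ℝ≥0∞ :=
  eLpNorm (fun ω => ⨆ t ∈ Icc 0 τ, eLpNorm (f t ω) q vol) (ENNReal.ofReal ρ) P

/-- `f ∈ C([0,T]; L^q(𝕋³))`. -/
def ContInLq {F : Type*} [NormedAddCommGroup F] (T : ℝ) (q : ℝ≥0∞) (f : ℝ → T3 → F) : Prop :=
  (∀ t ∈ Icc 0 T, MemLp (f t) q vol) ∧
    ∀ t ∈ Icc 0 T, Tendsto (fun s => eLpNorm (f s - f t) q vol) (𝓝[Icc 0 T] t) (𝓝 0)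

end Random

end LambdaNSE

open LambdaNSE

namespace LambdaNSE
open UnitAddTorus ComplexConjugate
open scoped ContDiff

/-! On the Fourier side the nonlinearity at time `t` is a finite sum over the cube `|k i| ≤ N` with
`N ∼ Λ(t) ≤ t^{-1/8}`. Writing `u(t) = e^{νtΔ} Y(t)` turns the Leray-projected equation into an
ordinary differential equation `Y' = rhs(t, Y)` in `L²`. On active modes the integrating factor is
harmless, because `λ_k t ≲ N² t ≲ t^{3/4}`. Counting modes, interactions and one derivative bounds
the Lipschitz constant on a ball by `N^7 ≲ t^{-7/8}` (`exists_rhsLipschitz`). This is integrable at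
`0`, so Picard iteration in a norm weighted by `exp (-2A)`, with `A' = L` the Lipschitz constant,
contracts by one half on all of `[0,T]` (`exists_flow`).

The nonlinearity being quadratic, the iteration is run with its argument truncated radially to the
ball of radius `M`. The truncation only rescales the force, which stays orthogonal to a
divergence-free `u` (`sum_conj_mul_advect`). Hence the energy balance holds, `‖u(t)‖ ≤ ‖v₀‖ ≤ M`,
and the truncation was never active (`modeSolution_of_truncated`). The solution is the image of `v₀`
under a deterministic continuous map, which gives adaptedness.

Uniqueness: the energy inequality bounds a competitor by `M`; testing with single modes gives
Duhamel's formula for each coefficient (`SolvesWeakly.isModeSolution`), and the weighted estimate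
then halves the difference of two solutions indefinitely (`IsModeSolution.unique`). Only continuity
of the individual coefficients enters, so weak continuity in time is enough.

Smoothness: since `Λ` decreases, only finitely many modes are forced after a time `ε > 0`. Their
coefficients are smooth by bootstrapping the equation; all other modes follow the free heat flow and
form a rapidly convergent series of exponentials.

High modes: `P_{<Λ}` averages translates against dilates of a fixed integrable kernel, so it is
bounded on `L¹` uniformly in `Λ` (`IsCutoff.exists_eLpNorm_lowPass_le`). Near `t = 0` the tensor is
`L¹`-close to a fixed trigonometric polynomial, which `P_{≥Λ(t)}` annihilates once `Λ(t)` is large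
(`tendsto_highS_zero`). Norms over `Ω` follow by dominated convergence (`tendsto_normLC`). -/

/-- Frequencies on the torus. -/
abbrev K3 : Type := Fin 3 → ℤ

/-- Supplies the translation invariance behind vanishing integrals of derivatives and the `L¹` bound
for averages of translates. -/
instance : vol.IsAddHaarMeasure := by
  unfold vol; infer_instance

/-! ### Fourier coefficients of `L²` fields and Parseval's identity -/

theorem fourierCoef_eq (f : T3 → ℝ) (k : K3) :
    fourierCoef f k = ∫ x, mFourier (-k) x * (f x : ℂ) ∂vol := rfl

theorem norm_mFourier_apply (k : K3) (x : T3) : ‖mFourier k x‖ = 1 := by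
  simp only [mFourier, fourier_apply, ContinuousMap.coe_mk, norm_prod, Circle.norm_coe,
    Finset.prod_const_one]

theorem mFourierCoeff_congr_ae {f g : T3 → ℂ} (h : f =ᵐ[vol] g) (k : K3) :
    mFourierCoeff f k = mFourierCoeff g k :=
  integral_congr_ae (h.mono fun x hx => by simp only [hx])

theorem fourierCoef_congr_ae {f g : T3 → ℝ} (h : f =ᵐ[vol] g) (k : K3) :
    fourierCoef f k = fourierCoef g k :=
  mFourierCoeff_congr_ae (h.mono fun x hx => by simp only [hx]) k

theorem fourierCoef_neg (f : T3 → ℝ) (k : K3) : fourierCoef f (-k) = conj (fourierCoef f k) := by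
  rw [fourierCoef_eq, fourierCoef_eq, ← integral_conj]
  refine integral_congr_ae (Eventually.of_forall fun x => ?_)
  simp [mFourier_neg]

/-- The Fourier basis of `L²(𝕋³; ℂ)`. -/
noncomputable def fourierBasisT3 : HilbertBasis K3 ℂ (Lp ℂ 2 vol) := mFourierBasis

theorem fourierBasisT3_repr (f : Lp ℂ 2 vol) (k : K3) :
    fourierBasisT3.repr f k = mFourierCoeff f k := mFourierBasis_repr f k

/-- The `i`-th component of a real vector field, as a complex function. -/
noncomputable def compC (i : Fin 3) : L2 →L[ℝ] Lp ℂ 2 vol :=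
  (Complex.ofRealCLM.comp (EuclideanSpace.proj i : E3 →L[ℝ] ℝ)).compLpL 2 vol

theorem coeFn_compC (i : Fin 3) (v : L2) : compC i v =ᵐ[vol] fun x => ((v x i : ℝ) : ℂ) := by
  filter_upwards [(Complex.ofRealCLM.comp
    (EuclideanSpace.proj i : E3 →L[ℝ] ℝ)).coeFn_compLpL v] with x hx
  simp only [compC, hx]; rfl

/-- The Fourier coefficients of a real vector field. -/
noncomputable def fc (v : L2) (k : K3) (i : Fin 3) : ℂ := fourierCoef (fun x => v x i) k

theorem fc_eq_repr (v : L2) (k : K3) (i : Fin 3) :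
    fc v k i = fourierBasisT3.repr (compC i v) k := by
  rw [fourierBasisT3_repr]
  exact (mFourierCoeff_congr_ae (coeFn_compC i v) k).symm

theorem fc_neg (v : L2) (k : K3) (i : Fin 3) : fc v (-k) i = conj (fc v k i) := fourierCoef_neg _ _

theorem fc_add (v w : L2) (k : K3) (i : Fin 3) : fc (v + w) k i = fc v k i + fc w k i := by
  simp [fc_eq_repr]

theorem fc_sub (v w : L2) (k : K3) (i : Fin 3) : fc (v - w) k i = fc v k i - fc w k i := by
  simp [fc_eq_repr]

theorem fc_smul (c : ℝ) (v : L2) (k : K3) (i : Fin 3) : fc (c • v) k i = c * fc v k i := by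
  have : compC i (c • v) = (c : ℂ) • compC i v := by rw [map_smul]; exact (Complex.coe_smul _ _).symm
  rw [fc_eq_repr, fc_eq_repr, this, map_smul]; rfl

theorem hasSum_fc_comp (v w : L2) (i : Fin 3) :
    HasSum (fun k => (conj (fc v k i) * fc w k i).re) (∫ x, v x i * w x i ∂vol) := by
  have h := fourierBasisT3.hasSum_inner_mul_inner (compC i v) (compC i w)
  rw [L2.inner_def] at h
  have e : ∫ x, inner ℂ (compC i v x) (compC i w x) ∂vol = ((∫ x, v x i * w x i ∂vol : ℝ) : ℂ) := by
    rw [← integral_complex_ofReal]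
    refine integral_congr_ae ?_
    filter_upwards [coeFn_compC i v, coeFn_compC i w] with x h1 h2
    simp [h1, h2, mul_comm]
  rw [e] at h
  have h' := Complex.reCLM.hasSum h
  simp only [Complex.reCLM_apply, Complex.ofReal_re] at h'
  convert h' using 2 with k
  rw [fc_eq_repr, fc_eq_repr, HilbertBasis.repr_apply_apply, HilbertBasis.repr_apply_apply,
    inner_conj_symm]

theorem integrable_comp_mul (v w : L2) (i : Fin 3) : Integrable (fun x => v x i * w x i) vol := by
  have := L2.integrable_inner (𝕜 := ℂ) (compC i v) (compC i w)
  have h2 : Integrable (fun x => ((v x i * w x i : ℝ) : ℂ)) vol := by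
    refine this.congr ?_
    filter_upwards [coeFn_compC i v, coeFn_compC i w] with x h1 h2
    simp [h1, h2, mul_comm]
  simpa using h2.re

/-- Parseval's identity. -/
theorem hasSum_fc_inner (v w : L2) :
    HasSum (fun k => ∑ i, (conj (fc v k i) * fc w k i).re) (inner ℝ v w) := by
  have h := hasSum_sum (s := Finset.univ) fun i _ => hasSum_fc_comp v w i
  rw [L2.inner_def]
  convert h using 1
  rw [← integral_finsetSum _ fun i _ => integrable_comp_mul v w i]
  refine integral_congr_ae (Eventually.of_forall fun x => ?_)
  simp [PiLp.inner_apply, mul_comm]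

theorem hasSum_fc_sq (v : L2) : HasSum (fun k => ∑ i, ‖fc v k i‖ ^ 2) (‖v‖ ^ 2) := by
  have h := hasSum_fc_inner v v
  rw [real_inner_self_eq_norm_sq] at h
  convert h using 4 with k i
  rw [Complex.conj_mul']; norm_cast

theorem norm_fc_le (v : L2) (k : K3) (i : Fin 3) : ‖fc v k i‖ ≤ ‖v‖ := by
  refine (sq_le_sq₀ (norm_nonneg _) (norm_nonneg _)).1 ?_
  refine le_trans ?_ (le_hasSum (hasSum_fc_sq v) k fun j _ => by positivity)
  exact Finset.single_le_sum (f := fun i => ‖fc v k i‖ ^ 2) (fun i _ => by positivity)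
    (Finset.mem_univ i)

theorem continuous_fc (k : K3) (i : Fin 3) : Continuous fun v => fc v k i := by
  refine LipschitzWith.continuous (K := 1) (LipschitzWith.of_dist_le_mul fun v w => ?_)
  rw [dist_eq_norm, dist_eq_norm, ← fc_sub, NNReal.coe_one, one_mul]
  exact norm_fc_le _ _ _

theorem L2_ext {v w : L2} (h : ∀ k i, fc v k i = fc w k i) : v = w := by
  have h0 := hasSum_fc_sq (v - w)
  have : (fun k => ∑ i, ‖fc (v - w) k i‖ ^ 2) = fun _ => 0 := by
    funext k; simp [fc_sub, h]
  rw [this] at h0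
  have := h0.unique hasSum_zero
  rwa [sq_eq_zero_iff, norm_eq_zero, sub_eq_zero] at this

/-- Every Hermitian square summable family is the family of Fourier coefficients of a field. -/
theorem exists_fc (a : K3 → Fin 3 → ℂ) (hs : Summable fun k => ∑ i, ‖a k i‖ ^ 2)
    (hH : ∀ k i, a (-k) i = conj (a k i)) : ∃ v : L2, ∀ k i, fc v k i = a k i := by
  have hm : ∀ i, Memℓp (fun k => a k i) 2 := fun i => by
    refine memℓp_gen ?_
    refine Summable.of_nonneg_of_le (fun k => by positivity) (fun k => ?_) hs
    simpa using Finset.single_le_sum (f := fun i => ‖a k i‖ ^ 2) (fun i _ => by positivity)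
      (Finset.mem_univ i)
  let g : Fin 3 → Lp ℂ 2 vol := fun i => fourierBasisT3.repr.symm ⟨fun k => a k i, hm i⟩
  have hg : ∀ i k, mFourierCoeff (g i) k = a k i := fun i k => by
    rw [← fourierBasisT3_repr]; simp [g]
  -- Hermitian symmetry says that `g i` and its conjugate have the same coefficients, so `g i` is
  -- real almost everywhere and nothing is lost in taking real parts below.
  have hre : ∀ i, ∀ᵐ x ∂vol, ((g i x).re : ℂ) = g i x := fun i => by
    have hmem : MemLp (fun x => conj (g i x)) 2 vol :=
      (Lp.memLp (g i)).star
    have : hmem.toLp _ = g i := by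
      apply fourierBasisT3.repr.injective
      ext k
      rw [fourierBasisT3_repr, fourierBasisT3_repr, mFourierCoeff_congr_ae hmem.coeFn_toLp]
      have : mFourierCoeff (fun x => conj (g i x)) k = conj (mFourierCoeff (g i) (-k)) := by
        rw [mFourierCoeff, mFourierCoeff, ← integral_conj]
        refine integral_congr_ae (Eventually.of_forall fun x => ?_)
        simp [mFourier_neg]
      rw [this, hg, hg, hH, Complex.conj_conj]
    filter_upwards [hmem.coeFn_toLp] with x hx
    rw [this] at hx
    exact (Complex.conj_eq_iff_re.1 hx.symm)
  have hv : MemLp (fun x => (WithLp.toLp 2 fun i => (g i x).re : E3)) 2 vol :=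
    MemLp.of_eval_piLp fun i => (Lp.memLp (g i)).re
  refine ⟨hv.toLp _, fun k i => ?_⟩
  rw [← hg]
  refine mFourierCoeff_congr_ae ?_ k
  filter_upwards [hv.coeFn_toLp, hre i] with x h1 h2
  rw [h1]; exact h2

/-! ### Fourier multipliers on `L²` -/

/-- Even Fourier multipliers which are bounded by one. -/
structure IsMult (m : K3 → ℝ) : Prop where
  even : ∀ k, m (-k) = m k
  abs_le : ∀ k, |m k| ≤ 1

open Classical in
/-- The operator on `L²` with Fourier multiplier `m`. -/
noncomputable def mulOp (m : K3 → ℝ) (v : L2) : L2 :=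
  -- The default `0` is never reached for multipliers satisfying `IsMult`, by `fc_mulOp`.
  if h : ∃ w : L2, ∀ k i, fc w k i = m k * fc v k i then h.choose else 0

theorem IsMult.sq_le {m : K3 → ℝ} (hm : IsMult m) (k : K3) : m k ^ 2 ≤ 1 := by
  rw [← sq_abs]; exact pow_le_one₀ (abs_nonneg _) (hm.abs_le k)

/-- A bound by one preserves square summability and evenness preserves Hermitian symmetry, so the
multiplied coefficients again belong to a real field. -/
theorem fc_mulOp {m : K3 → ℝ} (hm : IsMult m) (v : L2) (k : K3) (i : Fin 3) :
    fc (mulOp m v) k i = m k * fc v k i := by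
  have h : ∃ w : L2, ∀ k i, fc w k i = m k * fc v k i := by
    refine exists_fc (fun k i => m k * fc v k i) ?_ fun k i => ?_
    · refine Summable.of_nonneg_of_le (fun k => by positivity) (fun k => ?_) (hasSum_fc_sq v).summable
      refine Finset.sum_le_sum fun i _ => ?_
      rw [norm_mul, mul_pow, Complex.norm_real, Real.norm_eq_abs, sq_abs]
      exact mul_le_of_le_one_left (by positivity) (hm.sq_le k)
    · simp [hm.even, fc_neg]
  rw [mulOp, dif_pos h]
  exact h.choose_spec k i

theorem mulOp_sub {m : K3 → ℝ} (hm : IsMult m) (v w : L2) :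
    mulOp m (v - w) = mulOp m v - mulOp m w :=
  L2_ext fun k i => by simp only [fc_mulOp hm, fc_sub, mul_sub]

theorem norm_mulOp_le {m : K3 → ℝ} (hm : IsMult m) (v : L2) : ‖mulOp m v‖ ≤ ‖v‖ := by
  refine (sq_le_sq₀ (norm_nonneg _) (norm_nonneg _)).1 ?_
  refine hasSum_le (fun k => ?_) (hasSum_fc_sq _) (hasSum_fc_sq v)
  refine Finset.sum_le_sum fun i _ => ?_
  rw [fc_mulOp hm, norm_mul, mul_pow, Complex.norm_real, Real.norm_eq_abs, sq_abs]
  exact mul_le_of_le_one_left (by positivity) (hm.sq_le k)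

theorem continuous_mulOp {m : K3 → ℝ} (hm : IsMult m) : Continuous (mulOp m) := by
  refine LipschitzWith.continuous (K := 1) (LipschitzWith.of_dist_le_mul fun v w => ?_)
  rw [dist_eq_norm, dist_eq_norm, ← mulOp_sub hm, NNReal.coe_one, one_mul]
  exact norm_mulOp_le hm _

/-- Joint strong continuity of Fourier multipliers. -/
theorem tendsto_mulOp {ι : Type*} {l : Filter ι} {m : ι → K3 → ℝ} {m₀ : K3 → ℝ} {y : ι → L2}
    {y₀ : L2} (hm : ∀ᶠ n in l, IsMult (m n)) (hm₀ : IsMult m₀)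
    (h : ∀ k, Tendsto (fun n => m n k) l (𝓝 (m₀ k))) (hy : Tendsto y l (𝓝 y₀)) :
    Tendsto (fun n => mulOp (m n) (y n)) l (𝓝 (mulOp m₀ y₀)) := by
  rw [tendsto_iff_norm_sub_tendsto_zero] at hy ⊢
  have h1 : Tendsto (fun n => ‖mulOp (m n) y₀ - mulOp m₀ y₀‖) l (𝓝 0) := by
    -- Dominated convergence in Parseval's sum for the fixed field `y₀`. The factor `4` bounds `(m n
    -- k - m₀ k)²`, both multipliers having modulus at most one. The moving argument is handled at
    -- the end by contractivity.
    have h2 : Tendsto (fun n => ∑' k, ∑ i, ‖((m n k - m₀ k : ℝ) : ℂ) * fc y₀ k i‖ ^ 2) l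
        (𝓝 (∑' k : K3, (0 : ℝ))) := by
      refine tendsto_tsum_of_dominated_convergence
        (bound := fun k => 4 * ∑ i, ‖fc y₀ k i‖ ^ 2) ((hasSum_fc_sq y₀).summable.mul_left 4) ?_ ?_
      · intro k
        have : Tendsto (fun n => ∑ i, ‖((m n k - m₀ k : ℝ) : ℂ) * fc y₀ k i‖ ^ 2) l
            (𝓝 (∑ i, ‖((m₀ k - m₀ k : ℝ) : ℂ) * fc y₀ k i‖ ^ 2)) := by
          refine tendsto_finsetSum _ fun i _ => ?_
          refine (Tendsto.norm ?_).pow 2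
          refine Tendsto.mul_const _ ?_
          exact (Complex.continuous_ofReal.tendsto _).comp ((h k).sub_const _)
        simpa using this
      · filter_upwards [hm] with n hn k
        rw [Real.norm_of_nonneg (by positivity), Finset.mul_sum]
        refine Finset.sum_le_sum fun i _ => ?_
        rw [norm_mul, mul_pow, Complex.norm_real, Real.norm_eq_abs]
        gcongr
        have h3 := abs_sub (m n k) (m₀ k)
        have := hn.abs_le k
        have := hm₀.abs_le k
        nlinarith [abs_nonneg (m n k - m₀ k)]
    rw [tsum_zero] at h2
    have h3 : Tendsto (fun n => ‖mulOp (m n) y₀ - mulOp m₀ y₀‖ ^ 2) l (𝓝 0) := by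
      refine h2.congr' ?_
      filter_upwards [hm] with n hn
      rw [← (hasSum_fc_sq _).tsum_eq]
      simp only [fc_sub, fc_mulOp hn, fc_mulOp hm₀, Complex.ofReal_sub, sub_mul]
    have h4 := h3.sqrt
    simpa [Real.sqrt_sq] using h4
  have h5 := hy.add h1
  rw [add_zero] at h5
  refine squeeze_zero' (Eventually.of_forall fun n => norm_nonneg _) ?_ h5
  filter_upwards [hm] with n hn
  calc ‖mulOp (m n) (y n) - mulOp m₀ y₀‖
      = ‖mulOp (m n) (y n - y₀) + (mulOp (m n) y₀ - mulOp m₀ y₀)‖ := by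
        rw [mulOp_sub hn]; congr 1; abel
    _ ≤ _ := (norm_add_le _ _).trans (by gcongr; exact norm_mulOp_le hn _)

theorem _root_.Continuous.integrable_vol {F : Type*} [NormedAddCommGroup F] {f : T3 → F}
    (hf : Continuous f) : Integrable f vol :=
  hf.integrable_of_hasCompactSupport (HasCompactSupport.of_compactSpace f)

theorem _root_.Continuous.memLp_vol {F : Type*} [NormedAddCommGroup F] {f : T3 → F}
    (hf : Continuous f) (p : ℝ≥0∞) :
    MemLp f p vol :=
  hf.memLp_of_hasCompactSupport (HasCompactSupport.of_compactSpace f)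

/-! ### Partial derivatives on the torus through the periodic lift -/

section Calculus

variable {F : Type*} [NormedAddCommGroup F] [NormedSpace ℝ F]

theorem proj_add_smul (y : E3) (j : Fin 3) (s : ℝ) :
    proj (y + s • EuclideanSpace.single j (1 : ℝ)) =
      proj y + Pi.single j (s : UnitAddCircle) := by
  funext i
  by_cases h : i = j
  · subst h; simp [proj]
  · simp [proj, h]

theorem isOpenQuotientMap_proj : IsOpenQuotientMap proj := by
  have h : IsOpenQuotientMap fun y : Fin 3 → ℝ => fun i => (y i : UnitAddCircle) :=
    IsOpenQuotientMap.piMap fun _ => QuotientAddGroup.isOpenQuotientMap_mk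
  exact h.comp (EuclideanSpace.equiv (Fin 3) ℝ).toHomeomorph.isOpenQuotientMap

theorem proj_surjective : Function.Surjective proj := isOpenQuotientMap_proj.surjective

theorem Smooth.continuous {f : T3 → F} (hf : Smooth f) : Continuous f :=
  isOpenQuotientMap_proj.isQuotientMap.continuous_iff.2 (ContDiff.continuous hf)

theorem Smooth.hasDerivAt {f : T3 → F} (hf : Smooth f) (j : Fin 3) (y : E3) (s : ℝ) :
    HasDerivAt (fun s : ℝ => f (proj y + Pi.single j (s : UnitAddCircle)))
      (fderiv ℝ (fun y => f (proj y)) (y + s • EuclideanSpace.single j (1 : ℝ))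
        (EuclideanSpace.single j 1)) s := by
  have h1 : HasFDerivAt (fun y => f (proj y)) _ (y + s • EuclideanSpace.single j (1 : ℝ)) :=
    (ContDiff.differentiable hf (by simp)).differentiableAt.hasFDerivAt
  have h2 : HasDerivAt (fun s : ℝ => y + s • EuclideanSpace.single j (1 : ℝ))
      (EuclideanSpace.single j 1) s := by
    simpa using ((hasDerivAt_id s).smul_const (EuclideanSpace.single j (1 : ℝ))).const_add y
  have h3 := h1.comp_hasDerivAt s h2
  refine h3.congr_of_eventuallyEq (Eventually.of_forall fun s => ?_)
  simp [proj_add_smul]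

theorem Smooth.pd_proj {f : T3 → F} (hf : Smooth f) (j : Fin 3) (y : E3) :
    pd j f (proj y) = fderiv ℝ (fun y => f (proj y)) y (EuclideanSpace.single j 1) := by
  have := (hf.hasDerivAt j y 0).deriv
  rwa [zero_smul, add_zero] at this

theorem Smooth.pd {f : T3 → F} (hf : Smooth f) (j : Fin 3) : Smooth (pd j f) := by
  unfold Smooth
  simp_rw [hf.pd_proj]
  exact (ContDiff.fderiv_right hf (by simp)).clm_apply contDiff_const

theorem Smooth.hasDerivAt_pd {f : T3 → F} (hf : Smooth f) (j : Fin 3) (x : T3) (s : ℝ) :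
    HasDerivAt (fun s : ℝ => f (x + Pi.single j (s : UnitAddCircle)))
      (LambdaNSE.pd j f (x + Pi.single j (s : UnitAddCircle))) s := by
  obtain ⟨y, rfl⟩ := proj_surjective x
  rw [← proj_add_smul, hf.pd_proj]
  exact hf.hasDerivAt j y s

theorem Smooth.hasDerivAt_pd_zero {f : T3 → F} (hf : Smooth f) (j : Fin 3) (x : T3) :
    HasDerivAt (fun s : ℝ => f (x + Pi.single j (s : UnitAddCircle))) (LambdaNSE.pd j f x) 0 := by
  have := hf.hasDerivAt_pd j x 0
  simpa using this

/-- The integral of a partial derivative over the torus vanishes. -/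
theorem Smooth.integral_pd {f : T3 → F} (hf : Smooth f) (j : Fin 3) :
    ∫ x, LambdaNSE.pd j f x ∂vol = 0 := by
  obtain ⟨C, hC⟩ := isCompact_univ.exists_bound_of_continuousOn (hf.pd j).continuous.continuousOn
  have hc : ∀ (g : T3 → F), Continuous g → ∀ a : T3, Integrable (fun x => g (x + a)) vol :=
    fun g hg a => (hg.comp (continuous_add_const a)).integrable_vol
  let f₁ : ℝ → T3 → F := fun s x => f (x + Pi.single j (s : UnitAddCircle))
  let f₂ : ℝ → T3 → F := fun s x => LambdaNSE.pd j f (x + Pi.single j (s : UnitAddCircle))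
  have i₁ : ∀ s, Integrable (f₁ s) vol := fun s => hc f hf.continuous _
  have i₂ : ∀ s, Integrable (f₂ s) vol := fun s => hc _ (hf.pd j).continuous _
  have hd : ∀ x s, HasDerivAt (f₁ · x) (f₂ s x) s := fun x s => hf.hasDerivAt_pd j x s
  have hb : ∀ x s, ‖f₂ s x‖ ≤ C := fun x s => hC _ (mem_univ _)
  have h0 : f₂ 0 = LambdaNSE.pd j f := by
    funext x; simp only [f₂, QuotientAddGroup.mk_zero, Pi.single_zero, add_zero]
  -- By translation invariance the integral of the shifted function is constant in `s`, so its
  -- derivative at `0`, computed under the integral sign, vanishes.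
  have e : ∀ s, ∫ x, f₁ s x ∂vol = ∫ x, f x ∂vol := fun s => integral_add_right_eq_self f _
  clear_value f₁ f₂
  have h2 := (hasDerivAt_integral_of_dominated_loc_of_deriv_le (μ := vol) (𝕜 := ℝ) (F := f₁)
    (F' := f₂) (bound := fun _ => C) (x₀ := (0 : ℝ)) (s := univ) univ_mem
    (Eventually.of_forall fun s => (i₁ s).aestronglyMeasurable) (i₁ 0) (i₂ 0).aestronglyMeasurable
    (Eventually.of_forall fun x s _ => hb x s) (integrable_const C)
    (Eventually.of_forall fun x s _ => hd x s)).2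
  simp_rw [e, h0] at h2
  exact h2.unique (hasDerivAt_const (0 : ℝ) _)

end Calculus

/-! ### Trigonometric monomials and polynomials -/

theorem mFourier_apply_add (k : K3) (x y : T3) :
    mFourier k (x + y) = mFourier k x * mFourier k y := by
  simp [mFourier, fourier_apply, AddCircle.toCircle_add, Finset.prod_mul_distrib]

theorem mFourier_proj (k : K3) (y : E3) :
    mFourier k (proj y) = Complex.exp (2 * Real.pi * Complex.I * ∑ j, (k j : ℂ) * (y j : ℂ)) := by
  simp only [mFourier, proj, ContinuousMap.coe_mk, fourier_coe_apply]
  rw [← Complex.exp_sum, Finset.mul_sum]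
  congr 1
  refine Finset.sum_congr rfl fun i _ => ?_
  push_cast; ring

theorem smooth_mFourier (k : K3) : Smooth fun x => mFourier k x := by
  unfold Smooth
  simp_rw [mFourier_proj]
  refine Complex.contDiff_exp.comp (contDiff_const.mul (ContDiff.sum fun j _ => ?_))
  exact contDiff_const.mul (Complex.ofRealCLM.contDiff.comp (EuclideanSpace.proj j : E3 →L[ℝ] ℝ).contDiff)

theorem mFourier_single_real (k : K3) (j : Fin 3) (s : ℝ) :
    mFourier k (Pi.single j (s : UnitAddCircle)) =
      Complex.exp (2 * Real.pi * Complex.I * k j * s) := by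
  have h := mFourier_proj k (s • EuclideanSpace.single j (1 : ℝ))
  have h0 : (0 : T3) = proj 0 := by funext i; simp [proj]
  have h2 := proj_add_smul 0 j s
  rw [zero_add, ← h0, zero_add] at h2
  rw [← h2, h]
  congr 1
  simp [PiLp.single_apply, mul_assoc, apply_ite]

theorem pd_mFourier (k : K3) (j : Fin 3) (x : T3) :
    pd j (fun x => mFourier k x) x = 2 * Real.pi * Complex.I * k j * mFourier k x := by
  have h : HasDerivAt (fun s : ℝ => mFourier k x *
      Complex.exp (2 * Real.pi * Complex.I * k j * (s : ℂ)))
      (mFourier k x * (Complex.exp (2 * Real.pi * Complex.I * k j * ((0 : ℝ) : ℂ)) *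
        (2 * Real.pi * Complex.I * k j * 1))) 0 := by
    have h1 : HasDerivAt (fun s : ℝ => (2 * Real.pi * Complex.I * k j * (s : ℂ)))
      (2 * Real.pi * Complex.I * k j * 1) 0 := (HasDerivAt.ofReal_comp (hasDerivAt_id 0)).const_mul _
    exact (h1.cexp).const_mul _
  unfold pd
  simp_rw [mFourier_apply_add, mFourier_single_real]
  rw [h.deriv]
  simp [mul_comm]

/-- Real part of a trigonometric polynomial. -/
noncomputable def retp (S : Finset K3) (c : K3 → ℂ) (x : T3) : ℝ :=
  (∑ k ∈ S, c k * mFourier k x).re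

theorem smooth_retp (S : Finset K3) (c : K3 → ℂ) : Smooth (retp S c) := by
  unfold Smooth retp
  exact Complex.reCLM.contDiff.comp
    (ContDiff.sum fun k _ => contDiff_const.mul (smooth_mFourier k))

theorem pd_retp (S : Finset K3) (c : K3 → ℂ) (j : Fin 3) :
    pd j (retp S c) = retp S fun k => 2 * Real.pi * Complex.I * k j * c k := by
  funext x
  have h : HasDerivAt (fun s : ℝ => (∑ k ∈ S, c k * mFourier k (x + Pi.single j (s : UnitAddCircle))))
      (∑ k ∈ S, c k * (2 * Real.pi * Complex.I * k j * mFourier k x)) 0 := by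
    refine HasDerivAt.fun_sum fun k _ => HasDerivAt.const_mul _ ?_
    rw [← pd_mFourier]
    exact (smooth_mFourier k).hasDerivAt_pd_zero j x
  have h2 := (Complex.reCLM.hasFDerivAt.comp_hasDerivAt _ h).deriv
  refine h2.trans ?_
  simp only [retp, Complex.reCLM_apply]
  congr 1
  exact Finset.sum_congr rfl fun k _ => by ring

theorem integral_mul_retp {f : T3 → ℝ} (hf : Integrable f vol) (S : Finset K3) (c : K3 → ℂ) :
    ∫ x, f x * retp S c x ∂vol = (∑ k ∈ S, c k * fourierCoef f (-k)).re := by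
  have hi : ∀ k ∈ S, Integrable (fun x => c k * (mFourier k x * (f x : ℂ))) vol := fun k _ =>
    ((hf.ofReal (𝕜 := ℂ)).bdd_mul (c := 1) (mFourier k).continuous.aestronglyMeasurable
      (Eventually.of_forall fun x => (norm_mFourier_apply k x).le)).const_mul _
  have : ∑ k ∈ S, c k * fourierCoef f (-k)
      = ∫ x, ∑ k ∈ S, c k * (mFourier k x * (f x : ℂ)) ∂vol := by
    rw [integral_finsetSum _ hi]
    refine Finset.sum_congr rfl fun k _ => ?_
    rw [fourierCoef_eq, neg_neg, integral_const_mul]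
  rw [this]
  have h2 := integral_re (μ := vol) (𝕜 := ℂ) (integrable_finsetSum S hi)
  rw [← RCLike.re_eq_complex_re, ← h2]
  refine integral_congr_ae (Eventually.of_forall fun x => ?_)
  simp only [retp, RCLike.re_eq_complex_re]
  rw [← Complex.re_ofReal_mul, Finset.mul_sum]
  congr 1
  exact Finset.sum_congr rfl fun k _ => by ring

/-- If `k j ≠ 0`, then `∂_j` of the character is a nonzero multiple of the character, and
derivatives integrate to zero. -/
theorem integral_mFourier (k : K3) : ∫ x, mFourier k x ∂vol = if k = 0 then 1 else 0 := by
  split_ifs with h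
  · subst h; simp [mFourier_zero]
  · obtain ⟨j, hj⟩ := Function.ne_iff.1 h
    have := (smooth_mFourier k).integral_pd j
    simp_rw [pd_mFourier] at this
    rw [integral_const_mul] at this
    refine (mul_eq_zero.1 this).resolve_left ?_
    have : (k j : ℂ) ≠ 0 := by exact_mod_cast hj
    simp [Real.pi_ne_zero, this]

/-- Coefficients with the symmetry of those of a real function. -/
def Herm (c : K3 → ℂ) : Prop := ∀ k, c (-k) = conj (c k)

/-- The cube of frequencies of sup norm at most `N`. -/
noncomputable def box (N : ℕ) : Finset K3 := Fintype.piFinset fun _ => Finset.Icc (-(N : ℤ)) N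

theorem mem_box {N : ℕ} {k : K3} : k ∈ box N ↔ ∀ i, |k i| ≤ N := by
  simp [box, abs_le]

theorem neg_mem_box {N : ℕ} {k : K3} : -k ∈ box N ↔ k ∈ box N := by
  simp [mem_box]

theorem card_box (N : ℕ) : (box N).card = (2 * N + 1) ^ 3 := by
  simp [box, Fintype.card_piFinset]; omega

theorem sum_box_neg {M : Type*} [AddCommMonoid M] (N : ℕ) (f : K3 → M) :
    ∑ k ∈ box N, f (-k) = ∑ k ∈ box N, f k :=
  Finset.sum_nbij' (fun k => -k) (fun k => -k) (fun k hk => neg_mem_box.2 hk)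
    (fun k hk => neg_mem_box.2 hk) (by simp) (by simp) (by simp)

/-- The box is symmetric, so reindexing by `k ↦ -k` shows that a Hermitian polynomial equals its own
conjugate. -/
theorem ofReal_retp {N : ℕ} {c : K3 → ℂ} (hc : Herm c) (x : T3) :
    (retp (box N) c x : ℂ) = ∑ k ∈ box N, c k * mFourier k x := by
  refine Complex.conj_eq_iff_re.1 ?_
  rw [map_sum, ← sum_box_neg]
  refine Finset.sum_congr rfl fun k _ => ?_
  rw [map_mul, hc, Complex.conj_conj, mFourier_neg, Complex.conj_conj]

theorem fourierCoef_retp {N : ℕ} {c : K3 → ℂ} (hc : Herm c) (k : K3) :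
    fourierCoef (retp (box N) c) k = if k ∈ box N then c k else 0 := by
  rw [fourierCoef_eq]
  simp_rw [ofReal_retp hc, Finset.mul_sum]
  rw [integral_finsetSum]
  · have : ∀ l ∈ box N, ∫ x, mFourier (-k) x * (c l * mFourier l x) ∂vol
        = if l = k then c l else 0 := fun l _ => by
      have : ∀ x, mFourier (-k) x * (c l * mFourier l x) = c l * mFourier (l + -k) x := fun x => by
        rw [mFourier_add]; ring
      simp_rw [this]
      rw [integral_const_mul, integral_mFourier]
      simp [add_neg_eq_zero]
    rw [Finset.sum_congr rfl this]
    simp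
  · intro l _
    exact (((mFourier (-k)).continuous.mul (continuous_const.mul (mFourier l).continuous))).integrable_vol

/-- Vector fields whose components are real parts of trigonometric polynomials. -/
noncomputable def vtp (S : Finset K3) (c : K3 → Fin 3 → ℂ) (x : T3) : E3 :=
  WithLp.toLp 2 fun i => retp S (fun k => c k i) x

theorem smooth_vec {ψ : T3 → E3} : Smooth ψ ↔ ∀ i, Smooth fun x => ψ x i :=
  contDiff_euclidean

theorem Smooth.pd_comp {ψ : T3 → E3} (hψ : Smooth ψ) (j i : Fin 3) (x : T3) :
    LambdaNSE.pd j ψ x i = LambdaNSE.pd j (fun x => ψ x i) x := by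
  have h := ((EuclideanSpace.proj i : E3 →L[ℝ] ℝ).hasFDerivAt.comp_hasDerivAt _
    (hψ.hasDerivAt_pd_zero j x)).deriv
  exact h.symm

theorem smooth_vtp (S : Finset K3) (c : K3 → Fin 3 → ℂ) : Smooth (vtp S c) :=
  smooth_vec.2 fun i => smooth_retp S fun k => c k i

theorem pd_vtp (S : Finset K3) (c : K3 → Fin 3 → ℂ) (j : Fin 3) :
    pd j (vtp S c) = vtp S fun k i => 2 * Real.pi * Complex.I * k j * c k i := by
  funext x; ext i
  rw [(smooth_vtp S c).pd_comp]
  exact congrFun (pd_retp S (fun k => c k i) j) x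

/-! ### Fourier coefficients of derivatives -/

/-- Integration by parts: the derivative of the product of `f` with a character has zero integral.
-/
theorem fourierCoef_pd {f : T3 → ℝ} (hf : Smooth f) (j : Fin 3) (k : K3) :
    fourierCoef (pd j f) k = 2 * Real.pi * Complex.I * k j * fourierCoef f k := by
  have hg : Smooth fun x => mFourier (-k) x * (f x : ℂ) :=
    ContDiff.mul (smooth_mFourier (-k)) (Complex.ofRealCLM.contDiff.comp hf)
  have h := hg.integral_pd j
  have e : ∀ x, pd j (fun x => mFourier (-k) x * (f x : ℂ)) x
      = -(2 * Real.pi * Complex.I * k j) * (mFourier (-k) x * (f x : ℂ))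
        + mFourier (-k) x * ((pd j f x : ℝ) : ℂ) := fun x => by
    have h1 := (smooth_mFourier (-k)).hasDerivAt_pd_zero j x
    have h2 := (hf.hasDerivAt_pd_zero j x).ofReal_comp
    have h3 := (h1.mul h2).deriv
    refine h3.trans ?_
    rw [pd_mFourier]
    simp; ring
  simp_rw [e] at h
  rw [integral_add, integral_const_mul, ← fourierCoef_eq, ← fourierCoef_eq] at h
  · linear_combination h
  · exact (continuous_const.mul hg.continuous).integrable_vol
  · exact ((mFourier (-k)).continuous.mul
      (Complex.continuous_ofReal.comp (hf.pd j).continuous)).integrable_vol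

theorem fourierCoef_finsetSum {ι : Type*} (s : Finset ι) {f : ι → T3 → ℝ}
    (hf : ∀ i ∈ s, Integrable (f i) vol) (k : K3) :
    fourierCoef (fun x => ∑ i ∈ s, f i x) k = ∑ i ∈ s, fourierCoef (f i) k := by
  simp_rw [fourierCoef_eq]
  rw [← integral_finsetSum]
  · refine integral_congr_ae (Eventually.of_forall fun x => ?_)
    simp [Finset.mul_sum]
  · intro i hi
    exact ((hf i hi).ofReal (𝕜 := ℂ)).bdd_mul (c := 1) (mFourier _).continuous.aestronglyMeasurable
      (Eventually.of_forall fun x => (norm_mFourier_apply _ x).le)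

/-- A continuous field as an element of `L²`. -/
noncomputable def contL2 {ψ : T3 → E3} (h : Continuous ψ) : L2 := (h.memLp_vol 2).toLp ψ

theorem coeFn_contL2 {ψ : T3 → E3} (h : Continuous ψ) : contL2 h =ᵐ[vol] ψ :=
  MemLp.coeFn_toLp _

theorem fc_contL2 {ψ : T3 → E3} (h : Continuous ψ) (k : K3) (i : Fin 3) :
    fc (contL2 h) k i = fourierCoef (fun x => ψ x i) k :=
  fourierCoef_congr_ae ((coeFn_contL2 h).mono fun x hx => by simp only [hx]) k

theorem integral_inner_eq (v : L2) {ψ : T3 → E3} (h : Continuous ψ) :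
    ∫ x, inner ℝ (v x) (ψ x) ∂vol = inner ℝ v (contL2 h) := by
  rw [L2.inner_def]
  exact integral_congr_ae ((coeFn_contL2 h).mono fun x hx => by simp only [hx])

theorem integral_inner_vtp (v : L2) (S : Finset K3) (c : K3 → Fin 3 → ℂ) :
    ∫ x, inner ℝ (v x) (vtp S c x) ∂vol = (∑ k ∈ S, ∑ i, c k i * fc v (-k) i).re := by
  have hint : ∀ i, Integrable (fun x => v x i) vol := fun i =>
    ((Lp.memLp v).eval_piLp i).integrable (by norm_num)
  have : ∀ i, Integrable (fun x => v x i * retp S (fun k => c k i) x) vol := fun i => by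
    obtain ⟨C, hC⟩ := isCompact_univ.exists_bound_of_continuousOn
      (smooth_retp S fun k => c k i).continuous.continuousOn
    exact (hint i).mul_bdd (c := C) (smooth_retp S fun k => c k i).continuous.aestronglyMeasurable
      (Eventually.of_forall fun x => hC x (mem_univ x))
  rw [Finset.sum_comm, Complex.re_sum]
  simp_rw [fc]
  rw [Finset.sum_congr rfl fun i _ => (integral_mul_retp (hint i) S fun k => c k i).symm,
    ← integral_finsetSum _ fun i _ => this i]
  refine integral_congr_ae (Eventually.of_forall fun x => ?_)
  simp [PiLp.inner_apply, vtp, mul_comm]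

theorem Smooth.lap {ψ : T3 → E3} (hψ : Smooth ψ) : Smooth (lap ψ) :=
  ContDiff.sum fun j _ => (hψ.pd j).pd j

theorem fourierCoef_lap {ψ : T3 → E3} (hψ : Smooth ψ) (k : K3) (i : Fin 3) :
    fourierCoef (fun x => lap ψ x i) k
      = -((2 * Real.pi) ^ 2 * ∑ j, (k j : ℝ) ^ 2 : ℝ) * fourierCoef (fun x => ψ x i) k := by
  have h1 : ∀ x, lap ψ x i = ∑ j, pd j (pd j fun x => ψ x i) x := fun x => by
    simp only [LambdaNSE.lap, WithLp.ofLp_sum, Finset.sum_apply]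
    refine Finset.sum_congr rfl fun j _ => ?_
    rw [(hψ.pd j).pd_comp]
    congr 1
    funext x; exact hψ.pd_comp j i x
  have hs := smooth_vec.1 hψ i
  simp_rw [h1]
  rw [fourierCoef_finsetSum _ fun j _ => ((hs.pd j).pd j).continuous.integrable_vol]
  simp_rw [fourierCoef_pd (hs.pd _), fourierCoef_pd hs]
  push_cast
  rw [Finset.mul_sum, ← Finset.sum_neg_distrib, Finset.sum_mul]
  refine Finset.sum_congr rfl fun j _ => ?_
  linear_combination (2 * Real.pi * k j) ^ 2 * fourierCoef (fun x => ψ x i) k * Complex.I_sq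

theorem sum_fourierCoef_of_dvg {ψ : T3 → E3} (hψ : Smooth ψ) (h : ∀ x, dvg ψ x = 0) (k : K3) :
    ∑ j, (k j : ℂ) * fourierCoef (fun x => ψ x j) k = 0 := by
  have hs := smooth_vec.1 hψ
  have h1 : fourierCoef (fun x => ∑ j, pd j (fun x => ψ x j) x) k = 0 := by
    have : (fun x => ∑ j, pd j (fun x => ψ x j) x) = fun _ => (0 : ℝ) := by
      funext x
      rw [← h x, dvg]
      exact Finset.sum_congr rfl fun j _ => (hψ.pd_comp j j x).symm
    rw [this, fourierCoef_eq]; simp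
  rw [fourierCoef_finsetSum _ fun j _ => ((hs j).pd j).continuous.integrable_vol] at h1
  simp_rw [fourierCoef_pd (hs _)] at h1
  have h2 : (2 * Real.pi * Complex.I) * ∑ j, (k j : ℂ) * fourierCoef (fun x => ψ x j) k = 0 := by
    rw [← h1, Finset.mul_sum]
    exact Finset.sum_congr rfl fun j _ => by ring
  refine (mul_eq_zero.1 h2).resolve_left ?_
  simp [Real.pi_ne_zero]

theorem smooth_grad {θ : T3 → ℝ} (hθ : Smooth θ) : Smooth (grad θ) :=
  smooth_vec.2 fun i => hθ.pd i

/-- A field is weakly divergence free iff its Fourier coefficients are orthogonal to `k`. -/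
theorem weaklyDivFree_iff (v : L2) :
    WeaklyDivFree v ↔ ∀ k : K3, ∑ j, (k j : ℂ) * fc v k j = 0 := by
  constructor
  · intro h k
    -- The test function is the real part of `ζ i` times the character of frequency `-k`. The
    -- choices `ζ = 1` and `ζ = -i` then isolate the real and imaginary parts of `k · v̂(k)`.
    have key : ∀ ζ : ℂ, (ζ * ∑ j, (k j : ℂ) * fc v k j).re = 0 := fun ζ => by
      have h1 := h (retp {-k} fun _ => ζ * Complex.I) (smooth_retp _ _)
      have h2 : grad (retp {-k} fun _ => ζ * Complex.I) =
          vtp {-k} fun l j => 2 * Real.pi * Complex.I * l j * (ζ * Complex.I) := by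
        funext x; ext j
        simp only [grad, vtp]
        exact congrFun (pd_retp _ _ j) x
      rw [h2, integral_inner_vtp] at h1
      have h3 : ∑ l ∈ {-k}, ∑ i, 2 * Real.pi * Complex.I * (l i : ℂ) * (ζ * Complex.I) * fc v (-l) i
          = ((2 * Real.pi : ℝ) : ℂ) * (ζ * ∑ j, (k j : ℂ) * fc v k j) := by
        rw [Finset.sum_singleton, Finset.mul_sum, Finset.mul_sum]
        refine Finset.sum_congr rfl fun j _ => ?_
        rw [neg_neg, Pi.neg_apply]
        push_cast
        linear_combination (-(2 * Real.pi * k j * ζ * fc v k j)) * Complex.I_sq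
      rw [h3, Complex.re_ofReal_mul] at h1
      exact (mul_eq_zero.1 h1).resolve_left (by positivity)
    apply Complex.ext
    · simpa using key 1
    · simpa using key (-Complex.I)
  · intro h θ hθ
    rw [integral_inner_eq v (smooth_grad hθ).continuous]
    refine (hasSum_fc_inner v _).unique ?_
    convert hasSum_zero with k
    simp_rw [fc_contL2]
    have h1 : ∀ j, fourierCoef (fun x => grad θ x j) k
        = 2 * Real.pi * Complex.I * k j * fourierCoef θ k := fun j => fourierCoef_pd hθ j k
    simp_rw [h1]
    rw [← Complex.re_sum]
    have h2 := congrArg conj (h k)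
    simp only [map_sum, map_mul, map_zero, map_intCast] at h2
    have h3 : ∑ j, conj (fc v k j) * (2 * Real.pi * Complex.I * k j * fourierCoef θ k)
        = 2 * Real.pi * Complex.I * fourierCoef θ k * ∑ j, (k j : ℂ) * conj (fc v k j) := by
      rw [Finset.mul_sum]
      exact Finset.sum_congr rfl fun j _ => by ring
    rw [h3, h2]; simp

theorem meanFree_iff (v : L2) : MeanFree v ↔ ∀ i, fc v 0 i = 0 := by
  have hint : Integrable v vol := (Lp.memLp v).integrable (by norm_num)
  have h : ∀ i, fc v 0 i = (((∫ x, v x ∂vol) i : ℝ) : ℂ) := fun i => by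
    have := (EuclideanSpace.proj i : E3 →L[ℝ] ℝ).integral_comp_comm hint
    have h' : (∫ x, v x ∂vol) i = ∫ x, v x i ∂vol := this.symm
    rw [h', fc, fourierCoef_eq, ← integral_complex_ofReal]
    simp [mFourier_zero]
  simp_rw [h]
  constructor
  · intro h i; rw [MeanFree] at h; simp [h]
  · intro h; ext i; simpa using h i

/-! ### Evolution equations whose Lipschitz constant is integrable but singular at time zero -/

/-- `A` is a nonnegative primitive on `[0,T]` of the nonnegative integrable function `L`, which may
be singular at `0`. -/
structure IsWeight (T : ℝ) (L A : ℝ → ℝ) : Prop where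
  nonneg : ∀ t ∈ Icc 0 T, 0 ≤ A t
  cont : Continuous A
  hasDerivAt : ∀ t ∈ Ioo 0 T, HasDerivAt A (L t) t
  pos : ∀ t ∈ Ioc 0 T, 0 ≤ L t
  integrable : IntervalIntegrable L volume 0 T

theorem IsWeight.integrable_of_mem {T : ℝ} {L A : ℝ → ℝ} (h : IsWeight T L A) {t : ℝ}
    (ht : t ∈ Icc 0 T) : IntervalIntegrable L volume 0 t :=
  h.integrable.mono_set (by rw [uIcc_of_le ht.1, uIcc_of_le (ht.1.trans ht.2)]; exact Icc_subset_Icc_right ht.2)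

theorem IsWeight.integrable_exp {T : ℝ} {L A : ℝ → ℝ} (h : IsWeight T L A) {t : ℝ}
    (ht : t ∈ Icc 0 T) : IntervalIntegrable (fun s => L s * Real.exp (2 * A s)) volume 0 t :=
  (h.integrable_of_mem ht).mul_continuousOn
    (Real.continuous_exp.comp (continuous_const.mul h.cont)).continuousOn

/-- The integrand is the derivative of `exp (2 * A s) / 2`. The `2` in the exponent of the weight is
what produces the factor one half. -/
theorem IsWeight.integral_exp_le {T : ℝ} {L A : ℝ → ℝ} (h : IsWeight T L A) {t : ℝ}
    (ht : t ∈ Icc 0 T) : ∫ s in (0 : ℝ)..t, L s * Real.exp (2 * A s) ≤ Real.exp (2 * A t) / 2 := by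
  have := intervalIntegral.integral_eq_sub_of_hasDerivAt_of_le ht.1
    (f := fun s => Real.exp (2 * A s) / 2)
    ((Real.continuous_exp.comp (continuous_const.mul h.cont)).div_const 2).continuousOn
    (f' := fun s => L s * Real.exp (2 * A s)) (fun s hs => by
      -- The derivative of `A` is needed only on the open interval, which is why a blow-up of `L` at
      -- `0` does no harm.
      have h1 := (((h.hasDerivAt s ⟨hs.1, hs.2.trans_le ht.2⟩).const_mul 2).exp).div_const 2
      exact h1.congr_deriv (by ring)) (h.integrable_exp ht)
  rw [this]
  have := Real.exp_pos (2 * A 0)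
  linarith

/-- The basic estimate of the weighted Picard iteration. -/
theorem IsWeight.norm_integral_le {X : Type*} [NormedAddCommGroup X] [NormedSpace ℝ X] {T : ℝ}
    {L A : ℝ → ℝ} (h : IsWeight T L A) {t D : ℝ} (ht : t ∈ Icc 0 T) (hD : 0 ≤ D) {f : ℝ → X}
    (hf : ∀ s ∈ Ioc 0 t, ‖f s‖ ≤ L s * Real.exp (2 * A s) * D) :
    ‖∫ s in (0 : ℝ)..t, f s‖ ≤ Real.exp (2 * A t) * (D / 2) := by
  have h1 := intervalIntegral.norm_integral_le_of_norm_le (μ := volume) ht.1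
    (Eventually.of_forall hf) ((h.integrable_exp ht).mul_const D)
  rw [intervalIntegral.integral_mul_const] at h1
  have := mul_le_mul_of_nonneg_right (h.integral_exp_le ht) hD
  linarith

theorem intervalIntegrable_of_bound {X : Type*} [NormedAddCommGroup X] {T : ℝ} (hT : 0 ≤ T)
    {L : ℝ → ℝ} (hL : IntervalIntegrable L volume 0 T) {f : ℝ → X} (hf : ContinuousOn f (Ioc 0 T))
    (hb : ∀ s ∈ Ioc 0 T, ‖f s‖ ≤ L s) : IntervalIntegrable f volume 0 T := by
  rw [intervalIntegrable_iff_integrableOn_Ioc_of_le hT] at hL ⊢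
  exact hL.mono' (hf.aestronglyMeasurable measurableSet_Ioc)
    ((ae_restrict_iff' measurableSet_Ioc).2 (Eventually.of_forall hb))

/-- Global flow of a differential equation whose right-hand side is Lipschitz with a constant which
is integrable in time. -/
theorem exists_flow {X : Type*} [NormedAddCommGroup X] [NormedSpace ℝ X] [CompleteSpace X]
    {T B : ℝ} {L A : ℝ → ℝ} (hT : 0 < T) (hA : IsWeight T L A) (g : ℝ → X → X)
    (hcont : ∀ y : ℝ → X, Continuous y → ContinuousOn (fun s => g s (y s)) (Ioc 0 T))
    (hlip : ∀ s ∈ Ioc 0 T, ∀ x y, ‖g s x - g s y‖ ≤ L s * ‖x - y‖)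
    (hbd : ∀ s ∈ Ioc 0 T, ∀ x, ‖g s x‖ ≤ L s * B) :
    ∃ Y : ℝ → X → X, (∀ x, Continuous fun t => Y t x) ∧
      (∀ x, ∀ t ∈ Icc 0 T, Y t x = x + ∫ s in (0 : ℝ)..t, g s (Y s x)) ∧
      ∀ t ∈ Icc 0 T, Continuous (Y t) := by
  -- The fixed point unknown is `exp (-2A)` times the trajectory; `ext` restores the trajectory,
  -- freezing `y` at its endpoint values outside `[0,T]`.
  let ext : C(Icc 0 T, X) → ℝ → X := fun y s => Real.exp (2 * A s) • y (projIcc 0 T hT.le s)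
  have hext : ∀ y, Continuous (ext y) := fun y =>
    (Real.continuous_exp.comp (continuous_const.mul hA.cont)).smul
      (y.continuous.comp continuous_projIcc)
  have hint : ∀ y : ℝ → X, Continuous y → IntervalIntegrable (fun s => g s (y s)) volume 0 T :=
    fun y hy => intervalIntegrable_of_bound hT.le (hA.integrable.mul_const B) (hcont y hy)
      fun s hs => hbd s hs _
  have hint' : ∀ y : ℝ → X, Continuous y → ∀ t ∈ Icc 0 T,
      IntervalIntegrable (fun s => g s (y s)) volume 0 t := fun y hy t ht =>
    (hint y hy).mono_set (by
      rw [uIcc_of_le ht.1, uIcc_of_le hT.le]; exact Icc_subset_Icc_right ht.2)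
  have hprim : ∀ y : ℝ → X, Continuous y →
      ContinuousOn (fun t => ∫ s in (0 : ℝ)..t, g s (y s)) (Icc 0 T) := fun y hy => by
    have := intervalIntegral.continuousOn_primitive_interval' (hint y hy) left_mem_uIcc
    rwa [uIcc_of_le hT.le] at this
  let Φ : X → C(Icc 0 T, X) → C(Icc 0 T, X) := fun x y =>
    ⟨fun t => Real.exp (-(2 * A t)) • (x + ∫ s in (0 : ℝ)..t, g s (ext y s)), by
      refine Continuous.smul ?_ (continuous_const.add ?_)
      · exact Real.continuous_exp.comp
          (continuous_const.mul (hA.cont.comp continuous_subtype_val)).neg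
      · exact continuousOn_iff_continuous_domRestrict.1 (hprim _ (hext y))⟩
  -- In the weighted sup norm the contraction factor is one half however large `∫ L` is, so a single
  -- fixed point covers all of `[0,T]`.
  have hΦ : ∀ x, ContractingWith (1 / 2) (Φ x) := fun x => by
    refine ⟨by norm_num, LipschitzWith.of_dist_le_mul fun y z => ?_⟩
    refine (ContinuousMap.dist_le (by positivity)).2 fun t => ?_
    have h1 : Φ x y t - Φ x z t = Real.exp (-(2 * A t)) •
        ∫ s in (0 : ℝ)..t, (g s (ext y s) - g s (ext z s)) := by
      rw [intervalIntegral.integral_sub (hint' _ (hext y) _ t.2) (hint' _ (hext z) _ t.2)]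
      simp only [Φ, ContinuousMap.coe_mk, ← smul_sub, add_sub_add_left_eq_sub]
    rw [dist_eq_norm, h1, norm_smul, Real.norm_of_nonneg (Real.exp_nonneg _)]
    have h2 := hA.norm_integral_le (D := dist y z) t.2 dist_nonneg
      (f := fun s => g s (ext y s) - g s (ext z s)) fun s hs => by
        have hs' : s ∈ Ioc 0 T := ⟨hs.1, hs.2.trans t.2.2⟩
        refine (hlip s hs' _ _).trans ?_
        rw [mul_assoc]
        refine mul_le_mul_of_nonneg_left ?_ (hA.pos s hs')
        rw [← smul_sub, norm_smul, Real.norm_of_nonneg (Real.exp_nonneg _), ← dist_eq_norm]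
        exact mul_le_mul_of_nonneg_left (ContinuousMap.dist_apply_le_dist _) (Real.exp_nonneg _)
    calc _ ≤ Real.exp (-(2 * A t)) * (Real.exp (2 * A t) * (dist y z / 2)) := by gcongr
      _ = dist y z / 2 := by rw [← mul_assoc, ← Real.exp_add]; simp
      _ = _ := by simp; ring
  let fp : X → C(Icc 0 T, X) := fun x => (hΦ x).fixedPoint
  have hfp : ∀ x, Φ x (fp x) = fp x := fun x => (hΦ x).fixedPoint_isFixedPt
  refine ⟨fun t x => ext (fp x) t, fun x => hext _, fun x t ht => ?_, fun t ht => ?_⟩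
  · have h1 := congrArg (fun y : C(Icc 0 T, X) => y ⟨t, ht⟩) (hfp x)
    simp only [ext, projIcc_of_mem hT.le ht]
    rw [← h1]
    simp only [Φ, ContinuousMap.coe_mk, smul_smul, ← Real.exp_add]
    simp [ext]
  -- Since `A ≥ 0`, changing the datum moves `Φ` by at most `dist x x'`; the fixed points then
  -- differ by at most `(1 - 1/2)⁻¹ = 2` times as much.
  · have hl : ∀ x x', dist (fp x) (fp x') ≤ 2 * dist x x' := fun x x' => by
      have := ContractingWith.fixedPoint_lipschitz_in_map (hΦ x) (hΦ x') (C := dist x x')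
        fun z => (ContinuousMap.dist_le dist_nonneg).2 fun t => by
          have h1 : Φ x z t - Φ x' z t = Real.exp (-(2 * A t)) • (x - x') := by
            simp only [Φ, ContinuousMap.coe_mk, ← smul_sub, add_sub_add_right_eq_sub]
          rw [dist_eq_norm, h1, norm_smul, Real.norm_of_nonneg (Real.exp_nonneg _), ← dist_eq_norm]
          refine mul_le_of_le_one_left dist_nonneg (Real.exp_le_one_iff.2 ?_)
          have := hA.nonneg t t.2
          linarith
      refine this.trans (le_of_eq ?_)
      norm_num; ring
    have hc : Continuous fp := (LipschitzWith.of_dist_le_mul (K := 2) hl).continuous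
    exact continuous_const.smul ((continuous_eval_const _).comp hc)

/-- Powers of time with exponent `-7/8` have an explicit primitive. -/
theorem isWeight_rpow {T K : ℝ} (hK : 0 ≤ K) :
    IsWeight T (fun s => K * s ^ (-(7 / 8) : ℝ)) fun s => 8 * K * s ^ (1 / 8 : ℝ) where
  nonneg t ht := by have := ht.1; positivity
  cont := continuous_const.mul (Real.continuous_rpow_const (by norm_num))
  hasDerivAt t ht := by
    have := (Real.hasDerivAt_rpow_const (p := 1 / 8) (Or.inl ht.1.ne')).const_mul (8 * K)
    refine this.congr_deriv ?_
    have e : (1 / 8 - 1 : ℝ) = -(7 / 8) := by norm_num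
    rw [e]; ring
  pos t ht := by have := ht.1; positivity
  integrable := (intervalIntegral.intervalIntegrable_rpow' (by norm_num)).const_mul K

/-! ### The frequency cut-off -/

/-- The multiplier `φ(k/L)`. -/
noncomputable def cut (φ : E3 → ℝ) (L : ℝ) (k : K3) : ℝ := φ (L⁻¹ • freq k)

theorem freq_neg (k : K3) : freq (-k) = -freq k := by
  ext i; simp [freq]

theorem isMult_cut {φ : E3 → ℝ} (hφ : IsCutoff φ) (L : ℝ) : IsMult (cut φ L) where
  even k := hφ.radial _ _ (by rw [freq_neg, smul_neg, norm_neg])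
  abs_le k := by
    have := hφ.mem_Icc (L⁻¹ • freq k)
    exact abs_le.2 ⟨by rw [cut]; linarith [this.1], this.2⟩

theorem abs_le_norm_freq (k : K3) (i : Fin 3) : |(k i : ℝ)| ≤ ‖freq k‖ := by
  have := PiLp.norm_apply_le (freq k) i
  simpa [freq] using this

theorem cut_eq_zero {φ : E3 → ℝ} (hφ : IsCutoff φ) {L : ℝ} (hL : 0 < L) {N : ℕ} (hN : 2 * L ≤ N)
    {k : K3} (hk : k ∉ box N) : cut φ L k = 0 := by
  rw [mem_box] at hk
  push Not at hk
  obtain ⟨i, hi⟩ := hk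
  refine hφ.eq_zero _ ?_
  rw [norm_smul, norm_inv, Real.norm_of_nonneg hL.le, inv_mul_eq_div, le_div_iff₀ hL]
  have h1 : (N : ℝ) < |(k i : ℝ)| := by exact_mod_cast hi
  exact hN.trans (h1.le.trans (abs_le_norm_freq k i))

/-- Any `N ≥ 2L` is allowed, so that truncations at different times can be written over one common
box. -/
theorem lowPass_eq {φ : E3 → ℝ} (hφ : IsCutoff φ) {L : ℝ} (hL : 0 < L) {N : ℕ} (hN : 2 * L ≤ N)
    (f : T3 → ℝ) : lowPass φ L f = retp (box N) fun k => cut φ L k * fourierCoef f k := by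
  funext x
  rw [lowPass, retp, tsum_eq_sum (s := box N)]
  · rfl
  · intro k hk
    have := cut_eq_zero hφ hL hN hk
    rw [cut] at this
    simp [this]

theorem herm_cut_mul {m : K3 → ℝ} (hm : IsMult m) {c : K3 → ℂ} (hc : Herm c) :
    Herm fun k => m k * c k := fun k => by
  simp [hm.even, hc k]

theorem herm_fourierCoef (f : T3 → ℝ) : Herm (fourierCoef f) := fourierCoef_neg f

theorem box_mono {N N' : ℕ} (h : N ≤ N') : box N ⊆ box N' := fun k hk => by
  rw [mem_box] at *
  exact fun i => (hk i).trans (by exact_mod_cast h)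

/-! ### The nonlinearity on the Fourier side -/

/-- Fourier coefficients of `(a · ∇) b` for trigonometric polynomials. -/
noncomputable def advect (N : ℕ) (a b : K3 → Fin 3 → ℂ) (k : K3) (i : Fin 3) : ℂ :=
  ∑ l ∈ box N, ∑ n ∈ box N,
    if l + n = k then (∑ j, a l j * (2 * Real.pi * Complex.I * n j)) * b n i else 0

theorem fourierCoef_advect {N : ℕ} {a b : K3 → Fin 3 → ℂ} (ha : ∀ i, Herm fun k => a k i)
    (hb : ∀ i, Herm fun k => b k i) (k : K3) (i : Fin 3) :
    fourierCoef (fun x => (∑ j, vtp (box N) a x j • pd j (vtp (box N) b) x) i) k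
      = advect N a b k i := by
  have hb' : ∀ j, Herm fun k => 2 * Real.pi * Complex.I * k j * b k i := fun j k => by
    have := hb i k
    simp only at this
    simp [this, map_ofNat]
  have h1 : ∀ x, ((((∑ j, vtp (box N) a x j • pd j (vtp (box N) b) x) i : ℝ)) : ℂ) =
      ∑ l ∈ box N, ∑ n ∈ box N,
        ((∑ j, a l j * (2 * Real.pi * Complex.I * n j)) * b n i) * mFourier (l + n) x := fun x => by
    simp only [pd_vtp, WithLp.ofLp_sum, Finset.sum_apply, PiLp.smul_apply, smul_eq_mul]
    push_cast
    simp only [vtp]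
    simp_rw [ofReal_retp (ha _), ofReal_retp (hb' _), Finset.sum_mul_sum]
    rw [Finset.sum_comm]
    refine Finset.sum_congr rfl fun l _ => ?_
    rw [Finset.sum_comm]
    refine Finset.sum_congr rfl fun n _ => ?_
    rw [Finset.sum_mul, Finset.sum_mul]
    refine Finset.sum_congr rfl fun j _ => ?_
    rw [mFourier_add]; ring
  rw [fourierCoef_eq]
  simp_rw [h1, Finset.mul_sum]
  have hint : ∀ l n : K3, Integrable (fun x => mFourier (-k) x *
      (((∑ j, a l j * (2 * Real.pi * Complex.I * n j)) * b n i) * mFourier (l + n) x)) vol :=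
    fun l n => ((mFourier (-k)).continuous.mul
      (continuous_const.mul (mFourier (l + n)).continuous)).integrable_vol
  rw [integral_finsetSum _ fun l _ => integrable_finsetSum _ fun n _ => hint l n, advect]
  refine Finset.sum_congr rfl fun l _ => ?_
  rw [integral_finsetSum _ fun n _ => hint l n]
  refine Finset.sum_congr rfl fun n _ => ?_
  have : ∀ x, mFourier (-k) x *
      (((∑ j, a l j * (2 * Real.pi * Complex.I * n j)) * b n i) * mFourier (l + n) x) =
      ((∑ j, a l j * (2 * Real.pi * Complex.I * n j)) * b n i) * mFourier (l + n + -k) x :=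
    fun x => by rw [mFourier_add (m := l + n)]; ring
  simp_rw [this]
  rw [integral_const_mul, integral_mFourier]
  simp [add_neg_eq_zero]

/-- Inherited from reality: these are the Fourier coefficients of the real field `(a · ∇) b`. -/
theorem herm_advect {N : ℕ} {a b : K3 → Fin 3 → ℂ} (ha : ∀ i, Herm fun k => a k i)
    (hb : ∀ i, Herm fun k => b k i) (i : Fin 3) : Herm fun k => advect N a b k i := fun k => by
  simp only [← fourierCoef_advect ha hb]
  exact fourierCoef_neg _ k

/-- For each of the `(2N+1)³` values of `l` only `n = k - l` contributes, and its symbol is a sum of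
three terms of size at most `2πN · A`. -/
theorem norm_advect_le {N : ℕ} {a b : K3 → Fin 3 → ℂ} {A B : ℝ} (ha : ∀ k i, ‖a k i‖ ≤ A)
    (hb : ∀ k i, ‖b k i‖ ≤ B) (k : K3) (i : Fin 3) :
    ‖advect N a b k i‖ ≤ (2 * N + 1) ^ 3 * (6 * Real.pi * N) * A * B := by
  have hA : 0 ≤ A := (norm_nonneg _).trans (ha 0 0)
  have hB : 0 ≤ B := (norm_nonneg _).trans (hb 0 0)
  have h1 : ∀ l ∈ box N, ‖∑ n ∈ box N,
      if l + n = k then (∑ j, a l j * (2 * Real.pi * Complex.I * n j)) * b n i else 0‖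
      ≤ 6 * Real.pi * N * A * B := fun l _ => by
    have : ∀ n : K3, l + n = k ↔ n = k - l := fun n => by
      rw [eq_sub_iff_add_eq, add_comm]
    simp_rw [this]
    rw [Finset.sum_ite_eq']
    split_ifs with h
    · rw [norm_mul]
      refine mul_le_mul ?_ (hb _ _) (norm_nonneg _) (by positivity)
      refine (norm_sum_le _ _).trans ?_
      have h2 : ∀ j ∈ Finset.univ, ‖a l j * (2 * Real.pi * Complex.I * ((k - l) j : ℤ))‖
          ≤ A * (2 * Real.pi * N) := fun j _ => by
        rw [norm_mul]
        refine mul_le_mul (ha _ _) ?_ (norm_nonneg _) hA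
        have h3 : |(((k - l) j : ℤ) : ℝ)| ≤ N := by exact_mod_cast mem_box.1 h j
        simp only [norm_mul, Complex.norm_I, mul_one, Complex.norm_real, Complex.norm_intCast,
          Complex.norm_ofNat, Real.norm_of_nonneg Real.pi_pos.le]
        gcongr
      refine (Finset.sum_le_sum h2).trans (le_of_eq ?_)
      simp; ring
    · simp; positivity
  refine (norm_sum_le _ _).trans ((Finset.sum_le_sum h1).trans (le_of_eq ?_))
  rw [Finset.sum_const, card_box, nsmul_eq_mul]
  push_cast; ring

/-- Polarization, which turns the bilinear bound into a Lipschitz bound for the quadratic map. -/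
theorem advect_self_sub (N : ℕ) (a b : K3 → Fin 3 → ℂ) (k : K3) (i : Fin 3) :
    advect N a a k i - advect N b b k i = advect N (a - b) a k i + advect N b (a - b) k i := by
  simp only [advect, ← Finset.sum_sub_distrib, ← Finset.sum_add_distrib]
  refine Finset.sum_congr rfl fun l _ => Finset.sum_congr rfl fun n _ => ?_
  split_ifs
  · simp only [Pi.sub_apply, sub_mul, Finset.sum_sub_distrib]; ring
  · simp

theorem advect_smul (N : ℕ) (c : ℂ) (a : K3 → Fin 3 → ℂ) (k : K3) (i : Fin 3) :
    advect N (c • a) (c • a) k i = c ^ 2 * advect N a a k i := by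
  simp only [advect, Finset.mul_sum]
  refine Finset.sum_congr rfl fun l _ => Finset.sum_congr rfl fun n _ => ?_
  split_ifs
  · simp only [Pi.smul_apply, smul_eq_mul, Finset.mul_sum, Finset.sum_mul]
    exact Finset.sum_congr rfl fun j _ => by ring
  · simp

theorem advect_congr_box {N N' : ℕ} (h : N ≤ N') {a b : K3 → Fin 3 → ℂ}
    (ha : ∀ k ∉ box N, ∀ i, a k i = 0) (hb : ∀ k ∉ box N, ∀ i, b k i = 0) (k : K3) (i : Fin 3) :
    advect N' a b k i = advect N a b k i := by
  rw [advect, advect]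
  refine (Finset.sum_subset (box_mono h) fun l _ hl => ?_).symm.trans
    (Finset.sum_congr rfl fun l _ => ?_)
  · exact Finset.sum_eq_zero fun n _ => by simp [ha l hl]
  · exact (Finset.sum_subset (box_mono h) fun n _ hn => by simp [hb n hn]).symm

/-- The energy cancellation `∫ (a · ∇ a) · a = 0` for a divergence-free field. -/
theorem sum_conj_mul_advect {N : ℕ} {a : K3 → Fin 3 → ℂ} (ha : ∀ i, Herm fun k => a k i)
    (hdiv : ∀ k, ∑ j, (k j : ℂ) * a k j = 0) :
    ∑ k ∈ box N, ∑ i, conj (a k i) * advect N a a k i = 0 := by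
  set f : K3 → K3 → K3 → ℂ := fun l k n => if l + n = k then
    (2 * Real.pi * Complex.I * ∑ j, (n j : ℂ) * a l j) * ∑ i, a n i * conj (a k i) else 0 with hf
  have h1 : ∑ k ∈ box N, ∑ i, conj (a k i) * advect N a a k i
      = ∑ l ∈ box N, ∑ k ∈ box N, ∑ n ∈ box N, f l k n := by
    rw [Finset.sum_comm (s := box N) (t := box N)]
    refine Finset.sum_congr rfl fun k _ => ?_
    simp only [advect, Finset.mul_sum]
    rw [Finset.sum_comm]
    refine Finset.sum_congr rfl fun l _ => ?_
    rw [Finset.sum_comm]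
    refine Finset.sum_congr rfl fun n _ => ?_
    simp only [hf]
    split_ifs
    · rw [Finset.mul_sum]
      refine Finset.sum_congr rfl fun i _ => ?_
      rw [Finset.mul_sum, Finset.sum_mul, Finset.sum_mul, Finset.mul_sum]
      exact Finset.sum_congr rfl fun j _ => by ring
    · simp
  -- The exchange `(k, n) ↦ (-n, -k)` preserves the triad relation `l + n = k`. It flips the sign
  -- because `k · a(l) = n · a(l)`, by `l · a(l) = 0`. As the box is symmetric, the sum over `(k,
  -- n)` equals its own negative for each `l`.
  have h2 : ∀ l k n, f l (-n) (-k) = - f l k n := fun l k n => by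
    have e : l + -k = -n ↔ l + n = k := by
      constructor <;> intro h
      · rw [← sub_eq_add_neg, sub_eq_iff_eq_add] at h; rw [h]; abel
      · rw [← h]; abel
    simp only [hf, e]
    split_ifs with h
    · have ha' : ∀ k i, a (-k) i = conj (a k i) := fun k i => ha i k
      simp only [ha', Complex.conj_conj]
      have h3 : ∑ j, (((-k) j : ℤ) : ℂ) * a l j = - ∑ j, (n j : ℂ) * a l j := by
        rw [← h, ← Finset.sum_neg_distrib, ← sub_eq_zero, ← Finset.sum_sub_distrib,
          ← neg_eq_zero, ← Finset.sum_neg_distrib, ← hdiv l]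
        exact Finset.sum_congr rfl fun j _ => by simp; ring
      rw [h3]
      have h4 : ∑ i, conj (a k i) * a n i = ∑ i, a n i * conj (a k i) :=
        Finset.sum_congr rfl fun i _ => mul_comm _ _
      rw [h4]; ring
    · simp
  have h5 : ∀ l, ∑ k ∈ box N, ∑ n ∈ box N, f l k n = 0 := fun l => by
    have : ∑ k ∈ box N, ∑ n ∈ box N, f l k n = - ∑ k ∈ box N, ∑ n ∈ box N, f l k n := by
      calc ∑ k ∈ box N, ∑ n ∈ box N, f l k n = ∑ n ∈ box N, ∑ k ∈ box N, f l k n :=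
            Finset.sum_comm
        _ = ∑ n ∈ box N, ∑ k ∈ box N, f l (-k) (-n) := by
            rw [← sum_box_neg]
            refine Finset.sum_congr rfl fun n _ => ?_
            rw [← sum_box_neg]
        _ = _ := by simp_rw [h2, Finset.sum_neg_distrib]
    exact self_eq_neg.1 this
  rw [h1]
  exact Finset.sum_eq_zero fun l _ => h5 l

/-! ### The Leray projection -/

/-- The Leray projection at frequency `k` (zero on the mean). -/
noncomputable def leray (k : K3) (c : Fin 3 → ℂ) (i : Fin 3) : ℂ :=
  if k = 0 then 0 else c i - k i * (∑ j, (k j : ℂ) * c j) / ((∑ j, (k j : ℝ) ^ 2 : ℝ) : ℂ)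

theorem sum_sq_pos {k : K3} (hk : k ≠ 0) : 0 < ∑ j, (k j : ℝ) ^ 2 := by
  obtain ⟨i, hi⟩ := Function.ne_iff.1 hk
  refine Finset.sum_pos' (fun j _ => by positivity) ⟨i, Finset.mem_univ i, ?_⟩
  have : (k i : ℝ) ≠ 0 := by exact_mod_cast hi
  positivity

theorem sum_mul_leray (k : K3) (c : Fin 3 → ℂ) : ∑ i, (k i : ℂ) * leray k c i = 0 := by
  by_cases hk : k = 0
  · simp [hk]
  · have h := (sum_sq_pos hk).ne'
    have h' : ((∑ j, (k j : ℝ) ^ 2 : ℝ) : ℂ) ≠ 0 := by exact_mod_cast h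
    simp only [leray, if_neg hk, mul_sub, Finset.sum_sub_distrib]
    rw [sub_eq_zero]
    have : ∀ i, (k i : ℂ) * (k i * (∑ j, (k j : ℂ) * c j) / ((∑ j, (k j : ℝ) ^ 2 : ℝ) : ℂ))
        = (k i : ℂ) ^ 2 * ((∑ j, (k j : ℂ) * c j) / ((∑ j, (k j : ℝ) ^ 2 : ℝ) : ℂ)) :=
      fun i => by ring
    simp_rw [this]
    rw [← Finset.sum_mul]
    have h2 : ∑ i, (k i : ℂ) ^ 2 = ((∑ j, (k j : ℝ) ^ 2 : ℝ) : ℂ) := by push_cast; rfl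
    rw [h2, mul_div_cancel₀ _ h']

/-- The part of `c` removed by the projection is parallel to `k`, hence invisible to a `u`
orthogonal to `k`. At `k = 0` the projection kills everything, so there `u` itself has to vanish. -/
theorem sum_mul_leray_eq {k : K3} {u : Fin 3 → ℂ} (hu : ∑ i, (k i : ℂ) * u i = 0)
    (h0 : k = 0 → ∀ i, u i = 0) (c : Fin 3 → ℂ) :
    ∑ i, u i * leray k c i = ∑ i, u i * c i := by
  by_cases hk : k = 0
  · simp [h0 hk]
  · simp only [leray, if_neg hk, mul_sub, Finset.sum_sub_distrib]
    rw [sub_eq_self]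
    have : ∀ i, u i * (k i * (∑ j, (k j : ℂ) * c j) / ((∑ j, (k j : ℝ) ^ 2 : ℝ) : ℂ))
        = (k i : ℂ) * u i * ((∑ j, (k j : ℂ) * c j) / ((∑ j, (k j : ℝ) ^ 2 : ℝ) : ℂ)) :=
      fun i => by ring
    simp_rw [this]
    rw [← Finset.sum_mul, hu, zero_mul]

theorem leray_sub (k : K3) (c d : Fin 3 → ℂ) (i : Fin 3) :
    leray k c i - leray k d i = leray k (c - d) i := by
  by_cases hk : k = 0
  · simp [leray, hk]
  · simp only [leray, if_neg hk, Pi.sub_apply, mul_sub, Finset.sum_sub_distrib]; ring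

theorem leray_smul (k : K3) (z : ℂ) (c : Fin 3 → ℂ) (i : Fin 3) :
    leray k (z • c) i = z * leray k c i := by
  by_cases hk : k = 0
  · simp [leray, hk]
  · simp only [leray, if_neg hk, Pi.smul_apply, smul_eq_mul]
    have : ∑ j, (k j : ℂ) * (z * c j) = z * ∑ j, (k j : ℂ) * c j := by
      rw [Finset.mul_sum]; exact Finset.sum_congr rfl fun j _ => by ring
    rw [this]; ring

theorem leray_zero (k : K3) (i : Fin 3) : leray k 0 i = 0 := by
  simp [leray]

theorem leray_conj (k : K3) (c : Fin 3 → ℂ) (i : Fin 3) :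
    leray (-k) (fun i => conj (c i)) i = conj (leray k c i) := by
  by_cases hk : k = 0
  · simp [leray, hk]
  · have hk' : -k ≠ 0 := neg_ne_zero.2 hk
    simp [leray, hk]

/-- The constant is `1 + 3`: one for `c i`, and one for each of the three terms `k i * k j * c j`,
since `|k i * k j| ≤ |k|²`. -/
theorem norm_leray_le (k : K3) {c : Fin 3 → ℂ} {C : ℝ} (hc : ∀ i, ‖c i‖ ≤ C) (i : Fin 3) :
    ‖leray k c i‖ ≤ 4 * C := by
  have hC : 0 ≤ C := (norm_nonneg _).trans (hc 0)
  by_cases hk : k = 0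
  · simp [leray, hk, hC]
  · have h := sum_sq_pos hk
    rw [leray, if_neg hk, mul_div_assoc]
    refine (norm_sub_le _ _).trans ?_
    have h1 : ‖(k i : ℂ) * ((∑ j, (k j : ℂ) * c j) / ((∑ j, (k j : ℝ) ^ 2 : ℝ) : ℂ))‖ ≤ 3 * C := by
      rw [← mul_div_assoc, norm_div, Complex.norm_real, Real.norm_of_nonneg h.le, div_le_iff₀ h,
        Finset.mul_sum]
      refine (norm_sum_le _ _).trans ?_
      have h2 : ∀ j ∈ Finset.univ, ‖(k i : ℂ) * ((k j : ℂ) * c j)‖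
          ≤ C * ∑ j, (k j : ℝ) ^ 2 := fun j _ => by
        have hi := Finset.single_le_sum (f := fun j => (k j : ℝ) ^ 2) (fun j _ => by positivity)
          (Finset.mem_univ i)
        have hj := Finset.single_le_sum (f := fun j => (k j : ℝ) ^ 2) (fun j _ => by positivity)
          (Finset.mem_univ j)
        rw [norm_mul, norm_mul, ← mul_assoc, mul_comm]
        refine mul_le_mul (hc j) ?_ (by positivity) hC
        rw [Complex.norm_intCast, Complex.norm_intCast]
        nlinarith [sq_nonneg (|(k i : ℝ)| - |(k j : ℝ)|), sq_abs (k i : ℝ), sq_abs (k j : ℝ)]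
      refine (Finset.sum_le_sum h2).trans (le_of_eq ?_)
      simp; ring
    linarith [hc i]

/-! ### The nonlinearity of the equation -/

/-- Fourier coefficients of `P ((P u · ∇) P u)` where `P` has the multiplier `m`. -/
noncomputable def nlc (N : ℕ) (m : K3 → ℝ) (a : K3 → Fin 3 → ℂ) (k : K3) (i : Fin 3) : ℂ :=
  m k * advect N (fun k i => m k * a k i) (fun k i => m k * a k i) k i

theorem herm_nlc {N : ℕ} {m : K3 → ℝ} (hm : IsMult m) {a : K3 → Fin 3 → ℂ}
    (ha : ∀ i, Herm fun k => a k i) (i : Fin 3) : Herm fun k => nlc N m a k i :=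
  herm_cut_mul hm (herm_advect (fun i => herm_cut_mul hm (ha i))
    (fun i => herm_cut_mul hm (ha i)) i)

theorem low_eq {φ : E3 → ℝ} (hφ : IsCutoff φ) {Λ : ℝ → ℝ} {t : ℝ} (ht : 0 < t) (hL : 0 < Λ t)
    {N : ℕ} (hN : 2 * Λ t ≤ N) (w : T3 → E3) :
    low φ Λ t w = vtp (box N) fun k i => cut φ (Λ t) k * fourierCoef (fun x => w x i) k := by
  funext x
  simp only [low, lowS, if_pos ht, vtp]
  congr 1
  funext i
  rw [lowPass_eq hφ hL hN]

theorem nonlin_eq {φ : E3 → ℝ} (hφ : IsCutoff φ) {Λ : ℝ → ℝ} {t : ℝ} (ht : 0 < t) (hL : 0 < Λ t)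
    {N : ℕ} (hN : 2 * Λ t ≤ N) (w : T3 → E3) :
    nonlin φ Λ t w = vtp (box N) (nlc N (cut φ (Λ t)) fun k i => fourierCoef (fun x => w x i) k) := by
  have hH := fun i => herm_cut_mul (isMult_cut hφ (Λ t)) (herm_fourierCoef fun x => w x i)
  rw [nonlin, low_eq hφ ht hL hN, low_eq hφ ht hL hN w]
  congr 1
  funext k i
  rw [fourierCoef_advect hH hH, nlc]

theorem nlc_congr_box {N N' : ℕ} (h : N ≤ N') {m : K3 → ℝ} (hm : ∀ k ∉ box N, m k = 0)
    (a : K3 → Fin 3 → ℂ) (k : K3) (i : Fin 3) : nlc N' m a k i = nlc N m a k i := by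
  rw [nlc, nlc, advect_congr_box h] <;> intro k hk i <;> simp [hm k hk]

theorem nlc_eq_zero {N : ℕ} {m : K3 → ℝ} {k : K3} (h : m k = 0) (a : K3 → Fin 3 → ℂ) (i : Fin 3) :
    nlc N m a k i = 0 := by simp [nlc, h]

theorem nlc_smul (N : ℕ) (m : K3 → ℝ) (c : ℂ) (a : K3 → Fin 3 → ℂ) (k : K3) (i : Fin 3) :
    nlc N m (c • a) k i = c ^ 2 * nlc N m a k i := by
  have : (fun k i => (m k : ℂ) * (c • a) k i) = c • fun k i => (m k : ℂ) * a k i := by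
    funext k i; simp; ring
  rw [nlc, nlc, this, advect_smul]; ring

theorem norm_nlc_sub_le {N : ℕ} {m : K3 → ℝ} (hm : IsMult m) {a b : K3 → Fin 3 → ℂ} {A D : ℝ}
    (ha : ∀ k i, ‖a k i‖ ≤ A) (hb : ∀ k i, ‖b k i‖ ≤ A) (hD : ∀ k i, ‖a k i - b k i‖ ≤ D)
    (k : K3) (i : Fin 3) :
    ‖nlc N m a k i - nlc N m b k i‖ ≤ 2 * ((2 * N + 1) ^ 3 * (6 * Real.pi * N) * A * D) := by
  have hA : 0 ≤ A := (norm_nonneg _).trans (ha 0 0)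
  have hD' : 0 ≤ D := (norm_nonneg _).trans (hD 0 0)
  have hmul : ∀ (z : ℂ) (k : K3), ‖(m k : ℂ) * z‖ ≤ ‖z‖ := fun z k => by
    rw [norm_mul, Complex.norm_real]
    exact mul_le_of_le_one_left (norm_nonneg _) (hm.abs_le k)
  rw [nlc, nlc, ← mul_sub, advect_self_sub]
  refine (hmul _ _).trans ((norm_add_le _ _).trans ?_)
  have h0 : ∀ k i, ‖((fun k i => (m k : ℂ) * a k i) - fun k i => (m k : ℂ) * b k i) k i‖ ≤ D :=
    fun k i => by
      simp only [Pi.sub_apply, ← mul_sub]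
      exact (hmul _ _).trans (hD k i)
  have h1 := norm_advect_le (N := N) h0 (fun k i => (hmul (a k i) k).trans (ha k i)) k i
  have h2 := norm_advect_le (N := N) (fun k i => (hmul (b k i) k).trans (hb k i)) h0 k i
  linarith

/-- The outer multiplier is real and equal to the inner ones, so it can be moved onto the conjugated
factor; what remains is the cancellation for `m · a`, which is still divergence free. -/
theorem sum_conj_mul_nlc {N : ℕ} {m : K3 → ℝ} (hm : IsMult m) {a : K3 → Fin 3 → ℂ}
    (ha : ∀ i, Herm fun k => a k i) (hdiv : ∀ k, ∑ j, (k j : ℂ) * a k j = 0) :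
    ∑ k ∈ box N, ∑ i, conj (a k i) * nlc N m a k i = 0 := by
  have h := sum_conj_mul_advect (N := N) (fun i => herm_cut_mul hm (ha i)) fun k => by
    have : ∀ j, (k j : ℂ) * (m k * a k j) = m k * (k j * a k j) := fun j => by ring
    simp_rw [this]
    rw [← Finset.mul_sum, hdiv, mul_zero]
  rw [← h]
  refine Finset.sum_congr rfl fun k _ => Finset.sum_congr rfl fun i _ => ?_
  simp [nlc]; ring

/-! ### The heat semigroup and the radial truncation -/

/-- The decay rate of the mode `k` under the heat flow. -/
noncomputable def lam (ν : ℝ) (k : K3) : ℝ := ν * ((2 * Real.pi) ^ 2 * ∑ i, (k i : ℝ) ^ 2)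

theorem lam_nonneg {ν : ℝ} (hν : 0 ≤ ν) (k : K3) : 0 ≤ lam ν k := by
  unfold lam; positivity

theorem lam_neg (ν : ℝ) (k : K3) : lam ν (-k) = lam ν k := by simp [lam]

/-- The heat semigroup. -/
noncomputable def heat (ν t : ℝ) : L2 → L2 := mulOp fun k => Real.exp (-(lam ν k * t))

theorem isMult_heat {ν t : ℝ} (hν : 0 ≤ ν) (ht : 0 ≤ t) :
    IsMult fun k => Real.exp (-(lam ν k * t)) where
  even k := by rw [lam_neg]
  abs_le k := by
    rw [abs_of_nonneg (Real.exp_nonneg _)]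
    have := mul_nonneg (lam_nonneg hν k) ht
    exact Real.exp_le_one_iff.2 (by linarith)

theorem fc_heat {ν t : ℝ} (hν : 0 ≤ ν) (ht : 0 ≤ t) (v : L2) (k : K3) (i : Fin 3) :
    fc (heat ν t v) k i = Real.exp (-(lam ν k * t)) * fc v k i := fc_mulOp (isMult_heat hν ht) v k i

theorem heat_zero {ν : ℝ} (hν : 0 ≤ ν) (v : L2) : heat ν 0 v = v :=
  L2_ext fun k i => by simp [fc_heat hν le_rfl]

theorem continuousOn_heat {ν T : ℝ} (hν : 0 ≤ ν) {y : ℝ → L2} (hy : Continuous y) :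
    ContinuousOn (fun t => heat ν t (y t)) (Icc 0 T) := fun t ht => by
  refine tendsto_mulOp ?_ (isMult_heat hν ht.1) (fun k => ?_) (hy.tendsto t |>.mono_left inf_le_left)
  · filter_upwards [self_mem_nhdsWithin] with s hs using isMult_heat hν hs.1
  · have : Continuous fun s : ℝ => Real.exp (-(lam ν k * s)) := by fun_prop
    exact (this.tendsto t).mono_left inf_le_left

/-- The factor of the radial truncation to the ball of radius `M`. -/
noncomputable def truncFactor (M : ℝ) (y : L2) : ℝ := M / max M ‖y‖

theorem truncFactor_of_le {M : ℝ} (hM : 0 < M) {y : L2} (h : ‖y‖ ≤ M) : truncFactor M y = 1 := by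
  rw [truncFactor, max_eq_left h, div_self hM.ne']

theorem continuous_truncFactor {M : ℝ} (hM : 0 < M) : Continuous (truncFactor M) :=
  continuous_const.div (continuous_const.max continuous_norm) fun _ =>
    (lt_max_of_lt_left hM).ne'

/-- The radial truncation to the ball of radius `M`. -/
noncomputable def trunc (M : ℝ) (y : L2) : L2 := truncFactor M y • y

theorem norm_trunc_le {M : ℝ} (hM : 0 < M) (y : L2) : ‖trunc M y‖ ≤ M := by
  have h : 0 < max M ‖y‖ := lt_max_of_lt_left hM
  rw [trunc, norm_smul, truncFactor, Real.norm_of_nonneg (by positivity), div_mul_eq_mul_div,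
    div_le_iff₀ h]
  gcongr; exact le_max_right _ _

/-- The change of the vector and the change of the scalar factor each cost one `‖x - y‖`. -/
theorem norm_trunc_sub_le {M : ℝ} (hM : 0 < M) (x y : L2) :
    ‖trunc M x - trunc M y‖ ≤ 2 * ‖x - y‖ := by
  set p := max M ‖x‖ with hp
  set q := max M ‖y‖ with hq
  have hp0 : 0 < p := lt_max_of_lt_left hM
  have hq0 : 0 < q := lt_max_of_lt_left hM
  have e : trunc M x - trunc M y = (M / p) • (x - y) + (M / p * ((q - p) / q)) • y := by
    rw [trunc, trunc, truncFactor, truncFactor, ← hp, ← hq, smul_sub, sub_add, ← sub_smul]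
    congr 2
    field_simp; ring
  have h1 : M / p ≤ 1 := (div_le_one hp0).2 (le_max_left _ _)
  have h2 : |q - p| ≤ ‖x - y‖ := by
    have := abs_max_sub_max_le_max M ‖y‖ M ‖x‖
    rw [sub_self, abs_zero, max_eq_right (abs_nonneg (‖y‖ - ‖x‖))] at this
    exact this.trans ((abs_norm_sub_norm_le _ _).trans (norm_sub_rev _ _).le)
  have h3 : ‖y‖ ≤ q := le_max_right _ _
  rw [e]
  refine (norm_add_le _ _).trans ?_
  rw [norm_smul, norm_smul, Real.norm_of_nonneg (by positivity), norm_mul, norm_div,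
    norm_div, Real.norm_of_nonneg hM.le, Real.norm_of_nonneg hp0.le, Real.norm_eq_abs (q - p),
    Real.norm_of_nonneg hq0.le]
  have h4 : |q - p| / q * ‖y‖ ≤ ‖x - y‖ := by
    rw [div_mul_eq_mul_div, div_le_iff₀ hq0]
    exact mul_le_mul h2 h3 (norm_nonneg _) (norm_nonneg _)
  have h5 : M / p * ‖x - y‖ ≤ ‖x - y‖ := mul_le_of_le_one_left (norm_nonneg _) h1
  have h6 : M / p * (|q - p| / q) * ‖y‖ ≤ ‖x - y‖ := by
    rw [mul_assoc]
    exact (mul_le_of_le_one_left (by positivity) h1).trans h4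
  linarith

theorem continuous_trunc {M : ℝ} (hM : 0 < M) : Continuous (trunc M) :=
  (continuous_truncFactor hM).smul continuous_id

/-! ### The active frequencies -/

variable {ν T : ℝ} {φ : E3 → ℝ} {Λ : ℝ → ℝ}

theorem IsWavenumber.pos (hΛ : IsWavenumber T Λ) {t : ℝ} (ht : t ∈ Ioc 0 T) : 0 < Λ t := by
  obtain ⟨c, hc, h⟩ := hΛ.lower
  exact hc.trans_le (h t ht)

/-- All modes which are active at time `t` lie in the cube of this size. -/
noncomputable def modeBound (Λ : ℝ → ℝ) (t : ℝ) : ℕ := ⌈2 * Λ t⌉₊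

theorem le_modeBound (Λ : ℝ → ℝ) (t : ℝ) : 2 * Λ t ≤ modeBound Λ t := Nat.le_ceil _

/-- Where the monotonicity of `Λ` enters: a mode that has become inactive stays inactive, and the
box of time `s` serves all later times. -/
theorem modeBound_anti (hΛ : IsWavenumber T Λ) {s t : ℝ} (hs : s ∈ Ioc 0 T) (ht : t ∈ Ioc 0 T)
    (h : s ≤ t) : modeBound Λ t ≤ modeBound Λ s := by
  refine Nat.ceil_mono ?_
  have := hΛ.strictAnti.antitoneOn hs ht h
  linarith

theorem contDiffOn_cut (hφ : IsCutoff φ) (hΛ : IsWavenumber T Λ) (k : K3) :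
    ContDiffOn ℝ ∞ (fun t => cut φ (Λ t) k) (Ioc 0 T) :=
  hφ.smooth.comp_contDiffOn ((hΛ.smooth.inv fun _ ht => (hΛ.pos ht).ne').smul contDiffOn_const)

/-! ### The right-hand side after removal of the heat flow, and its Lipschitz constant -/

/-- Fourier coefficients of the right-hand side of the equation for `e^{-νtΔ} u`. -/
noncomputable def rhsCoef (ν : ℝ) (φ : E3 → ℝ) (Λ : ℝ → ℝ) (t : ℝ) (a : K3 → Fin 3 → ℂ) (k : K3)
    (i : Fin 3) : ℂ :=
  -(Real.exp (lam ν k * t) * leray k (nlc (modeBound Λ t) (cut φ (Λ t)) a k) i)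

/-- The integer `modeBound Λ t` jumps with `t`; freezing it at a larger `N` makes continuity and
smoothness in time visible. -/
theorem rhsCoef_eq (hφ : IsCutoff φ) (hΛ : IsWavenumber T Λ) {t : ℝ} (ht : t ∈ Ioc 0 T) {N : ℕ}
    (hN : modeBound Λ t ≤ N) (a : K3 → Fin 3 → ℂ) (k : K3) (i : Fin 3) :
    rhsCoef ν φ Λ t a k i = -(Real.exp (lam ν k * t) * leray k (nlc N (cut φ (Λ t)) a k) i) := by
  have : nlc N (cut φ (Λ t)) a k = nlc (modeBound Λ t) (cut φ (Λ t)) a k := by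
    funext i
    exact nlc_congr_box hN (fun k hk => cut_eq_zero hφ (hΛ.pos ht) (le_modeBound Λ t) hk) a k i
  rw [rhsCoef, this]

theorem rhsCoef_eq_zero (hφ : IsCutoff φ) (hΛ : IsWavenumber T Λ) {t : ℝ} (ht : t ∈ Ioc 0 T) {N : ℕ}
    (hN : modeBound Λ t ≤ N) {k : K3} (hk : k ∉ box N) (a : K3 → Fin 3 → ℂ) (i : Fin 3) :
    rhsCoef ν φ Λ t a k i = 0 := by
  have h0 := cut_eq_zero hφ (hΛ.pos ht) (le_modeBound Λ t) (fun h => hk (box_mono hN h))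
  have : nlc (modeBound Λ t) (cut φ (Λ t)) a k = 0 := funext fun i => nlc_eq_zero h0 a i
  rw [rhsCoef, this, leray_zero]; simp

theorem herm_rhsCoef (hφ : IsCutoff φ) {t : ℝ} {a : K3 → Fin 3 → ℂ}
    (ha : ∀ i, Herm fun k => a k i) (i : Fin 3) : Herm fun k => rhsCoef ν φ Λ t a k i := fun k => by
  have : nlc (modeBound Λ t) (cut φ (Λ t)) a (-k)
      = fun i => conj (nlc (modeBound Λ t) (cut φ (Λ t)) a k i) :=
    funext fun i => herm_nlc (isMult_cut hφ _) ha i k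
  simp only [rhsCoef, lam_neg, this, leray_conj, map_neg, map_mul, Complex.conj_ofReal]

theorem herm_fc (v : L2) (i : Fin 3) : Herm fun k => fc v k i := fun k => fc_neg v k i

/-- The rounding error `1` of the ceiling is absorbed using `1 ≤ T^{1/8} t^{-1/8}`. -/
theorem modeBound_bounds (hΛ : IsWavenumber T Λ) {t : ℝ} (ht : t ∈ Ioc 0 T) :
    (1 : ℝ) ≤ modeBound Λ t ∧
      (modeBound Λ t : ℝ) ≤ (2 + T ^ (1 / 8 : ℝ)) * t ^ (-(1 / 8) : ℝ) := by
  have hpos := hΛ.pos ht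
  constructor
  · have : 0 < modeBound Λ t := Nat.ceil_pos.2 (by linarith)
    exact_mod_cast this
  · have h1 : (modeBound Λ t : ℝ) < 2 * Λ t + 1 := Nat.ceil_lt_add_one (by linarith)
    have h2 := hΛ.upper t ht
    have h3 : 1 ≤ T ^ (1 / 8 : ℝ) * t ^ (-(1 / 8) : ℝ) := by
      rw [Real.rpow_neg ht.1.le, ← div_eq_mul_inv, one_le_div (Real.rpow_pos_of_pos ht.1 _)]
      exact Real.rpow_le_rpow ht.1.le ht.2 (by norm_num)
    linarith

/-- Weighted Lipschitz bound for the right-hand side, with a constant integrable in time. -/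
def RhsLipschitz (ν T : ℝ) (φ : E3 → ℝ) (Λ : ℝ → ℝ) (K : ℝ) : Prop :=
  ∀ t ∈ Ioc 0 T, ∀ (a b : K3 → Fin 3 → ℂ) (A D : ℝ), (∀ k i, ‖a k i‖ ≤ A) →
      (∀ k i, ‖b k i‖ ≤ A) → (∀ k i, ‖a k i - b k i‖ ≤ D) → ∀ k i,
      -- The prefactor is the number of index pairs `(k, i)` in the active box; it upgrades the
      -- bound per coefficient to bounds in `ℓ²` and in `ℓ¹`.
      3 * (2 * (modeBound Λ t : ℝ) + 1) ^ 3 * ‖rhsCoef ν φ Λ t a k i - rhsCoef ν φ Λ t b k i‖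
        ≤ K * t ^ (-(7 / 8) : ℝ) * (A * D)

/-- The exponent `1/8` is used here. The number of modes, the number of interactions and one
derivative give `N³ · N³ · N = N⁷ ≲ t^{-7/8}`, which is integrable. On active modes `λ_k t ≲ N² t ≲
t^{3/4}`, so the growing factor `exp (λ_k t)` is bounded by `exp E`. -/
theorem exists_rhsLipschitz (hν : 0 ≤ ν) (hφ : IsCutoff φ) (hΛ : IsWavenumber T Λ) :
    ∃ K : ℝ, 0 ≤ K ∧ RhsLipschitz ν T φ Λ K := by
  set C := 2 + T ^ (1 / 8 : ℝ) with hC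
  set E := ν * ((2 * Real.pi) ^ 2 * (3 * (C ^ 2 * T ^ (3 / 4 : ℝ)))) with hE
  -- `104976 = 3 · 27 · 4 · 2 · 27 · 6`: the index count `3 (3N)³`, the Leray bound `4`, the two
  -- terms of the polarization, the interaction count `(3N)³` and the symbol bound `6πN`.
  refine ⟨104976 * Real.pi * Real.exp E * |C| ^ 7, by positivity, ?_⟩
  intro t ht a b A D ha hb hD k i
  have hA : 0 ≤ A := (norm_nonneg _).trans (ha 0 0)
  have hD' : 0 ≤ D := (norm_nonneg _).trans (hD 0 0)
  have hT : 0 < T := ht.1.trans_le ht.2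
  have hC0 : 0 < C := by positivity
  by_cases hk : k ∈ box (modeBound Λ t)
  · obtain ⟨hN1, hN2⟩ := modeBound_bounds hΛ ht
    have hN := norm_nlc_sub_le (N := modeBound Λ t) (isMult_cut hφ (Λ t)) ha hb hD k
    set N : ℝ := (modeBound Λ t : ℝ) with hNdef
    rw [← hC] at hN2
    have ht0 := ht.1
    have hr : 0 ≤ t ^ (-(1 / 8) : ℝ) := by positivity
    have hexp : Real.exp (lam ν k * t) ≤ Real.exp E := by
      refine Real.exp_le_exp.2 ?_
      have h1 : ∑ i, (k i : ℝ) ^ 2 ≤ 3 * N ^ 2 := by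
        have : ∀ i ∈ Finset.univ, (k i : ℝ) ^ 2 ≤ N ^ 2 := fun i _ => by
          have h := mem_box.1 hk i
          have h' : |(k i : ℝ)| ≤ N := by rw [hNdef]; exact_mod_cast h
          rw [← sq_abs]; gcongr
        refine (Finset.sum_le_sum this).trans (le_of_eq ?_)
        simp
      have h2 : N ^ 2 * t ≤ C ^ 2 * T ^ (3 / 4 : ℝ) := by
        calc N ^ 2 * t ≤ (C * t ^ (-(1 / 8) : ℝ)) ^ 2 * t := by gcongr
          _ = C ^ 2 * (t ^ (-(1 / 8) : ℝ) * t ^ (-(1 / 8) : ℝ) * t ^ (1 : ℝ)) := by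
            rw [Real.rpow_one]; ring
          _ = C ^ 2 * t ^ (3 / 4 : ℝ) := by
            rw [← Real.rpow_add ht0, ← Real.rpow_add ht0]; norm_num
          _ ≤ _ := by gcongr; exact ht.2
      calc lam ν k * t ≤ ν * ((2 * Real.pi) ^ 2 * (3 * N ^ 2)) * t := by
            unfold lam; gcongr
        _ = ν * ((2 * Real.pi) ^ 2 * (3 * (N ^ 2 * t))) := by ring
        _ ≤ _ := by rw [hE]; gcongr
    have h2N : 2 * N + 1 ≤ 3 * N := by linarith
    have h3 : ‖rhsCoef ν φ Λ t a k i - rhsCoef ν φ Λ t b k i‖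
        ≤ Real.exp E * (4 * (2 * ((3 * N) ^ 3 * (6 * Real.pi * N) * A * D))) := by
      have : rhsCoef ν φ Λ t a k i - rhsCoef ν φ Λ t b k i
          = -(Real.exp (lam ν k * t) * leray k (nlc (modeBound Λ t) (cut φ (Λ t)) a k
            - nlc (modeBound Λ t) (cut φ (Λ t)) b k) i) := by
        rw [← leray_sub, rhsCoef, rhsCoef]; ring
      rw [this, norm_neg, norm_mul, Complex.norm_real, Real.norm_of_nonneg (Real.exp_nonneg _)]
      refine mul_le_mul hexp ?_ (norm_nonneg _) (Real.exp_nonneg _)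
      refine (norm_leray_le k (fun i => hN i) i).trans ?_
      gcongr
    have h7 : N ^ 7 ≤ C ^ 7 * t ^ (-(7 / 8) : ℝ) := by
      calc N ^ 7 ≤ (C * t ^ (-(1 / 8) : ℝ)) ^ 7 := by gcongr
        _ = C ^ 7 * t ^ (-(7 / 8) : ℝ) := by
          rw [mul_pow, ← Real.rpow_natCast (t ^ _), ← Real.rpow_mul ht0.le]; norm_num
    rw [abs_of_pos hC0]
    calc 3 * (2 * N + 1) ^ 3 * ‖rhsCoef ν φ Λ t a k i - rhsCoef ν φ Λ t b k i‖
        ≤ 3 * (3 * N) ^ 3 * (Real.exp E * (4 * (2 * ((3 * N) ^ 3 * (6 * Real.pi * N) * A * D)))) := by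
          gcongr
      _ = 104976 * Real.pi * Real.exp E * N ^ 7 * (A * D) := by ring
      _ ≤ 104976 * Real.pi * Real.exp E * (C ^ 7 * t ^ (-(7 / 8) : ℝ)) * (A * D) := by gcongr
      _ = _ := by ring
  · rw [rhsCoef_eq_zero hφ hΛ ht le_rfl hk, rhsCoef_eq_zero hφ hΛ ht le_rfl hk]
    have := ht.1
    simp; positivity

/-- The right-hand side of the truncated equation for `e^{-νtΔ} u`. -/
noncomputable def rhs (ν : ℝ) (φ : E3 → ℝ) (Λ : ℝ → ℝ) (M t : ℝ) (y : L2) : L2 :=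
  contL2 (smooth_vtp (box (modeBound Λ t))
    (rhsCoef ν φ Λ t (fc (trunc M (heat ν t y))))).continuous

theorem fc_rhs (hφ : IsCutoff φ) (hΛ : IsWavenumber T Λ) (M : ℝ) {t : ℝ} (ht : t ∈ Ioc 0 T) (y : L2)
    (k : K3) (i : Fin 3) :
    fc (rhs ν φ Λ M t y) k i = rhsCoef ν φ Λ t (fc (trunc M (heat ν t y))) k i := by
  rw [rhs, fc_contL2]
  refine (fourierCoef_retp (herm_rhsCoef hφ (herm_fc _) i) k).trans ?_
  split_ifs with h
  · rfl
  · exact (rhsCoef_eq_zero hφ hΛ ht le_rfl h _ _).symm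

/-- With `Q` indices and coefficients at most `C / Q`, Parseval gives `‖v‖² ≤ Q (C / Q)² = C² / Q ≤
C²`. -/
theorem norm_le_of_fc_box {v : L2} {N : ℕ} {C : ℝ} (h0 : ∀ k ∉ box N, ∀ i, fc v k i = 0)
    (h : ∀ k i, 3 * (2 * (N : ℝ) + 1) ^ 3 * ‖fc v k i‖ ≤ C) : ‖v‖ ≤ C := by
  set Q : ℝ := 3 * (2 * (N : ℝ) + 1) ^ 3 with hQ
  have hQ1 : 1 ≤ Q := by
    have : (1 : ℝ) ≤ (2 * (N : ℝ) + 1) ^ 3 := one_le_pow₀ (by have := N.cast_nonneg (α := ℝ); linarith)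
    linarith
  have hC : 0 ≤ C := (by positivity : 0 ≤ Q * ‖fc v 0 0‖).trans (h 0 0)
  refine (sq_le_sq₀ (norm_nonneg _) hC).1 ?_
  rw [← (hasSum_fc_sq v).tsum_eq, tsum_eq_sum (s := box N) fun k hk => by simp [h0 k hk]]
  have h1 : ∀ k ∈ box N, ∑ i, ‖fc v k i‖ ^ 2 ≤ 3 * (C / Q) ^ 2 := fun k _ => by
    have : ∀ i ∈ Finset.univ, ‖fc v k i‖ ^ 2 ≤ (C / Q) ^ 2 := fun i _ => by
      have := h k i
      rw [mul_comm, ← le_div_iff₀ (by positivity)] at this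
      gcongr
    refine (Finset.sum_le_sum this).trans (le_of_eq ?_)
    simp
  refine (Finset.sum_le_sum h1).trans ?_
  rw [Finset.sum_const, card_box, nsmul_eq_mul]
  push_cast
  have : (2 * (N : ℝ) + 1) ^ 3 * (3 * (C / Q) ^ 2) = C ^ 2 / Q := by
    field_simp
    rw [hQ]; ring
  rw [this]
  exact div_le_self (sq_nonneg C) hQ1

/-- All the fields lie in one finite-dimensional space, where coefficientwise and norm convergence
agree. -/
theorem tendsto_of_fc_box {ι : Type*} {l : Filter ι} {v : ι → L2} {v₀ : L2} {N : ℕ}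
    (h0 : ∀ᶠ n in l, ∀ k ∉ box N, ∀ i, fc (v n) k i = 0) (h0' : ∀ k ∉ box N, ∀ i, fc v₀ k i = 0)
    (h : ∀ k i, Tendsto (fun n => fc (v n) k i) l (𝓝 (fc v₀ k i))) : Tendsto v l (𝓝 v₀) := by
  rw [tendsto_iff_norm_sub_tendsto_zero]
  have h1 : Tendsto (fun n => ∑ k ∈ box N, ∑ i, ‖fc (v n) k i - fc v₀ k i‖ ^ 2) l (𝓝 0) := by
    have : Tendsto (fun n => ∑ k ∈ box N, ∑ i, ‖fc (v n) k i - fc v₀ k i‖ ^ 2) l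
        (𝓝 (∑ k ∈ box N, ∑ i, ‖fc v₀ k i - fc v₀ k i‖ ^ 2)) :=
      tendsto_finsetSum _ fun k _ => tendsto_finsetSum _ fun i _ =>
        ((h k i).sub_const _).norm.pow 2
    simpa using this
  have h2 : Tendsto (fun n => ‖v n - v₀‖ ^ 2) l (𝓝 0) := by
    refine h1.congr' ?_
    filter_upwards [h0] with n hn
    rw [← (hasSum_fc_sq _).tsum_eq, tsum_eq_sum (s := box N) fun k hk => by
      simp [fc_sub, hn k hk, h0' k hk]]
    simp only [fc_sub]
  simpa [Real.sqrt_sq] using h2.sqrt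

theorem continuousOn_nlc {s : Set ℝ} {m : ℝ → K3 → ℝ} {a : ℝ → K3 → Fin 3 → ℂ} (N : ℕ)
    (hm : ∀ k, ContinuousOn (fun t => m t k) s) (ha : ∀ k i, ContinuousOn (fun t => a t k i) s)
    (k : K3) (i : Fin 3) : ContinuousOn (fun t => nlc N (m t) (a t) k i) s := by
  have hm' : ∀ k, ContinuousOn (fun t => (m t k : ℂ)) s := fun k =>
    Complex.continuous_ofReal.comp_continuousOn (hm k)
  unfold nlc advect
  refine (hm' k).mul (continuousOn_finsetSum _ fun l _ => continuousOn_finsetSum _ fun n _ => ?_)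
  split_ifs
  · exact (continuousOn_finsetSum _ fun j _ =>
      ((hm' l).mul (ha l j)).mul continuousOn_const).mul ((hm' n).mul (ha n i))
  · exact continuousOn_const

theorem continuousOn_leray {s : Set ℝ} {c : ℝ → Fin 3 → ℂ}
    (hc : ∀ i, ContinuousOn (fun t => c t i) s) (k : K3) (i : Fin 3) :
    ContinuousOn (fun t => leray k (c t) i) s := by
  unfold leray
  split_ifs
  · exact continuousOn_const
  · exact (hc i).sub ((continuousOn_const.mul
      (continuousOn_finsetSum _ fun j _ => continuousOn_const.mul (hc j))).div_const _)

/-- Reduces to times bounded away from `0`, on which one fixed box contains every active mode. -/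
theorem continuousOn_Ioc_of_forall {X : Type*} [TopologicalSpace X] {f : ℝ → X}
    (h : ∀ ε ∈ Ioc 0 T, ContinuousOn f (Ioc ε T)) : ContinuousOn f (Ioc 0 T) := fun t ht => by
  refine (h (t / 2) ⟨half_pos ht.1, by linarith [ht.1, ht.2]⟩ t
    ⟨half_lt_self ht.1, ht.2⟩).mono_of_mem_nhdsWithin ?_
  filter_upwards [self_mem_nhdsWithin,
    mem_nhdsWithin_of_mem_nhds (Ioi_mem_nhds (half_lt_self ht.1))] with s hs hs'
  exact ⟨hs', hs.2⟩

theorem continuousOn_rhsCoef (hφ : IsCutoff φ) (hΛ : IsWavenumber T Λ) {a : ℝ → K3 → Fin 3 → ℂ}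
    (ha : ∀ k i, ContinuousOn (fun t => a t k i) (Ioc 0 T)) (k : K3) (i : Fin 3) :
    ContinuousOn (fun t => rhsCoef ν φ Λ t (a t) k i) (Ioc 0 T) := by
  refine continuousOn_Ioc_of_forall fun ε hε => ?_
  have hsub : Ioc ε T ⊆ Ioc 0 T := Ioc_subset_Ioc_left hε.1.le
  have : ContinuousOn (fun t => -((Real.exp (lam ν k * t) : ℂ) *
      leray k (nlc (modeBound Λ ε) (cut φ (Λ t)) (a t) k) i)) (Ioc ε T) := by
    refine (ContinuousOn.mul ?_ (continuousOn_leray (fun i => continuousOn_nlc _ (fun k => ?_)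
      (fun k i => (ha k i).mono hsub) k i) k i)).neg
    · exact (Complex.continuous_ofReal.comp
        (Real.continuous_exp.comp (continuous_const.mul continuous_id))).continuousOn
    · exact (contDiffOn_cut hφ hΛ k).continuousOn.mono hsub
  refine this.congr fun t ht => ?_
  exact rhsCoef_eq hφ hΛ (hsub ht) (modeBound_anti hΛ hε (hsub ht) ht.1.le) _ _ _

theorem continuousOn_rhs (hν : 0 ≤ ν) (hφ : IsCutoff φ) (hΛ : IsWavenumber T Λ) {M : ℝ} (hM : 0 < M)
    {y : ℝ → L2} (hy : Continuous y) :
    ContinuousOn (fun t => rhs ν φ Λ M t (y t)) (Ioc 0 T) := by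
  have hcoef : ∀ k i, ContinuousOn (fun t => fc (rhs ν φ Λ M t (y t)) k i) (Ioc 0 T) :=
    fun k i => by
      have hc : ∀ k i, ContinuousOn (fun t => fc (trunc M (heat ν t (y t))) k i) (Ioc 0 T) :=
        fun k i => ((continuous_fc k i).comp (continuous_trunc hM)).comp_continuousOn
          ((continuousOn_heat hν hy).mono Ioc_subset_Icc_self)
      refine (continuousOn_rhsCoef (ν := ν) hφ hΛ hc k i).congr fun t ht => ?_
      exact fc_rhs hφ hΛ M ht _ k i
  refine continuousOn_Ioc_of_forall fun ε hε t ht => ?_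
  have hsub : Ioc ε T ⊆ Ioc 0 T := Ioc_subset_Ioc_left hε.1.le
  have h0 : ∀ t ∈ Ioc ε T, ∀ k ∉ box (modeBound Λ ε), ∀ i, fc (rhs ν φ Λ M t (y t)) k i = 0 :=
    fun t ht k hk i => by
      rw [fc_rhs hφ hΛ M (hsub ht)]
      exact rhsCoef_eq_zero hφ hΛ (hsub ht) (modeBound_anti hΛ hε (hsub ht) ht.1.le) hk _ _
  refine tendsto_of_fc_box (N := modeBound Λ ε) ?_ (h0 t ht)
    fun k i => (hcoef k i).mono hsub t ht
  filter_upwards [self_mem_nhdsWithin] with s hs using h0 s hs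

theorem norm_trunc_heat_sub_le (hν : 0 ≤ ν) {M : ℝ} (hM : 0 < M) {t : ℝ} (ht : 0 ≤ t) (x y : L2) :
    ‖trunc M (heat ν t x) - trunc M (heat ν t y)‖ ≤ 2 * ‖x - y‖ := by
  refine (norm_trunc_sub_le hM _ _).trans ?_
  gcongr
  rw [heat, ← mulOp_sub (isMult_heat hν ht)]
  exact norm_mulOp_le (isMult_heat hν ht) _

theorem rhs_sub_le (hν : 0 ≤ ν) (hφ : IsCutoff φ) (hΛ : IsWavenumber T Λ) {K : ℝ}
    (hK : RhsLipschitz ν T φ Λ K) {M : ℝ} (hM : 0 < M) {t : ℝ} (ht : t ∈ Ioc 0 T)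
    (x y : L2) :
    ‖rhs ν φ Λ M t x - rhs ν φ Λ M t y‖ ≤ K * t ^ (-(7 / 8) : ℝ) * (M * (2 * ‖x - y‖)) := by
  have hb : ∀ x k i, ‖fc (trunc M (heat ν t x)) k i‖ ≤ M := fun x k i =>
    (norm_fc_le _ _ _).trans (norm_trunc_le hM _)
  refine norm_le_of_fc_box (N := modeBound Λ t) (fun k hk i => ?_) fun k i => ?_
  · rw [fc_sub, fc_rhs hφ hΛ M ht, fc_rhs hφ hΛ M ht, rhsCoef_eq_zero hφ hΛ ht le_rfl hk,
      rhsCoef_eq_zero hφ hΛ ht le_rfl hk, sub_zero]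
  · rw [fc_sub, fc_rhs hφ hΛ M ht, fc_rhs hφ hΛ M ht]
    refine hK t ht _ _ _ _ (hb x) (hb y) (fun k i => ?_) k i
    rw [← fc_sub]
    exact (norm_fc_le _ _ _).trans (norm_trunc_heat_sub_le hν hM ht.1.le x y)

theorem rhsCoef_zero (t : ℝ) (k : K3) (i : Fin 3) : rhsCoef ν φ Λ t 0 k i = 0 := by
  have : nlc (modeBound Λ t) (cut φ (Λ t)) 0 k = 0 := by
    funext i; simp [nlc, advect]
  rw [rhsCoef, this, leray_zero]; simp

theorem RhsLipschitz.norm_le {K : ℝ} (hK : RhsLipschitz ν T φ Λ K) {t : ℝ} (ht : t ∈ Ioc 0 T)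
    {a : K3 → Fin 3 → ℂ} {A : ℝ} (ha : ∀ k i, ‖a k i‖ ≤ A) (k : K3) (i : Fin 3) :
    3 * (2 * (modeBound Λ t : ℝ) + 1) ^ 3 * ‖rhsCoef ν φ Λ t a k i‖
      ≤ K * t ^ (-(7 / 8) : ℝ) * (A * A) := by
  have hA : 0 ≤ A := (norm_nonneg _).trans (ha 0 0)
  have := hK t ht a 0 A A ha (by simpa using hA) (fun k i => by simpa using ha k i) k i
  rwa [rhsCoef_zero, sub_zero] at this

theorem RhsLipschitz.norm_le' {K : ℝ} (hK : RhsLipschitz ν T φ Λ K) {t : ℝ} (ht : t ∈ Ioc 0 T)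
    {a : K3 → Fin 3 → ℂ} {A : ℝ} (ha : ∀ k i, ‖a k i‖ ≤ A) (k : K3) (i : Fin 3) :
    ‖rhsCoef ν φ Λ t a k i‖ ≤ K * t ^ (-(7 / 8) : ℝ) * (A * A) := by
  refine le_trans (le_mul_of_one_le_left (norm_nonneg _) ?_) (hK.norm_le ht ha k i)
  have : (1 : ℝ) ≤ (2 * (modeBound Λ t : ℝ) + 1) ^ 3 :=
    one_le_pow₀ (by have := (modeBound Λ t).cast_nonneg (α := ℝ); linarith)
  linarith

theorem norm_rhs_le (hφ : IsCutoff φ) (hΛ : IsWavenumber T Λ) {K : ℝ}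
    (hK : RhsLipschitz ν T φ Λ K) {M : ℝ} (hM : 0 < M) {t : ℝ} (ht : t ∈ Ioc 0 T)
    (x : L2) : ‖rhs ν φ Λ M t x‖ ≤ K * t ^ (-(7 / 8) : ℝ) * (M * M) := by
  have hb : ∀ k i, ‖fc (trunc M (heat ν t x)) k i‖ ≤ M := fun k i =>
    (norm_fc_le _ _ _).trans (norm_trunc_le hM _)
  refine norm_le_of_fc_box (N := modeBound Λ t) (fun k hk i => ?_) fun k i => ?_
  · rw [fc_rhs hφ hΛ M ht, rhsCoef_eq_zero hφ hΛ ht le_rfl hk]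
  · rw [fc_rhs hφ hΛ M ht]
    exact hK.norm_le ht hb k i

/-! ### Forced heat modes and the energy balance -/

/-- The Fourier coefficients of `u` solve `∂_t û = -λ û + e^{-λ t} F` with initial datum `v₀`, in
integrated form. -/
structure ForcedModes (ν T : ℝ) (v₀ : L2) (u : ℝ → L2) (F : ℝ → K3 → Fin 3 → ℂ) : Prop where
  cont : ∀ k i, ContinuousOn (fun t => fc (u t) k i) (Icc 0 T)
  contF : ∀ k i, ContinuousOn (fun t => F t k i) (Ioc 0 T)
  intF : ∀ k i, IntervalIntegrable (fun t => F t k i) volume 0 T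
  eq : ∀ k i, ∀ t ∈ Icc 0 T,
    Real.exp (lam ν k * t) * fc (u t) k i = fc v₀ k i + ∫ s in (0 : ℝ)..t, F s k i

theorem intervalIntegrable_of_mem {X : Type*} [NormedAddCommGroup X] {f : ℝ → X}
    (h : IntervalIntegrable f volume 0 T) {t : ℝ} (ht : t ∈ Icc 0 T) :
    IntervalIntegrable f volume 0 t :=
  h.mono_set (by
    rw [uIcc_of_le ht.1, uIcc_of_le (ht.1.trans ht.2)]; exact Icc_subset_Icc_right ht.2)

/-- At the endpoint `T` only a left derivative is available, hence the two cases. -/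
theorem hasDerivWithinAt_primitive {X : Type*} [NormedAddCommGroup X] [NormedSpace ℝ X]
    [CompleteSpace X] {f : ℝ → X} (hi : IntervalIntegrable f volume 0 T)
    (hc : ContinuousOn f (Ioc 0 T)) {t : ℝ} (ht : t ∈ Ioc 0 T) :
    HasDerivWithinAt (fun t => ∫ s in (0 : ℝ)..t, f s) (f t) (Ioc 0 T) t := by
  have hi' := intervalIntegrable_of_mem hi ⟨ht.1.le, ht.2⟩
  rcases eq_or_lt_of_le ht.2 with h | h
  · subst h
    have hms : StronglyMeasurableAtFilter f (𝓝[Iic t] t) volume := by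
      refine ⟨Ioc 0 t, ?_, hc.aestronglyMeasurable measurableSet_Ioc⟩
      exact Ioc_mem_nhdsLE ht.1
    have := intervalIntegral.integral_hasDerivWithinAt_right hi' (s := Iic t) (t := Iic t) hms
      ((hc t ht).mono_of_mem_nhdsWithin (Ioc_mem_nhdsLE ht.1))
    exact this.mono fun s hs => hs.2
  · have hnhds : Ioc 0 T ∈ 𝓝 t := Ioc_mem_nhds ht.1 h
    have := intervalIntegral.integral_hasDerivAt_right hi'
      ⟨Ioc 0 T, hnhds, hc.aestronglyMeasurable measurableSet_Ioc⟩ (hc.continuousAt hnhds)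
    exact this.hasDerivWithinAt

theorem ForcedModes.fc_eq {v₀ : L2} {u : ℝ → L2} {F : ℝ → K3 → Fin 3 → ℂ}
    (h : ForcedModes ν T v₀ u F) (k : K3) (i : Fin 3) {t : ℝ} (ht : t ∈ Icc 0 T) :
    fc (u t) k i = Real.exp (-(lam ν k * t)) * (fc v₀ k i + ∫ s in (0 : ℝ)..t, F s k i) := by
  rw [← h.eq k i t ht, ← mul_assoc, ← Complex.ofReal_mul, ← Real.exp_add]; simp

theorem ForcedModes.hasDerivWithinAt {v₀ : L2} {u : ℝ → L2} {F : ℝ → K3 → Fin 3 → ℂ}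
    (h : ForcedModes ν T v₀ u F) (k : K3) (i : Fin 3) {t : ℝ} (ht : t ∈ Ioc 0 T) :
    HasDerivWithinAt (fun t => fc (u t) k i)
      (-(lam ν k * fc (u t) k i) + Real.exp (-(lam ν k * t)) * F t k i) (Ioc 0 T) t := by
  have h1 : HasDerivAt (fun t : ℝ => (Real.exp (-(lam ν k * t)) : ℂ))
      ((Real.exp (-(lam ν k * t)) * -(lam ν k * 1) : ℝ) : ℂ) t :=
    (((hasDerivAt_id t).const_mul (lam ν k)).neg.exp).ofReal_comp
  have h2 := h1.hasDerivWithinAt.mul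
    ((hasDerivWithinAt_primitive (h.intF k i) (h.contF k i) ht).const_add (fc v₀ k i))
  refine (h2.congr (fun s hs => h.fc_eq k i (Ioc_subset_Icc_self hs))
    (h.fc_eq k i (Ioc_subset_Icc_self ht))).congr_deriv ?_
  rw [h.fc_eq k i (Ioc_subset_Icc_self ht)]
  push_cast; ring

/-- The energy identity for a single frequency. -/
theorem ForcedModes.energy_mode {v₀ : L2} {u : ℝ → L2} {F : ℝ → K3 → Fin 3 → ℂ}
    (h : ForcedModes ν T v₀ u F) (k : K3) {t : ℝ} (ht : t ∈ Icc 0 T) :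
    IntervalIntegrable (fun s => ∑ i,
      (conj (fc (u s) k i) * (Real.exp (-(lam ν k * s)) * F s k i)).re) volume 0 t ∧
    (∑ i, ‖fc (u t) k i‖ ^ 2) / 2 + ∫ s in (0 : ℝ)..t, lam ν k * ∑ i, ‖fc (u s) k i‖ ^ 2
      = (∑ i, ‖fc v₀ k i‖ ^ 2) / 2 + ∫ s in (0 : ℝ)..t, ∑ i,
        (conj (fc (u s) k i) * (Real.exp (-(lam ν k * s)) * F s k i)).re := by
  have hsub : Icc 0 t ⊆ Icc 0 T := Icc_subset_Icc_right ht.2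
  have hce : Continuous fun s : ℝ => (Real.exp (-(lam ν k * s)) : ℂ) :=
    Complex.continuous_ofReal.comp (by fun_prop)
  have hi1 : ∀ i, IntervalIntegrable (fun s =>
      (conj (fc (u s) k i) * (Real.exp (-(lam ν k * s)) * F s k i)).re) volume 0 t := fun i => by
    have h1 := (intervalIntegrable_of_mem (h.intF k i) ht).continuousOn_mul
      (g := fun s => conj (fc (u s) k i) * (Real.exp (-(lam ν k * s)) : ℂ)) (by
        rw [uIcc_of_le ht.1]
        exact (Complex.continuous_conj.comp_continuousOn ((h.cont k i).mono hsub)).mul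
          hce.continuousOn)
    have h2 : IntervalIntegrable (fun s => ((conj (fc (u s) k i) *
      (Real.exp (-(lam ν k * s)) * F s k i)))) volume 0 t := by
      simpa only [mul_assoc] using h1
    exact ⟨h2.1.re, h2.2.re⟩
  have hi2 : ∀ i, IntervalIntegrable (fun s => lam ν k * ‖fc (u s) k i‖ ^ 2) volume 0 t :=
    fun i => ContinuousOn.intervalIntegrable (by
      rw [uIcc_of_le ht.1]
      exact continuousOn_const.mul (((h.cont k i).mono hsub).norm.pow 2))
  -- The force may blow up at `0`, so the fundamental theorem is used in the form that needs
  -- continuity on `[0,t]`, a derivative inside, and integrability.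
  have hd : ∀ i, ∫ s in (0 : ℝ)..t, (-(lam ν k * ‖fc (u s) k i‖ ^ 2) +
      (conj (fc (u s) k i) * (Real.exp (-(lam ν k * s)) * F s k i)).re)
      = ‖fc (u t) k i‖ ^ 2 / 2 - ‖fc (u 0) k i‖ ^ 2 / 2 := fun i => by
    refine intervalIntegral.integral_eq_sub_of_hasDerivAt_of_le ht.1
      ((((h.cont k i).mono hsub).norm.pow 2).div_const 2) (fun s hs => ?_)
      ((hi2 i).neg.add (hi1 i))
    have hs' : s ∈ Ioc 0 T := ⟨hs.1, hs.2.le.trans ht.2⟩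
    have h1 := (h.hasDerivWithinAt k i hs').hasDerivAt
      (Ioc_mem_nhds hs.1 (hs.2.trans_le ht.2))
    have h2 := (h1.norm_sq).div_const 2
    refine h2.congr_deriv ?_
    simp only [Complex.inner]
    have : (conj (fc (u s) k i) * -(lam ν k * fc (u s) k i)).re
        = -(lam ν k * ‖fc (u s) k i‖ ^ 2) := by
      have e : conj (fc (u s) k i) * -(lam ν k * fc (u s) k i)
        = ((-(lam ν k * ‖fc (u s) k i‖ ^ 2) : ℝ) : ℂ) := by
        push_cast
        rw [← Complex.conj_mul']; ring
      rw [e, Complex.ofReal_re]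
    rw [mul_comm _ (conj _), mul_add, Complex.add_re, this]; ring
  have h0 : ∀ i, fc (u 0) k i = fc v₀ k i := fun i => by
    have := h.fc_eq k i (t := 0) ⟨le_rfl, ht.1.trans ht.2⟩
    simpa using this
  refine ⟨?_, ?_⟩
  · have := IntervalIntegrable.sum (μ := volume) (a := 0) (b := t) Finset.univ (fun i _ => hi1 i)
    simpa [Finset.sum_apply, Finset.sum_fn] using this
  · rw [intervalIntegral.integral_finsetSum fun i _ => hi1 i]
    simp_rw [Finset.mul_sum]
    rw [intervalIntegral.integral_finsetSum fun i _ => hi2 i, Finset.sum_div, Finset.sum_div,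
      ← Finset.sum_add_distrib, ← Finset.sum_add_distrib]
    refine Finset.sum_congr rfl fun i _ => ?_
    have h1 := hd i
    have h2 : IntervalIntegrable (fun s => -(lam ν k * ‖fc (u s) k i‖ ^ 2)) volume 0 t := (hi2 i).neg
    rw [intervalIntegral.integral_add h2 (hi1 i), intervalIntegral.integral_neg, h0] at h1
    linarith

/-- Termwise integration over frequencies of a family with an integrable bound. -/
theorem hasSum_integral_of_bound {ι : Type*} [Countable ι] {t : ℝ} (ht : 0 ≤ t) {q : ι → ℝ → ℝ}
    {L : ℝ → ℝ} {Q : ℝ → ℝ} (hq : ∀ k, IntervalIntegrable (q k) volume 0 t)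
    (hL : IntervalIntegrable L volume 0 t)
    (hb : ∀ s ∈ Ioc 0 t, ∀ S : Finset ι, ∑ k ∈ S, ‖q k s‖ ≤ L s)
    (hQ : ∀ s ∈ Ioc 0 t, HasSum (fun k => q k s) (Q s)) :
    HasSum (fun k => ∫ s in (0 : ℝ)..t, q k s) (∫ s in (0 : ℝ)..t, Q s) := by
  simp only [intervalIntegral.integral_of_le ht]
  simp only [intervalIntegrable_iff_integrableOn_Ioc_of_le ht] at hq hL
  -- The bound on all finite partial sums makes the integrals of `‖q k‖` summable, which permits
  -- exchanging sum and integral.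
  have hs : Summable fun k => ∫ s in Ioc 0 t, ‖q k s‖ := by
    refine summable_of_sum_le (c := ∫ s in Ioc 0 t, L s)
      (fun k => integral_nonneg fun _ => norm_nonneg _) fun S => ?_
    rw [← integral_finsetSum S fun k _ => (hq k).norm]
    exact setIntegral_mono_on (integrable_finsetSum S fun k _ => (hq k).norm) hL
      measurableSet_Ioc fun s hs => hb s hs S
  have h1 := hasSum_integral_of_summable_integral_norm hq hs
  have h2 : ∫ s in Ioc 0 t, ∑' k, q k s = ∫ s in Ioc 0 t, Q s :=
    setIntegral_congr_fun measurableSet_Ioc fun s hs => (hQ s hs).tsum_eq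
  rwa [h2] at h1

/-- Sum of the energy identities of the single modes. The bound `hb` justifies integrating the work
of the force termwise, and `hcancel` makes its total vanish. The dissipation is summed by Tonelli in
`ℝ≥0∞`, so that `u ∈ L²(0,T;H¹)` is a consequence and not an assumption. -/
theorem ForcedModes.energyBalance {v₀ : L2} {u : ℝ → L2} {F : ℝ → K3 → Fin 3 → ℂ} (hν : 0 ≤ ν)
    (h : ForcedModes ν T v₀ u F) {L : ℝ → ℝ} (hL : IntervalIntegrable L volume 0 T)
    (hb : ∀ s ∈ Ioc 0 T, ∀ S : Finset K3,
      ∑ k ∈ S, ∑ i, ‖fc (u s) k i‖ * ‖F s k i‖ ≤ L s)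
    (hcancel : ∀ s ∈ Ioc 0 T, HasSum (fun k => ∑ i,
      (conj (fc (u s) k i) * (Real.exp (-(lam ν k * s)) * F s k i)).re) 0) :
    EnergyBalance ν T v₀ u := by
  intro t ht
  have hsub : Icc 0 t ⊆ Icc 0 T := Icc_subset_Icc_right ht.2
  have h1 : HasSum (fun k => ∫ s in (0 : ℝ)..t, ∑ i,
      (conj (fc (u s) k i) * (Real.exp (-(lam ν k * s)) * F s k i)).re) 0 := by
    have := hasSum_integral_of_bound ht.1 (Q := fun _ => 0)
      (fun k => (h.energy_mode k ht).1) (intervalIntegrable_of_mem hL ht)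
      (fun s hs S => ?_) (fun s hs => hcancel s ⟨hs.1, hs.2.trans ht.2⟩)
    · simpa using this
    · refine le_trans (Finset.sum_le_sum fun k _ => ?_) (hb s ⟨hs.1, hs.2.trans ht.2⟩ S)
      refine (norm_sum_le _ _).trans (Finset.sum_le_sum fun i _ => ?_)
      refine (Complex.abs_re_le_norm _).trans ?_
      rw [norm_mul, norm_mul, RCLike.norm_conj, Complex.norm_real,
        Real.norm_of_nonneg (Real.exp_nonneg _)]
      refine mul_le_mul_of_nonneg_left (mul_le_of_le_one_left (norm_nonneg _) ?_) (norm_nonneg _)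
      have := mul_nonneg (lam_nonneg hν k) hs.1.le
      exact Real.exp_le_one_iff.2 (by linarith)
  have h2 : HasSum (fun k => (∑ i, ‖fc (u t) k i‖ ^ 2) / 2 +
      ∫ s in (0 : ℝ)..t, lam ν k * ∑ i, ‖fc (u s) k i‖ ^ 2) (‖v₀‖ ^ 2 / 2) := by
    have := ((hasSum_fc_sq v₀).div_const 2).add h1
    rw [add_zero] at this
    refine this.congr_fun fun k => ?_
    exact (h.energy_mode k ht).2
  have hnn : ∀ k, 0 ≤ ∫ s in (0 : ℝ)..t, lam ν k * ∑ i, ‖fc (u s) k i‖ ^ 2 := fun k =>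
    intervalIntegral.integral_nonneg ht.1 fun s _ =>
      mul_nonneg (lam_nonneg hν k) (by positivity)
  have hcont : ∀ k, ContinuousOn (fun s => lam ν k * ∑ i, ‖fc (u s) k i‖ ^ 2) (Icc 0 t) :=
    fun k => continuousOn_const.mul
      (continuousOn_finsetSum _ fun i _ => ((h.cont k i).mono hsub).norm.pow 2)
  have h3 : ENNReal.ofReal ν * ∫⁻ s in Ioc 0 t, gradSq (u s)
      = ∑' k, ENNReal.ofReal (∫ s in (0 : ℝ)..t, lam ν k * ∑ i, ‖fc (u s) k i‖ ^ 2) := by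
    have e1 : ∀ s k, ENNReal.ofReal ν * (ENNReal.ofReal ((2 * Real.pi) ^ 2 * ∑ i, (k i : ℝ) ^ 2) *
        ∑ i, ‖fourierCoef (fun x => u s x i) k‖ₑ ^ 2)
        = ENNReal.ofReal (lam ν k * ∑ i, ‖fc (u s) k i‖ ^ 2) := fun s k => by
      rw [← mul_assoc, ← ENNReal.ofReal_mul hν, ENNReal.ofReal_mul (lam_nonneg hν k),
        ENNReal.ofReal_sum_of_nonneg fun i _ => by positivity]
      congr 1
      refine Finset.sum_congr rfl fun i _ => ?_
      rw [← ofReal_norm, ENNReal.ofReal_pow (norm_nonneg _)]; rfl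
    unfold gradSq
    rw [← lintegral_const_mul' _ _ ENNReal.ofReal_ne_top]
    simp_rw [← ENNReal.tsum_mul_left, e1]
    rw [lintegral_tsum]
    · refine tsum_congr fun k => ?_
      rw [intervalIntegral.integral_of_le ht.1, ofReal_integral_eq_lintegral_ofReal]
      · exact ((hcont k).integrableOn_Icc).mono_set Ioc_subset_Icc_self
      · exact Eventually.of_forall fun s => mul_nonneg (lam_nonneg hν k) (by positivity)
    · intro k
      exact (((hcont k).mono Ioc_subset_Icc_self).aestronglyMeasurable
        measurableSet_Ioc).aemeasurable.ennreal_ofReal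
  have h4 : ENNReal.ofReal (‖u t‖ ^ 2 / 2)
      = ∑' k, ENNReal.ofReal ((∑ i, ‖fc (u t) k i‖ ^ 2) / 2) := by
    have := (hasSum_fc_sq (u t)).div_const 2
    rw [← this.tsum_eq, ENNReal.ofReal_tsum_of_nonneg (fun k => by positivity) this.summable]
  rw [h3, h4, ← ENNReal.tsum_add, ← h2.tsum_eq, ENNReal.ofReal_tsum_of_nonneg
    (fun k => add_nonneg (by positivity) (hnn k)) h2.summable]
  exact tsum_congr fun k => (ENNReal.ofReal_add (by positivity) (hnn k)).symm

/-! ### The equation in Fourier variables: existence and uniqueness -/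

/-- The `Λ`-NSE in Fourier variables, in Duhamel form, for trajectories bounded by `M`. -/
structure IsModeSolution (ν T : ℝ) (φ : E3 → ℝ) (Λ : ℝ → ℝ) (M : ℝ) (v₀ : L2) (u : ℝ → L2) :
    Prop where
  forced : ForcedModes ν T v₀ u fun s => rhsCoef ν φ Λ s (fc (u s))
  bound : ∀ t ∈ Icc 0 T, ‖u t‖ ≤ M

/-- A Fourier coefficient as a continuous linear functional. -/
noncomputable def fcL (k : K3) (i : Fin 3) : L2 →L[ℝ] ℂ :=
  LinearMap.mkContinuous
    { toFun := fun v => fc v k i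
      map_add' := fun v w => fc_add v w k i
      map_smul' := fun c v => by simpa using fc_smul c v k i } 1
    fun v => by simpa using norm_fc_le v k i

theorem fcL_apply (k : K3) (i : Fin 3) (v : L2) : fcL k i v = fc v k i := rfl

theorem integral_congr_Ioc {X : Type*} [NormedAddCommGroup X] [NormedSpace ℝ X] {t : ℝ}
    (ht : 0 ≤ t) {f g : ℝ → X} (h : ∀ s ∈ Ioc 0 t, f s = g s) :
    ∫ s in (0 : ℝ)..t, f s = ∫ s in (0 : ℝ)..t, g s := by
  rw [intervalIntegral.integral_of_le ht, intervalIntegral.integral_of_le ht]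
  exact setIntegral_congr_fun measurableSet_Ioc h

theorem ForcedModes.weaklyDivFree {v₀ : L2} {u : ℝ → L2} {F : ℝ → K3 → Fin 3 → ℂ}
    (h : ForcedModes ν T v₀ u F) (hF : ∀ s ∈ Ioc 0 T, ∀ k : K3, ∑ j, (k j : ℂ) * F s k j = 0)
    (h0 : WeaklyDivFree v₀) {t : ℝ} (ht : t ∈ Icc 0 T) : WeaklyDivFree (u t) := by
  rw [weaklyDivFree_iff] at h0 ⊢
  intro k
  have h1 : ∫ s in (0 : ℝ)..t, ∑ j, (k j : ℂ) * F s k j = 0 := by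
    rw [integral_congr_Ioc ht.1 (g := fun _ => 0) fun s hs => hF s ⟨hs.1, hs.2.trans ht.2⟩ k]
    simp
  rw [intervalIntegral.integral_finsetSum fun j _ =>
    (intervalIntegrable_of_mem (h.intF k j) ht).const_mul _] at h1
  simp_rw [intervalIntegral.integral_const_mul] at h1
  have h2 : ∑ j, (k j : ℂ) * fc (u t) k j = Real.exp (-(lam ν k * t)) *
      (∑ j, (k j : ℂ) * fc v₀ k j + ∑ j, (k j : ℂ) * ∫ s in (0 : ℝ)..t, F s k j) := by
    rw [← Finset.sum_add_distrib, Finset.mul_sum]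
    refine Finset.sum_congr rfl fun j _ => ?_
    rw [h.fc_eq k j ht]; ring
  rw [h2, h0, h1]; simp

theorem ForcedModes.meanFree {v₀ : L2} {u : ℝ → L2} {F : ℝ → K3 → Fin 3 → ℂ}
    (h : ForcedModes ν T v₀ u F) (hF : ∀ s ∈ Ioc 0 T, ∀ i, F s 0 i = 0)
    (h0 : MeanFree v₀) {t : ℝ} (ht : t ∈ Icc 0 T) : MeanFree (u t) := by
  rw [meanFree_iff] at h0 ⊢
  intro i
  rw [h.fc_eq 0 i ht, h0, integral_congr_Ioc ht.1 (g := fun _ => 0)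
    fun s hs => hF s ⟨hs.1, hs.2.trans ht.2⟩ i]
  simp

theorem sum_mul_rhsCoef (t : ℝ) (a : K3 → Fin 3 → ℂ) (k : K3) :
    ∑ j, (k j : ℂ) * rhsCoef ν φ Λ t a k j = 0 := by
  have : ∑ j, (k j : ℂ) * rhsCoef ν φ Λ t a k j = -(Real.exp (lam ν k * t)) *
      ∑ j, (k j : ℂ) * leray k (nlc (modeBound Λ t) (cut φ (Λ t)) a k) j := by
    rw [Finset.mul_sum]
    exact Finset.sum_congr rfl fun j _ => by rw [rhsCoef]; ring
  rw [this, sum_mul_leray, mul_zero]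

theorem rhsCoef_mode_zero (t : ℝ) (a : K3 → Fin 3 → ℂ) (i : Fin 3) :
    rhsCoef ν φ Λ t a 0 i = 0 := by
  simp [rhsCoef, leray]

/-- By homogeneity of degree two, the radial truncation multiplies the force by a scalar and cannot
spoil the energy cancellation. -/
theorem rhsCoef_smul (t : ℝ) (c : ℂ) (a : K3 → Fin 3 → ℂ) (k : K3) (i : Fin 3) :
    rhsCoef ν φ Λ t (c • a) k i = c ^ 2 * rhsCoef ν φ Λ t a k i := by
  have : nlc (modeBound Λ t) (cut φ (Λ t)) (c • a) k
      = c ^ 2 • nlc (modeBound Λ t) (cut φ (Λ t)) a k :=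
    funext fun i => nlc_smul _ _ _ _ _ _
  rw [rhsCoef, this, leray_smul, rhsCoef]; ring

/-- The two integrating factors cancel, the Leray projection drops because `v` is divergence and
mean free, and the remaining finite sum vanishes by the triad cancellation. -/
theorem hasSum_conj_mul_rhsCoef (hφ : IsCutoff φ) (hΛ : IsWavenumber T Λ) {t : ℝ}
    (ht : t ∈ Ioc 0 T) {v : L2} (hdiv : WeaklyDivFree v) (hmean : MeanFree v) :
    HasSum (fun k => ∑ i,
      (conj (fc v k i) * (Real.exp (-(lam ν k * t)) * rhsCoef ν φ Λ t (fc v) k i)).re) 0 := by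
  rw [weaklyDivFree_iff] at hdiv
  rw [meanFree_iff] at hmean
  have h1 : ∀ k, ∑ i, conj (fc v k i) * (Real.exp (-(lam ν k * t)) * rhsCoef ν φ Λ t (fc v) k i)
      = -∑ i, conj (fc v k i) * nlc (modeBound Λ t) (cut φ (Λ t)) (fc v) k i := fun k => by
    rw [← sum_mul_leray_eq (k := k) (u := fun i => conj (fc v k i))
      (c := nlc (modeBound Λ t) (cut φ (Λ t)) (fc v) k), ← Finset.sum_neg_distrib]
    · refine Finset.sum_congr rfl fun i _ => ?_
      have : (Real.exp (-(lam ν k * t)) : ℂ) * Real.exp (lam ν k * t) = 1 := by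
        rw [← Complex.ofReal_mul, ← Real.exp_add]; simp
      rw [rhsCoef]
      linear_combination (-(conj (fc v k i) *
        leray k (nlc (modeBound Λ t) (cut φ (Λ t)) (fc v) k) i)) * this
    · have := congrArg conj (hdiv k)
      simpa using this
    · rintro rfl i; simp [hmean i]
  have h2 := hasSum_sum_of_ne_finset_zero (L := SummationFilter.unconditional K3)
    (s := box (modeBound Λ t)) (f := fun k => ∑ i,
      (conj (fc v k i) * (Real.exp (-(lam ν k * t)) * rhsCoef ν φ Λ t (fc v) k i)).re)
      (fun k hk => by simp [rhsCoef_eq_zero hφ hΛ ht le_rfl hk])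
  convert h2 using 1
  simp_rw [← Complex.re_sum, h1]
  rw [Finset.sum_neg_distrib, sum_conj_mul_nlc (isMult_cut hφ (Λ t)) (herm_fc v) hdiv]
  simp

/-- Only indices in the active box contribute, and their number is exactly the prefactor in
`RhsLipschitz`; hence a bound independent of `S`. -/
theorem RhsLipschitz.sum_le (hφ : IsCutoff φ) (hΛ : IsWavenumber T Λ) {K : ℝ}
    (hK : RhsLipschitz ν T φ Λ K) {t : ℝ} (ht : t ∈ Ioc 0 T)
    {a b : K3 → Fin 3 → ℂ} {A B : ℝ} (ha : ∀ k i, ‖a k i‖ ≤ A) (hb : ∀ k i, ‖b k i‖ ≤ B)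
    (S : Finset K3) : ∑ k ∈ S, ∑ i, ‖b k i‖ * ‖rhsCoef ν φ Λ t a k i‖
      ≤ B * (K * t ^ (-(7 / 8) : ℝ) * (A * A)) := by
  have hB : 0 ≤ B := (norm_nonneg _).trans (hb 0 0)
  set N := modeBound Λ t
  set Q : ℝ := 3 * (2 * (N : ℝ) + 1) ^ 3 with hQ
  have hQ0 : 0 < Q := by positivity
  calc ∑ k ∈ S, ∑ i, ‖b k i‖ * ‖rhsCoef ν φ Λ t a k i‖
      ≤ ∑ k ∈ S ∪ box N, ∑ i, ‖b k i‖ * ‖rhsCoef ν φ Λ t a k i‖ :=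
        Finset.sum_le_sum_of_subset_of_nonneg Finset.subset_union_left
          fun k _ _ => by positivity
    _ = ∑ k ∈ box N, ∑ i, ‖b k i‖ * ‖rhsCoef ν φ Λ t a k i‖ :=
        (Finset.sum_subset Finset.subset_union_right fun k _ hk => by
          simp [rhsCoef_eq_zero hφ hΛ ht le_rfl hk]).symm
    _ ≤ ∑ k ∈ box N, ∑ _i : Fin 3, B * (K * t ^ (-(7 / 8) : ℝ) * (A * A) / Q) := by
        refine Finset.sum_le_sum fun k _ => Finset.sum_le_sum fun i _ => ?_
        refine mul_le_mul (hb k i) ?_ (norm_nonneg _) hB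
        rw [le_div_iff₀ hQ0, mul_comm]
        exact hK.norm_le ht ha k i
    _ = B * (K * t ^ (-(7 / 8) : ℝ) * (A * A)) := by
        rw [Finset.sum_const, Finset.sum_const, card_box, nsmul_eq_mul, nsmul_eq_mul]
        push_cast
        simp only [Finset.card_univ, Fintype.card_fin]
        field_simp
        rw [hQ]; push_cast; ring

theorem EnergyInequality.norm_le {v₀ : L2} {u : ℝ → L2} (h : EnergyInequality ν T v₀ u) {t : ℝ}
    (ht : t ∈ Icc 0 T) : ‖u t‖ ≤ ‖v₀‖ := by
  have h1 := (le_self_add).trans (h t ht)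
  rw [ENNReal.ofReal_le_ofReal_iff (by positivity)] at h1
  refine (sq_le_sq₀ (norm_nonneg _) (norm_nonneg _)).1 (by linarith)

/-- The radial truncation is never active along solutions of the truncated equation. -/
theorem modeSolution_of_truncated (hν : 0 ≤ ν) (hT : 0 < T) (hφ : IsCutoff φ)
    (hΛ : IsWavenumber T Λ) {M : ℝ} (hM : 0 < M) {v₀ : L2} (hdiv : WeaklyDivFree v₀)
    (hmean : MeanFree v₀) (hb : ‖v₀‖ ≤ M) {u : ℝ → L2} (hucont : ContinuousOn u (Icc 0 T))
    (hF : ForcedModes ν T v₀ u fun s => rhsCoef ν φ Λ s (fc (trunc M (u s)))) :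
    IsModeSolution ν T φ Λ M v₀ u ∧ EnergyBalance ν T v₀ u ∧
      ∀ t ∈ Icc 0 T, WeaklyDivFree (u t) ∧ MeanFree (u t) := by
  obtain ⟨K, hK0, hK⟩ := exists_rhsLipschitz (T := T) hν hφ hΛ
  have hdf : ∀ t ∈ Icc 0 T, WeaklyDivFree (u t) := fun t ht =>
    hF.weaklyDivFree (fun s _ k => sum_mul_rhsCoef s _ k) hdiv ht
  have hmf : ∀ t ∈ Icc 0 T, MeanFree (u t) := fun t ht =>
    hF.meanFree (fun s _ i => rhsCoef_mode_zero s _ i) hmean ht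
  -- A qualitative bound from compactness, used only to justify the energy balance, which then
  -- yields the sharp bound `M`.
  obtain ⟨M', hM'⟩ := isCompact_Icc.exists_bound_of_continuousOn hucont
  have hfct : ∀ s, fc (trunc M (u s)) = (truncFactor M (u s) : ℂ) • fc (u s) := fun s => by
    funext k i; rw [trunc, fc_smul]; rfl
  have hE : EnergyBalance ν T v₀ u := by
    refine hF.energyBalance hν (((isWeight_rpow (T := T) hK0).integrable.mul_const (M * M)).const_mul M')
      (fun s hs S => ?_) (fun s hs => ?_)
    · exact hK.sum_le hφ hΛ hs (fun k i => (norm_fc_le _ k i).trans (norm_trunc_le hM _))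
        (fun k i => (norm_fc_le _ k i).trans (hM' s (Ioc_subset_Icc_self hs))) S
    · have hs' := Ioc_subset_Icc_self hs
      have h1 := (hasSum_conj_mul_rhsCoef (ν := ν) hφ hΛ hs (hdf s hs') (hmf s hs')).mul_left
        (truncFactor M (u s) ^ 2)
      rw [mul_zero] at h1
      refine h1.congr_fun fun k => ?_
      rw [Finset.mul_sum]
      refine Finset.sum_congr rfl fun i _ => ?_
      rw [hfct, rhsCoef_smul, ← Complex.re_ofReal_mul]
      congr 1
      push_cast; ring
  have hle : ∀ t ∈ Icc 0 T, ‖u t‖ ≤ M := fun t ht =>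
    (EnergyInequality.norm_le (fun t ht => (hE t ht).le) ht).trans hb
  have htr : ∀ t ∈ Icc 0 T, trunc M (u t) = u t := fun t ht => by
    rw [trunc, truncFactor_of_le hM (hle t ht), one_smul]
  have htr' : ∀ k i, ∀ s ∈ Ioc 0 T,
      rhsCoef ν φ Λ s (fc (u s)) k i = rhsCoef ν φ Λ s (fc (trunc M (u s))) k i :=
    fun k i s hs => by rw [htr s (Ioc_subset_Icc_self hs)]
  refine ⟨⟨⟨hF.cont, fun k i => (hF.contF k i).congr (htr' k i), fun k i => ?_,
    fun k i t ht => ?_⟩, hle⟩, hE, fun t ht => ⟨hdf t ht, hmf t ht⟩⟩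
  · have := hF.intF k i
    rw [intervalIntegrable_iff_integrableOn_Ioc_of_le hT.le] at this ⊢
    exact this.congr_fun (fun s hs => (htr' k i s hs).symm) measurableSet_Ioc
  · have h := integral_congr_Ioc ht.1 (f := fun s => rhsCoef ν φ Λ s (fc (u s)) k i)
      (g := fun s => rhsCoef ν φ Λ s (fc (trunc M (u s))) k i)
      fun s hs => htr' k i s ⟨hs.1, hs.2.trans ht.2⟩
    rw [h]
    exact hF.eq k i t ht

/-- The solution map of the `Λ`-NSE. -/
theorem exists_modeSolution (hν : 0 ≤ ν) (hT : 0 < T) (hφ : IsCutoff φ) (hΛ : IsWavenumber T Λ)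
    {M : ℝ} (hM : 0 < M) : ∃ U : ℝ → L2 → L2, (∀ t ∈ Icc 0 T, Continuous (U t)) ∧
      ∀ v₀, WeaklyDivFree v₀ → MeanFree v₀ → ‖v₀‖ ≤ M →
        IsModeSolution ν T φ Λ M v₀ (fun t => U t v₀) ∧
        ContinuousOn (fun t => U t v₀) (Icc 0 T) ∧ U 0 v₀ = v₀ ∧
        EnergyBalance ν T v₀ (fun t => U t v₀) ∧
        ∀ t ∈ Icc 0 T, WeaklyDivFree (U t v₀) ∧ MeanFree (U t v₀) := by
  obtain ⟨K, hK0, hK⟩ := exists_rhsLipschitz (T := T) hν hφ hΛ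
  -- `2 * K * M` is the Lipschitz constant on the ball, with the `2` coming from the radial
  -- truncation. Relative to this weight the size `K * M * M` of the force gives `B = M / 2`.
  obtain ⟨Y, hYc, hYeq, hYx⟩ := exists_flow (B := M / 2) hT
    (isWeight_rpow (T := T) (by positivity : 0 ≤ 2 * K * M)) (rhs ν φ Λ M)
    (fun y hy => continuousOn_rhs hν hφ hΛ hM hy)
    (fun s hs x y => (rhs_sub_le hν hφ hΛ hK hM hs x y).trans (le_of_eq (by ring)))
    (fun s hs x => (norm_rhs_le hφ hΛ hK hM hs x).trans (le_of_eq (by ring)))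
  refine ⟨fun t v => heat ν t (Y t v),
    fun t ht => (continuous_mulOp (isMult_heat hν ht.1)).comp (hYx t ht), fun v₀ hdiv hmean hb => ?_⟩
  set u : ℝ → L2 := fun t => heat ν t (Y t v₀) with hu
  have hucont : ContinuousOn u (Icc 0 T) := continuousOn_heat hν (hYc v₀)
  have hrhs : IntervalIntegrable (fun s => rhs ν φ Λ M s (Y s v₀)) volume 0 T :=
    intervalIntegrable_of_bound hT.le
      ((isWeight_rpow (T := T) hK0).integrable.mul_const (M * M))
      (continuousOn_rhs hν hφ hΛ hM (hYc v₀)) fun s hs => norm_rhs_le hφ hΛ hK hM hs _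
  have hF : ForcedModes ν T v₀ u fun s => rhsCoef ν φ Λ s (fc (trunc M (u s))) := by
    have e : ∀ k i, ∀ s ∈ Ioc 0 T, fcL k i (rhs ν φ Λ M s (Y s v₀))
        = rhsCoef ν φ Λ s (fc (trunc M (u s))) k i := fun k i s hs => fc_rhs hφ hΛ M hs _ k i
    refine ⟨fun k i => (continuous_fc k i).comp_continuousOn hucont, fun k i => ?_,
      fun k i => ?_, fun k i t ht => ?_⟩
    · exact ((fcL k i).continuous.comp_continuousOn
        (continuousOn_rhs hν hφ hΛ hM (hYc v₀))).congr fun s hs => (e k i s hs).symm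
    · rw [intervalIntegrable_iff_integrableOn_Ioc_of_le hT.le] at hrhs ⊢
      exact ((fcL k i).integrable_comp hrhs).congr
        ((ae_restrict_iff' measurableSet_Ioc).2 (Eventually.of_forall (e k i)))
    · have h1 : fc (Y t v₀) k i = fc v₀ k i + ∫ s in (0 : ℝ)..t, fcL k i (rhs ν φ Λ M s (Y s v₀)) := by
        rw [ContinuousLinearMap.intervalIntegral_comp_comm _ (intervalIntegrable_of_mem hrhs ht),
          fcL_apply, ← fc_add, ← hYeq v₀ t ht]
      rw [integral_congr_Ioc ht.1 fun s hs => e k i s ⟨hs.1, hs.2.trans ht.2⟩] at h1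
      rw [← h1, hu, fc_heat hν ht.1, ← mul_assoc, ← Complex.ofReal_mul, ← Real.exp_add]
      simp
  have hu0 : u 0 = v₀ := by
    have := hYeq v₀ 0 ⟨le_rfl, hT.le⟩
    simp only [intervalIntegral.integral_same, add_zero] at this
    simp only [hu, this, heat_zero hν]
  obtain ⟨h1, h2, h3⟩ := modeSolution_of_truncated hν hT hφ hΛ hM hdiv hmean hb hucont hF
  exact ⟨h1, hucont, hu0, h2, h3⟩

/-- Uniqueness for the equation in Fourier variables. -/
theorem IsModeSolution.unique (hν : 0 ≤ ν) (hφ : IsCutoff φ) (hΛ : IsWavenumber T Λ) {M : ℝ}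
    {v₀ : L2} {u v : ℝ → L2} (hu : IsModeSolution ν T φ Λ M v₀ u)
    (hv : IsModeSolution ν T φ Λ M v₀ v) {t : ℝ} (ht : t ∈ Icc 0 T) : u t = v t := by
  obtain ⟨K, hK0, hK⟩ := exists_rhsLipschitz (T := T) hν hφ hΛ
  have hM : 0 ≤ M := (norm_nonneg _).trans (hu.bound t ht)
  have hW := isWeight_rpow (T := T) (by positivity : 0 ≤ K * M)
  set A : ℝ → ℝ := fun s => 8 * (K * M) * s ^ (1 / 8 : ℝ) with hA
  -- One use of Duhamel's formula halves the weighted bound. The estimate is made per coefficient,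
  -- uniformly in `(k, i)`, so continuity in norm is not needed.
  have step : ∀ D, 0 ≤ D → (∀ s ∈ Icc 0 T, ∀ k i,
      ‖fc (u s) k i - fc (v s) k i‖ ≤ Real.exp (2 * A s) * D) →
      ∀ s ∈ Icc 0 T, ∀ k i, ‖fc (u s) k i - fc (v s) k i‖ ≤ Real.exp (2 * A s) * (D / 2) := by
    intro D hD h s hs k i
    have h1 : fc (u s) k i - fc (v s) k i = Real.exp (-(lam ν k * s)) * ∫ r in (0 : ℝ)..s,
        (rhsCoef ν φ Λ r (fc (u r)) k i - rhsCoef ν φ Λ r (fc (v r)) k i) := by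
      rw [intervalIntegral.integral_sub (intervalIntegrable_of_mem (hu.forced.intF k i) hs)
        (intervalIntegrable_of_mem (hv.forced.intF k i) hs), hu.forced.fc_eq k i hs,
        hv.forced.fc_eq k i hs]
      ring
    rw [h1, norm_mul, Complex.norm_real, Real.norm_of_nonneg (Real.exp_nonneg _)]
    have h2 := mul_nonneg (lam_nonneg hν k) hs.1
    refine (mul_le_of_le_one_left (norm_nonneg _)
      (Real.exp_le_one_iff.2 (by linarith))).trans ?_
    refine hW.norm_integral_le hs hD fun r hr => ?_
    have hr' : r ∈ Ioc 0 T := ⟨hr.1, hr.2.trans hs.2⟩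
    have hr'' := Ioc_subset_Icc_self hr'
    refine le_trans (le_mul_of_one_le_left (norm_nonneg _) ?_) ((hK r hr' _ _ M _
      (fun k i => (norm_fc_le _ k i).trans (hu.bound r hr''))
      (fun k i => (norm_fc_le _ k i).trans (hv.bound r hr'')) (h r hr'') k i).trans (le_of_eq ?_))
    · have : (1 : ℝ) ≤ (2 * (modeBound Λ r : ℝ) + 1) ^ 3 :=
        one_le_pow₀ (by have := (modeBound Λ r).cast_nonneg (α := ℝ); linarith)
      linarith
    · ring
  -- The starting value `2 * M` is the trivial bound for the difference of two coefficients of size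
  -- at most `M`.
  have hall : ∀ n : ℕ, ∀ s ∈ Icc 0 T, ∀ k i,
      ‖fc (u s) k i - fc (v s) k i‖ ≤ Real.exp (2 * A s) * (2 * M / 2 ^ n) := by
    intro n
    induction n with
    | zero =>
      intro s hs k i
      have h1 := (norm_fc_le (u s) k i).trans (hu.bound s hs)
      have h2 := (norm_fc_le (v s) k i).trans (hv.bound s hs)
      have h3 : 1 ≤ Real.exp (2 * A s) :=
        Real.one_le_exp (mul_nonneg zero_le_two (hW.nonneg s hs))
      refine (norm_sub_le _ _).trans ?_
      rw [pow_zero, div_one]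
      nlinarith
    | succ n ih =>
      intro s hs k i
      have := step _ (by positivity) ih s hs k i
      rwa [div_div, ← pow_succ] at this
  refine L2_ext fun k i => ?_
  have hlim : Tendsto (fun n : ℕ => Real.exp (2 * A t) * (2 * M / 2 ^ n)) atTop (𝓝 0) := by
    have : Tendsto (fun n : ℕ => Real.exp (2 * A t) * (2 * M) * (1 / 2) ^ n) atTop
        (𝓝 (Real.exp (2 * A t) * (2 * M) * 0)) :=
      (tendsto_pow_atTop_nhds_zero_of_lt_one (by norm_num) (by norm_num)).const_mul _
    rw [mul_zero] at this
    refine this.congr fun n => ?_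
    rw [one_div, inv_pow]; ring
  have := ge_of_tendsto' hlim fun n => hall n t ht k i
  exact sub_eq_zero.1 (norm_le_zero_iff.1 this)

/-! ### Equivalence of the Fourier and weak formulations -/

/-- Advection by a divergence-free field has zero mean: only pairs `n = -l` contribute, with the
factor `l · a(l) = 0`. Needed because `leray` discards the mean. -/
theorem advect_zero_mode {N : ℕ} {a b : K3 → Fin 3 → ℂ} (hdiv : ∀ k, ∑ j, (k j : ℂ) * a k j = 0)
    (i : Fin 3) : advect N a b 0 i = 0 := by
  refine Finset.sum_eq_zero fun l _ => Finset.sum_eq_zero fun n _ => ?_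
  split_ifs with h
  · have hn : n = -l := (neg_eq_of_add_eq_zero_right h).symm
    subst hn
    have : ∑ j, a l j * (2 * Real.pi * Complex.I * ((-l) j : ℤ))
        = -(2 * Real.pi * Complex.I) * ∑ j, (l j : ℂ) * a l j := by
      rw [Finset.mul_sum]
      refine Finset.sum_congr rfl fun j _ => ?_
      rw [Pi.neg_apply]; push_cast; ring
    rw [this, hdiv]; simp
  · rfl

theorem nlc_zero_mode {N : ℕ} {m : K3 → ℝ} {a : K3 → Fin 3 → ℂ}
    (hdiv : ∀ k, ∑ j, (k j : ℂ) * a k j = 0) (i : Fin 3) : nlc N m a 0 i = 0 := by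
  rw [nlc, advect_zero_mode, mul_zero]
  intro k
  have : ∀ j, (k j : ℂ) * (m k * a k j) = m k * (k j * a k j) := fun j => by ring
  simp_rw [this]
  rw [← Finset.mul_sum, hdiv, mul_zero]

/-- Here the condition at `k = 0` falls on `c` instead of `u`, because test fields need not be mean
free whereas the nonlinearity is. -/
theorem sum_mul_leray_eq' {k : K3} {u : Fin 3 → ℂ} (hu : ∑ i, (k i : ℂ) * u i = 0)
    {c : Fin 3 → ℂ} (h0 : k = 0 → ∀ i, c i = 0) :
    ∑ i, u i * leray k c i = ∑ i, u i * c i := by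
  by_cases hk : k = 0
  · simp [h0 hk, hk, leray]
  · exact sum_mul_leray_eq hu (fun h => absurd h hk) c

theorem nonlin_continuous (hφ : IsCutoff φ) {t : ℝ} (ht : 0 < t) (hL : 0 < Λ t) (w : T3 → E3) :
    Continuous (nonlin φ Λ t w) := by
  rw [nonlin_eq hφ ht hL (le_modeBound Λ t)]
  exact (smooth_vtp _ _).continuous

theorem fc_nonlin (hφ : IsCutoff φ) (hΛ : IsWavenumber T Λ) {t : ℝ} (ht : t ∈ Ioc 0 T) (v : L2)
    (k : K3) (i : Fin 3) :
    fc (contL2 (nonlin_continuous hφ ht.1 (hΛ.pos ht) v)) k i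
      = nlc (modeBound Λ t) (cut φ (Λ t)) (fc v) k i := by
  rw [fc_contL2, nonlin_eq hφ ht.1 (hΛ.pos ht) (le_modeBound Λ t)]
  refine (fourierCoef_retp (herm_nlc (isMult_cut hφ _) (herm_fc v) i) k).trans ?_
  split_ifs with h
  · rfl
  · exact (nlc_eq_zero (cut_eq_zero hφ (hΛ.pos ht) (le_modeBound Λ t) h) _ _).symm

theorem exp_mul_rhsCoef (t : ℝ) (a : K3 → Fin 3 → ℂ) (k : K3) (i : Fin 3) :
    Real.exp (-(lam ν k * t)) * rhsCoef ν φ Λ t a k i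
      = -leray k (nlc (modeBound Λ t) (cut φ (Λ t)) a k) i := by
  have : (Real.exp (-(lam ν k * t)) : ℂ) * Real.exp (lam ν k * t) = 1 := by
    rw [← Complex.ofReal_mul, ← Real.exp_add]; simp
  rw [rhsCoef]
  linear_combination (-leray k (nlc (modeBound Λ t) (cut φ (Λ t)) a k) i) * this

theorem ForcedModes.integrable_deriv {v₀ : L2} {u : ℝ → L2} {F : ℝ → K3 → Fin 3 → ℂ}
    (h : ForcedModes ν T v₀ u F) (k : K3) (i : Fin 3) {t : ℝ} (ht : t ∈ Icc 0 T) :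
    IntervalIntegrable (fun s =>
      -(lam ν k * fc (u s) k i) + Real.exp (-(lam ν k * s)) * F s k i) volume 0 t := by
  refine IntervalIntegrable.add (ContinuousOn.intervalIntegrable ?_) ?_
  · rw [uIcc_of_le ht.1]
    exact (continuousOn_const.mul ((h.cont k i).mono (Icc_subset_Icc_right ht.2))).neg
  · refine (intervalIntegrable_of_mem (h.intF k i) ht).continuousOn_mul ?_
    exact (Complex.continuous_ofReal.comp (by fun_prop)).continuousOn

theorem ForcedModes.fc_eq_integral {v₀ : L2} {u : ℝ → L2} {F : ℝ → K3 → Fin 3 → ℂ}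
    (h : ForcedModes ν T v₀ u F) (k : K3) (i : Fin 3) {t : ℝ} (ht : t ∈ Icc 0 T) :
    fc (u t) k i = fc v₀ k i + ∫ s in (0 : ℝ)..t,
      (-(lam ν k * fc (u s) k i) + Real.exp (-(lam ν k * s)) * F s k i) := by
  have h0 : fc (u 0) k i = fc v₀ k i := by
    simpa using h.fc_eq k i (t := 0) ⟨le_rfl, ht.1.trans ht.2⟩
  rw [intervalIntegral.integral_eq_sub_of_hasDerivAt_of_le ht.1
    ((h.cont k i).mono (Icc_subset_Icc_right ht.2)) (fun s hs => ?_) (h.integrable_deriv k i ht), h0]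
  · ring
  · exact (h.hasDerivWithinAt k i ⟨hs.1, hs.2.le.trans ht.2⟩).hasDerivAt
      (Ioc_mem_nhds hs.1 (hs.2.trans_le ht.2))

theorem lam_mul_fc_lap {ψ : T3 → E3} (hψ : Smooth ψ) (k : K3) (i : Fin 3) :
    (ν : ℂ) * fc (contL2 hψ.lap.continuous) k i = -(lam ν k * fc (contL2 hψ.continuous) k i) := by
  rw [fc_contL2, fc_contL2, fourierCoef_lap hψ, lam]
  push_cast; ring

/-- Solutions of the equation in Fourier variables solve the weak formulation. -/
theorem IsModeSolution.solvesWeakly (hν : 0 ≤ ν) (hφ : IsCutoff φ)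
    (hΛ : IsWavenumber T Λ) {M : ℝ} {v₀ : L2} {u : ℝ → L2} (hu : IsModeSolution ν T φ Λ M v₀ u)
    (hdiv : ∀ t ∈ Icc 0 T, WeaklyDivFree (u t)) (hmean : ∀ t ∈ Icc 0 T, MeanFree (u t)) :
    SolvesWeakly ν T φ Λ v₀ u where
  divFree := hdiv
  meanFree := hmean
  equation ψ hψ hψd t ht := by
    obtain ⟨K, hK0, hK⟩ := exists_rhsLipschitz (T := T) hν hφ hΛ
    have hM : 0 ≤ M := (norm_nonneg _).trans (hu.bound t ht)
    set Ψ := contL2 hψ.continuous with hΨ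
    set LΨ := contL2 hψ.lap.continuous with hLΨ
    have hΨd : ∀ k : K3, ∑ j, (k j : ℂ) * fc Ψ k j = 0 := fun k => by
      simp_rw [hΨ, fc_contL2]; exact sum_fourierCoef_of_dvg hψ hψd k
    set d : ℝ → K3 → Fin 3 → ℂ := fun s k i => -(lam ν k * fc (u s) k i) +
      Real.exp (-(lam ν k * s)) * rhsCoef ν φ Λ s (fc (u s)) k i with hd
    have hdi : ∀ k i, IntervalIntegrable (fun s => (conj (d s k i) * fc Ψ k i).re) volume 0 t :=
      fun k i => by
        have h1 := hu.forced.integrable_deriv k i ht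
        have h2 : IntervalIntegrable (fun s => conj (d s k i) * fc Ψ k i) volume 0 t :=
          IntervalIntegrable.mul_const
            (⟨Complex.conjCLE.toContinuousLinearMap.integrable_comp h1.1,
              Complex.conjCLE.toContinuousLinearMap.integrable_comp h1.2⟩ :
              IntervalIntegrable (fun s => conj (d s k i)) volume 0 t) _
        exact ⟨h2.1.re, h2.2.re⟩
    have hmode : ∀ k, ∑ i, (conj (fc (u t) k i) * fc Ψ k i).re =
        ∑ i, (conj (fc v₀ k i) * fc Ψ k i).re +
          ∫ s in (0 : ℝ)..t, ∑ i, (conj (d s k i) * fc Ψ k i).re := fun k => by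
      rw [intervalIntegral.integral_finsetSum fun i _ => hdi k i, ← Finset.sum_add_distrib]
      refine Finset.sum_congr rfl fun i _ => ?_
      rw [hu.forced.fc_eq_integral k i ht]
      have h1 := hu.forced.integrable_deriv k i ht
      -- Conjugation makes the pairing with `Ψ` linear over `ℝ` only, which is enough to pass under
      -- the time integral.
      let ℓ : ℂ →L[ℝ] ℝ := LinearMap.toContinuousLinearMap
        { toFun := fun z => (conj z * fc Ψ k i).re
          map_add' := fun z w => by simp only [map_add, add_mul, Complex.add_re]
          map_smul' := fun c z => by simp; ring }
      have h2 := ℓ.intervalIntegral_comp_comm h1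
      have h3 : ∀ z, ℓ z = (conj z * fc Ψ k i).re := fun z => rfl
      simp only [h3] at h2
      rw [map_add, add_mul, Complex.add_re, ← h2]
    have hsum : ∀ s ∈ Ioc 0 t, HasSum (fun k => ∑ i, (conj (d s k i) * fc Ψ k i).re)
        (ν * ∫ x, inner ℝ (u s x) (lap ψ x) ∂vol
          - ∫ x, inner ℝ (nonlin φ Λ s (u s) x) (ψ x) ∂vol) := fun s hs => by
      have hs' : s ∈ Ioc 0 T := ⟨hs.1, hs.2.trans ht.2⟩
      have hn := nonlin_continuous hφ hs'.1 (hΛ.pos hs') (u s)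
      have e1 : ∫ x, inner ℝ (nonlin φ Λ s (u s) x) (ψ x) ∂vol = inner ℝ (contL2 hn) Ψ := by
        rw [← integral_inner_eq (contL2 hn) hψ.continuous]
        exact integral_congr_ae ((coeFn_contL2 hn).mono fun x hx => by simp only [hx])
      rw [integral_inner_eq _ hψ.lap.continuous, e1]
      have h1 := ((hasSum_fc_inner (u s) LΨ).mul_left ν).sub (hasSum_fc_inner (contL2 hn) Ψ)
      refine h1.congr_fun fun k => ?_
      have hdu := (weaklyDivFree_iff _).1 (hdiv s (Ioc_subset_Icc_self hs'))
      have h2 : ∑ i, conj (fc (contL2 hn) k i) * fc Ψ k i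
          = -∑ i, conj (Real.exp (-(lam ν k * s)) * rhsCoef ν φ Λ s (fc (u s)) k i)
            * fc Ψ k i := by
        rw [← Finset.sum_neg_distrib]
        have h3 := congrArg conj (sum_mul_leray_eq' (k := k) (u := fun i => conj (fc Ψ k i))
          (c := nlc (modeBound Λ s) (cut φ (Λ s)) (fc (u s)) k)
          (by simpa using congrArg conj (hΨd k))
          (by rintro rfl i; exact nlc_zero_mode hdu i))
        simp only [map_sum, map_mul, Complex.conj_conj] at h3
        simp_rw [exp_mul_rhsCoef, fc_nonlin hφ hΛ hs', map_neg, neg_mul, neg_neg]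
        simp_rw [mul_comm _ (fc Ψ k _)]
        exact h3.symm
      simp only [← Complex.re_sum]
      rw [h2, ← Complex.re_ofReal_mul, ← Complex.sub_re, sub_neg_eq_add]
      congr 1
      rw [Finset.mul_sum, ← Finset.sum_add_distrib]
      refine Finset.sum_congr rfl fun i _ => ?_
      have h4 := lam_mul_fc_lap (ν := ν) hψ k i
      rw [← hLΨ, ← hΨ] at h4
      simp only [hd, map_add, map_neg, map_mul, Complex.conj_ofReal]
      linear_combination (-conj (fc (u s) k i)) * h4
    -- The dominating function splits in two. The viscous term, with the Laplacian moved onto `ψ`,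
    -- is bounded by half a sum of squares and Parseval; the nonlinear term by the `ℓ¹` bound
    -- `RhsLipschitz.sum_le`.
    have hfin := hasSum_integral_of_bound ht.1
      (L := fun s => (M ^ 2 + ν ^ 2 * ‖LΨ‖ ^ 2) / 2 +
        ‖Ψ‖ * (K * s ^ (-(7 / 8) : ℝ) * (M * M)))
      (fun k => by
        have := IntervalIntegrable.sum (μ := volume) (a := 0) (b := t) Finset.univ
          (fun i _ => hdi k i)
        simpa [Finset.sum_fn] using this)
      (intervalIntegrable_const.add (intervalIntegrable_of_mem
        (((isWeight_rpow (T := T) hK0).integrable.mul_const (M * M)).const_mul ‖Ψ‖) ht))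
      (fun s hs S => ?_) hsum
    · have hA := hasSum_fc_inner (u t) Ψ
      have hB := (hasSum_fc_inner v₀ Ψ).add hfin
      rw [integral_inner_eq _ hψ.continuous, integral_inner_eq _ hψ.continuous]
      refine hA.unique (hB.congr_fun fun k => ?_)
      exact hmode k
    · have hs' : s ∈ Ioc 0 T := ⟨hs.1, hs.2.trans ht.2⟩
      have hus := hu.bound s (Ioc_subset_Icc_self hs')
      have h1 : ∀ k i, ‖(conj (d s k i) * fc Ψ k i).re‖ ≤
          (‖fc (u s) k i‖ ^ 2 + ν ^ 2 * ‖fc LΨ k i‖ ^ 2) / 2 +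
            ‖fc Ψ k i‖ * ‖rhsCoef ν φ Λ s (fc (u s)) k i‖ := fun k i => by
        refine (Complex.abs_re_le_norm _).trans ?_
        have h4 := lam_mul_fc_lap (ν := ν) hψ k i
        rw [← hLΨ, ← hΨ] at h4
        have h5 : conj (d s k i) * fc Ψ k i = conj (fc (u s) k i) * (ν * fc LΨ k i) +
            conj (Real.exp (-(lam ν k * s)) * rhsCoef ν φ Λ s (fc (u s)) k i) * fc Ψ k i := by
          simp only [hd, map_add, map_neg, map_mul, Complex.conj_ofReal]
          linear_combination (-conj (fc (u s) k i)) * h4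
        rw [h5]
        refine (norm_add_le _ _).trans (add_le_add ?_ ?_)
        · rw [norm_mul, norm_mul, RCLike.norm_conj, Complex.norm_real]
          have := sq_nonneg (‖fc (u s) k i‖ - ‖ν‖ * ‖fc LΨ k i‖)
          have h6 : ‖ν‖ ^ 2 = ν ^ 2 := by rw [Real.norm_eq_abs, sq_abs]
          nlinarith
        · rw [norm_mul, RCLike.norm_conj, norm_mul, Complex.norm_real,
            Real.norm_of_nonneg (Real.exp_nonneg _), mul_comm]
          refine mul_le_mul_of_nonneg_left (mul_le_of_le_one_left (norm_nonneg _) ?_) (norm_nonneg _)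
          have := mul_nonneg (lam_nonneg hν k) hs.1.le
          exact Real.exp_le_one_iff.2 (by linarith)
      refine (Finset.sum_le_sum fun k _ => (norm_sum_le _ _).trans
        (Finset.sum_le_sum fun i _ => h1 k i)).trans ?_
      simp only [Finset.sum_add_distrib, ← Finset.sum_div, ← Finset.mul_sum]
      have h7 := sum_le_hasSum S (fun k _ => by positivity) (hasSum_fc_sq (u s))
      have h8 := sum_le_hasSum S (fun k _ => by positivity) (hasSum_fc_sq LΨ)
      have h9 := hK.sum_le hφ hΛ hs' (fun k i => (norm_fc_le (u s) k i).trans hus)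
        (fun k i => norm_fc_le Ψ k i) S
      have h10 : ‖u s‖ ^ 2 ≤ M ^ 2 := by gcongr
      have h11 := mul_le_mul_of_nonneg_left h8 (sq_nonneg ν)
      linarith

/-- The coefficients of the divergence-free test field which detects the mode `(k, i)`. -/
noncomputable def testCoef (ζ : ℂ) (k : K3) (i : Fin 3) (j : Fin 3) : ℂ :=
  ζ * leray k (Pi.single i 1) j

/-- Symmetry of the Leray projection: pairing with a projected basis vector reads off a projected
coefficient. -/
theorem sum_testCoef (ζ : ℂ) (k : K3) (i : Fin 3) (c : Fin 3 → ℂ) :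
    ∑ j, testCoef ζ k i j * c j = ζ * leray k c i := by
  simp only [testCoef, mul_assoc, ← Finset.mul_sum]
  congr 1
  by_cases hk : k = 0
  · simp [leray, hk]
  · simp only [leray, if_neg hk]
    have h1 : ∑ l, (k l : ℂ) * (Pi.single i 1 : Fin 3 → ℂ) l = k i := by
      simp [Pi.single_apply]
    simp_rw [h1, sub_mul, Finset.sum_sub_distrib]
    congr 1
    · simp [Pi.single_apply]
    · rw [Finset.mul_sum, Finset.sum_div]
      exact Finset.sum_congr rfl fun j _ => by ring

theorem leray_of_div {k : K3} {c : Fin 3 → ℂ} (h : ∑ j, (k j : ℂ) * c j = 0)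
    (h0 : k = 0 → ∀ i, c i = 0) (i : Fin 3) : leray k c i = c i := by
  by_cases hk : k = 0
  · simp [leray, hk, h0 hk]
  · simp [leray, hk, h]

theorem dvg_vtp_testCoef (ζ : ℂ) (k : K3) (i : Fin 3) (x : T3) :
    dvg (vtp {-k} fun _ => testCoef ζ k i) x = 0 := by
  simp only [dvg, pd_vtp, vtp, retp, Finset.sum_singleton]
  rw [← Complex.re_sum]
  have : ∑ j, 2 * Real.pi * Complex.I * (((-k) j : ℤ) : ℂ) * testCoef ζ k i j * mFourier (-k) x
      = -(2 * Real.pi * Complex.I) * ζ * mFourier (-k) x *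
        ∑ j, (k j : ℂ) * leray k (Pi.single i 1) j := by
    rw [Finset.mul_sum]
    refine Finset.sum_congr rfl fun j _ => ?_
    rw [testCoef, Pi.neg_apply]; push_cast; ring
  rw [this, sum_mul_leray]; simp

theorem lap_vtp_singleton (ν : ℝ) (k : K3) (c : Fin 3 → ℂ) (v : L2) :
    ν * ∫ x, inner ℝ (v x) (lap (vtp {-k} fun _ => c) x) ∂vol
      = -(lam ν k * ∫ x, inner ℝ (v x) (vtp {-k} (fun _ => c) x) ∂vol) := by
  have h1 : lap (vtp {-k} fun _ => c)
      = fun x => (-((2 * Real.pi) ^ 2 * ∑ j, (k j : ℝ) ^ 2)) • vtp {-k} (fun _ => c) x := by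
    funext x; ext i
    simp only [lap, pd_vtp, vtp, retp, Finset.sum_singleton, WithLp.ofLp_sum, Finset.sum_apply,
      PiLp.smul_apply, smul_eq_mul]
    rw [← Complex.re_sum, ← Complex.re_ofReal_mul]
    congr 1
    push_cast
    rw [Finset.mul_sum, ← Finset.sum_neg_distrib, Finset.sum_mul]
    refine Finset.sum_congr rfl fun j _ => ?_
    rw [Pi.neg_apply]; push_cast
    linear_combination (2 * Real.pi * k j) ^ 2 * c i * mFourier (-k) x * Complex.I_sq
  rw [h1]
  simp_rw [inner_smul_right]
  rw [integral_const_mul, lam]; ring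

/-- Bounded solutions of the weak formulation with continuous Fourier coefficients solve the equation
in Fourier variables. -/
theorem SolvesWeakly.isModeSolution (hν : 0 ≤ ν) (hT : 0 < T) (hφ : IsCutoff φ)
    (hΛ : IsWavenumber T Λ) {M : ℝ} {v₀ : L2} (hdiv : WeaklyDivFree v₀) (hmean : MeanFree v₀)
    {v : ℝ → L2} (h : SolvesWeakly ν T φ Λ v₀ v)
    (hcont : ∀ k i, ContinuousOn (fun t => fc (v t) k i) (Icc 0 T))
    (hb : ∀ t ∈ Icc 0 T, ‖v t‖ ≤ M) : IsModeSolution ν T φ Λ M v₀ v := by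
  obtain ⟨K, hK0, hK⟩ := exists_rhsLipschitz (T := T) hν hφ hΛ
  have hcF : ∀ k i, ContinuousOn (fun t => rhsCoef ν φ Λ t (fc (v t)) k i) (Ioc 0 T) := fun k i =>
    continuousOn_rhsCoef hφ hΛ (fun k i => (hcont k i).mono Ioc_subset_Icc_self) k i
  have hiF : ∀ k i, IntervalIntegrable (fun t => rhsCoef ν φ Λ t (fc (v t)) k i) volume 0 T :=
    fun k i => intervalIntegrable_of_bound hT.le
      ((isWeight_rpow (T := T) hK0).integrable.mul_const (M * M)) (hcF k i) fun s hs =>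
      hK.norm_le' hs (fun k i => (norm_fc_le _ k i).trans (hb s (Ioc_subset_Icc_self hs))) k i
  refine ⟨⟨hcont, hcF, hiF, fun k i t ht => ?_⟩, hb⟩
  have hce : Continuous fun s : ℝ => (Real.exp (lam ν k * s) : ℂ) :=
    Complex.continuous_ofReal.comp (by fun_prop)
  set f : ℝ → ℂ := fun s => -(lam ν k * fc (v s) k i) +
    Real.exp (-(lam ν k * s)) * rhsCoef ν φ Λ s (fc (v s)) k i with hf
  have hif : IntervalIntegrable f volume 0 T := by
    refine IntervalIntegrable.add (ContinuousOn.intervalIntegrable ?_) ?_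
    · rw [uIcc_of_le hT.le]
      exact (continuousOn_const.mul (hcont k i)).neg
    · refine (hiF k i).continuousOn_mul ?_
      exact (Complex.continuous_ofReal.comp (by fun_prop)).continuousOn
  have hdf : ∀ s ∈ Icc 0 T, ∀ i, leray k (fc (v s) k) i = fc (v s) k i := fun s hs =>
    leray_of_div ((weaklyDivFree_iff _).1 (h.divFree s hs) k)
      (by rintro rfl; exact (meanFree_iff _).1 (h.meanFree s hs))
  have hd0 : ∀ i, leray k (fc v₀ k) i = fc v₀ k i :=
    leray_of_div ((weaklyDivFree_iff _).1 hdiv k) (by rintro rfl; exact (meanFree_iff _).1 hmean)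
  have hint : ∀ (w : L2) (ζ : ℂ), ∫ x, inner ℝ (w x) (vtp {-k} (fun _ => testCoef ζ k i) x) ∂vol
      = (ζ * leray k (fc w k) i).re := fun w ζ => by
    rw [integral_inner_vtp, Finset.sum_singleton, neg_neg, sum_testCoef]
  have hweak : ∀ t ∈ Icc 0 T, fc (v t) k i = fc v₀ k i + ∫ s in (0 : ℝ)..t, f s := by
    intro t ht
    -- Real test fields see only real parts; varying `ζ` recovers the whole complex coefficient.
    have key : ∀ ζ : ℂ, (ζ * fc (v t) k i).re
        = (ζ * (fc v₀ k i + ∫ s in (0 : ℝ)..t, f s)).re := fun ζ => by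
      have h1 := h.equation _ (smooth_vtp {-k} fun _ => testCoef ζ k i)
        (dvg_vtp_testCoef ζ k i) t ht
      rw [hint, hint, hdf t ht, hd0] at h1
      rw [h1, mul_add, Complex.add_re]
      congr 1
      have hif' := (intervalIntegrable_of_mem hif ht).const_mul ζ
      have h2 := Complex.reCLM.intervalIntegral_comp_comm hif'
      rw [intervalIntegral.integral_const_mul] at h2
      rw [← Complex.reCLM_apply, ← h2]
      refine integral_congr_Ioc ht.1 fun s hs => ?_
      have hs' : s ∈ Ioc 0 T := ⟨hs.1, hs.2.trans ht.2⟩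
      have hn := nonlin_continuous hφ hs'.1 (hΛ.pos hs') (v s)
      have e1 : ∫ x, inner ℝ (nonlin φ Λ s (v s) x) (vtp {-k} (fun _ => testCoef ζ k i) x) ∂vol
          = ∫ x, inner ℝ (contL2 hn x) (vtp {-k} (fun _ => testCoef ζ k i) x) ∂vol :=
        integral_congr_ae ((coeFn_contL2 hn).mono fun x hx => by simp only [hx])
      have e2 : fc (contL2 hn) k = nlc (modeBound Λ s) (cut φ (Λ s)) (fc (v s)) k :=
        funext fun i => fc_nonlin hφ hΛ hs' (v s) k i
      rw [lap_vtp_singleton, e1, hint, hint, hdf s (Ioc_subset_Icc_self hs'), e2,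
        Complex.reCLM_apply, hf]
      simp only [exp_mul_rhsCoef]
      rw [← Complex.re_ofReal_mul, ← Complex.neg_re, ← Complex.sub_re]
      congr 1
      ring
    apply Complex.ext
    · simpa using key 1
    · simpa using key (-Complex.I)
  have hv0 : fc (v 0) k i = fc v₀ k i := by simpa using hweak 0 ⟨le_rfl, hT.le⟩
  have hcf : ContinuousOn f (Ioc 0 T) := by
    refine (continuousOn_const.mul ((hcont k i).mono Ioc_subset_Icc_self)).neg.add
      (ContinuousOn.mul ?_ (hcF k i))
    exact (Complex.continuous_ofReal.comp (by fun_prop)).continuousOn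
  -- Multiplication by `exp (λ_k s)` removes the viscous term, leaving only the force in the
  -- derivative.
  rw [intervalIntegral.integral_eq_sub_of_hasDerivAt_of_le ht.1
    (f := fun s => Real.exp (lam ν k * s) * fc (v s) k i)
    (hce.continuousOn.mul ((hcont k i).mono (Icc_subset_Icc_right ht.2))) (fun s hs => ?_)
    (intervalIntegrable_of_mem (hiF k i) ht)]
  · simp [hv0]
  · have hs' : s ∈ Ioc 0 T := ⟨hs.1, hs.2.le.trans ht.2⟩
    have hsn : Ioc 0 T ∈ 𝓝 s := Ioc_mem_nhds hs.1 (hs.2.trans_le ht.2)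
    have h1 := (((hasDerivWithinAt_primitive hif hcf hs').const_add (fc v₀ k i)).congr
      (fun r hr => hweak r (Ioc_subset_Icc_self hr)) (hweak s (Ioc_subset_Icc_self hs'))).hasDerivAt
      hsn
    have h2 : HasDerivAt (fun s : ℝ => (Real.exp (lam ν k * s) : ℂ))
        ((Real.exp (lam ν k * s) * (lam ν k * 1) : ℝ) : ℂ) s :=
      (((hasDerivAt_id s).const_mul (lam ν k)).exp).ofReal_comp
    refine (h2.mul h1).congr_deriv ?_
    have h3 : (Real.exp (lam ν k * s) : ℂ) * Real.exp (-(lam ν k * s)) = 1 := by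
      rw [← Complex.ofReal_mul, ← Real.exp_add]; simp
    simp only [hf]
    push_cast at h3 ⊢
    linear_combination (rhsCoef ν φ Λ s (fc (v s)) k i) * h3

/-- Weak continuity tested against fields carrying a single frequency; the real and imaginary parts
are then reassembled. -/
theorem continuousOn_fc_of_weakly {v : ℝ → L2}
    (h : ∀ w : L2, ContinuousOn (fun t => (inner ℝ w (v t) : ℝ)) (Icc 0 T)) (k : K3) (i : Fin 3) :
    ContinuousOn (fun t => fc (v t) k i) (Icc 0 T) := by
  have key : ∀ ζ : ℂ, ContinuousOn (fun t => (ζ * fc (v t) k i).re) (Icc 0 T) := fun ζ => by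
    have hs := (smooth_vtp {-k} fun _ => Pi.single i ζ).continuous
    refine (h (contL2 hs)).congr fun t _ => ?_
    beta_reduce
    rw [real_inner_comm, ← integral_inner_eq, integral_inner_vtp, Finset.sum_singleton, neg_neg]
    simp [Pi.single_apply]
  have h1 : ContinuousOn (fun t => (((1 * fc (v t) k i).re : ℝ) : ℂ) +
      ((-Complex.I * fc (v t) k i).re : ℝ) * Complex.I) (Icc 0 T) :=
    (Complex.continuous_ofReal.comp_continuousOn (key 1)).add
      ((Complex.continuous_ofReal.comp_continuousOn (key (-Complex.I))).mul continuousOn_const)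
  refine h1.congr fun t _ => ?_
  apply Complex.ext <;> simp

/-! ### Series of exponentials -/

section ExpSeries

variable {ι V : Type} [NormedAddCommGroup V] [NormedSpace ℝ V]

theorem hasFDerivAt_exp_smul {F : Type} [NormedAddCommGroup F] [NormedSpace ℂ F]
    (ℓ : V →L[ℝ] ℂ) (b : F) (z : V) :
    HasFDerivAt (fun z => Complex.exp (ℓ z) • b) (Complex.exp (ℓ z) • ℓ.smulRight b) z := by
  refine ((ℓ.hasFDerivAt.cexp).smul_const b).congr_fderiv ?_
  ext w
  simp [mul_smul]

/-- Convergence, with all polynomial weights, of a series of exponentials on a set where the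
exponentials are bounded by `E`. -/
structure ExpSummable {F : Type} [NormedAddCommGroup F] (s : Set V) (ℓ : ι → V →L[ℝ] ℂ)
    (E : ι → ℝ) (b : ι → F) : Prop where
  le : ∀ k, ∀ z ∈ s, ‖Complex.exp (ℓ k z)‖ ≤ E k
  summable : ∀ m : ℕ, Summable fun k => E k * ‖ℓ k‖ ^ m * ‖b k‖

variable {F : Type} [NormedAddCommGroup F] [NormedSpace ℂ F] {s : Set V} {ℓ : ι → V →L[ℝ] ℂ}
  {E : ι → ℝ} {b : ι → F}

theorem ExpSummable.norm_le (h : ExpSummable s ℓ E b) (k : ι) {z : V} (hz : z ∈ s) :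
    ‖Complex.exp (ℓ k z) • b k‖ ≤ E k * ‖ℓ k‖ ^ 0 * ‖b k‖ := by
  rw [norm_smul, pow_zero, mul_one]
  exact mul_le_mul_of_nonneg_right (h.le k z hz) (norm_nonneg _)

theorem ExpSummable.summable_apply [CompleteSpace F] (h : ExpSummable s ℓ E b) {z : V}
    (hz : z ∈ s) : Summable fun k => Complex.exp (ℓ k z) • b k :=
  Summable.of_norm_bounded (h.summable 0) fun k => h.norm_le k hz

/-- Differentiating a term brings down one factor `ℓ k`, absorbed by the next polynomial weight. The
derivative is thus a series of the same kind, with values in linear maps. -/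
theorem ExpSummable.smulRight (h : ExpSummable s ℓ E b) (hs : s.Nonempty) :
    ExpSummable s ℓ E fun k => (ℓ k).smulRight (b k) where
  le := h.le
  summable m := by
    obtain ⟨z, hz⟩ := hs
    have hE : ∀ k, 0 ≤ E k := fun k => (norm_nonneg _).trans (h.le k z hz)
    have hb : ∀ k, ‖(ℓ k).smulRight (b k)‖ ≤ ‖ℓ k‖ * ‖b k‖ := fun k =>
      ContinuousLinearMap.opNorm_le_bound _ (by positivity) fun w => by
        rw [ContinuousLinearMap.smulRight_apply, norm_smul]
        have := mul_le_mul_of_nonneg_right ((ℓ k).le_opNorm w) (norm_nonneg (b k))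
        linarith
    refine Summable.of_nonneg_of_le (fun k => ?_) (fun k => ?_) (h.summable (m + 1))
    · have := hE k; positivity
    · rw [pow_succ, mul_assoc (E k), mul_assoc (E k), mul_assoc (‖ℓ k‖ ^ m)]
      have := hE k
      gcongr
      exact hb k

theorem ExpSummable.hasFDerivAt [CompleteSpace F] (h : ExpSummable s ℓ E b) (hs : IsOpen s)
    (hc : IsPreconnected s) {z : V} (hz : z ∈ s) :
    HasFDerivAt (fun z => ∑' k, Complex.exp (ℓ k z) • b k)
      (∑' k, Complex.exp (ℓ k z) • (ℓ k).smulRight (b k)) z :=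
  hasFDerivAt_tsum_of_isPreconnected ((h.smulRight ⟨z, hz⟩).summable 0) hs hc
    (fun k z _ => hasFDerivAt_exp_smul (ℓ k) (b k) z)
    (fun k w hw => (h.smulRight ⟨w, hw⟩).norm_le k hw) hz (h.summable_apply hz) hz

/-- The target space is quantified inside the statement because each differentiation changes it. -/
theorem ExpSummable.contDiffOn_nat (hs : IsOpen s) (hc : IsPreconnected s) (n : ℕ) :
    ∀ {F : Type} [NormedAddCommGroup F] [NormedSpace ℂ F] [CompleteSpace F] {b : ι → F},
      ExpSummable s ℓ E b → ContDiffOn ℝ n (fun z => ∑' k, Complex.exp (ℓ k z) • b k) s := by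
  induction n with
  | zero =>
    intro F _ _ _ b h
    rw [Nat.cast_zero, contDiffOn_zero]
    exact fun z hz => (h.hasFDerivAt hs hc hz).continuousAt.continuousWithinAt
  | succ n ih =>
    intro F _ _ _ b h
    rcases s.eq_empty_or_nonempty with rfl | hne
    · exact contDiffOn_empty
    push_cast
    refine (contDiffOn_succ_iff_fderiv_of_isOpen hs).2
      ⟨fun z hz => (h.hasFDerivAt hs hc hz).differentiableAt.differentiableWithinAt, by simp, ?_⟩
    exact (ih (h.smulRight hne)).congr fun z hz => (h.hasFDerivAt hs hc hz).fderiv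

theorem ExpSummable.contDiffOn [CompleteSpace F] (h : ExpSummable s ℓ E b) (hs : IsOpen s)
    (hc : IsPreconnected s) : ContDiffOn ℝ ∞ (fun z => ∑' k, Complex.exp (ℓ k z) • b k) s :=
  contDiffOn_infty.2 fun n => ExpSummable.contDiffOn_nat hs hc n h

theorem ExpSummable.fderiv_apply [CompleteSpace F] (h : ExpSummable s ℓ E b) {z : V} (hz : z ∈ s)
    (w : V) : (∑' k, Complex.exp (ℓ k z) • (ℓ k).smulRight (b k)) w
      = ∑' k, (Complex.exp (ℓ k z) * ℓ k w) • b k := by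
  have := (ContinuousLinearMap.apply ℝ F w).map_tsum ((h.smulRight ⟨z, hz⟩).summable_apply hz)
  simpa [mul_smul] using this

end ExpSeries

/-! ### The frequency sums of the heat flow -/

/-- The squared length of a frequency. -/
def ksq (k : K3) : ℝ := ∑ i, (k i : ℝ) ^ 2

theorem ksq_nonneg (k : K3) : 0 ≤ ksq k := Finset.sum_nonneg fun _ _ => sq_nonneg _

/-- Each factor `1 + (k i)²` is at most `1 + ksq k`, so the sum is dominated by a product of three
convergent one-dimensional sums. -/
theorem summable_inv_one_add_ksq : Summable fun k : K3 => ((1 + ksq k) ^ 3)⁻¹ := by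
  classical
  have hg : Summable fun n : ℤ => (1 + (n : ℝ) ^ 2)⁻¹ := by
    have h1 : Summable fun n : ℤ => |(n : ℝ)| ^ (-2 : ℝ) :=
      Real.summable_abs_int_rpow (by norm_num)
    refine h1.of_norm_bounded_eventually ?_
    filter_upwards [(finite_singleton (0 : ℤ)).compl_mem_cofinite] with n hn
    have hn : (n : ℝ) ≠ 0 := by exact_mod_cast hn
    rw [Real.norm_of_nonneg (by positivity), Real.rpow_neg (abs_nonneg _), Real.rpow_two, sq_abs]
    gcongr
    linarith
  have h : Summable fun k : K3 => ∏ i, (1 + (k i : ℝ) ^ 2)⁻¹ := by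
    refine summable_of_sum_le (c := ∏ _i : Fin 3, ∑' n : ℤ, (1 + (n : ℝ) ^ 2)⁻¹)
      (fun k => Finset.prod_nonneg fun _ _ => by positivity) fun S => ?_
    calc ∑ k ∈ S, ∏ i, (1 + (k i : ℝ) ^ 2)⁻¹
        ≤ ∑ k ∈ Fintype.piFinset fun i => S.image fun k : K3 => k i, ∏ i, (1 + (k i : ℝ) ^ 2)⁻¹ := by
          refine Finset.sum_le_sum_of_subset_of_nonneg (fun k hk => ?_)
            fun k _ _ => (by positivity : (0 : ℝ) ≤ ∏ i, (1 + (k i : ℝ) ^ 2)⁻¹)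
          exact Fintype.mem_piFinset.2 fun i => Finset.mem_image_of_mem _ hk
      _ = ∏ i, ∑ n ∈ S.image fun k : K3 => k i, (1 + (n : ℝ) ^ 2)⁻¹ :=
          (Finset.prod_univ_sum (fun i => S.image fun k : K3 => k i)
            fun _ (n : ℤ) => (1 + (n : ℝ) ^ 2)⁻¹).symm
      _ ≤ _ := Finset.prod_le_prod (fun _ _ => Finset.sum_nonneg fun _ _ => by positivity)
          fun _ _ => hg.sum_le_tsum _ fun _ _ => by positivity
  refine Summable.of_nonneg_of_le (fun k => ?_) (fun k => ?_) h
  · have := ksq_nonneg k; positivity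
  · rw [Finset.prod_inv_distrib]
    gcongr
    have : ∀ i ∈ Finset.univ, 1 + (k i : ℝ) ^ 2 ≤ 1 + ksq k := fun i hi => by
      gcongr
      exact Finset.single_le_sum (f := fun i => (k i : ℝ) ^ 2) (fun _ _ => sq_nonneg _) hi
    simpa using Finset.prod_le_prod (fun _ _ => by positivity) this

/-- From `x^n / n! ≤ exp x` with `n = m + 3`: three powers are left over to ensure summability over
`ℤ³`. -/
theorem summable_pow_mul_exp {c : ℝ} (hc : 0 < c) (m : ℕ) :
    Summable fun k : K3 => (1 + ksq k) ^ m * Real.exp (-(c * ksq k)) := by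
  refine Summable.of_nonneg_of_le (fun k => ?_) (fun k => ?_)
    (summable_inv_one_add_ksq.mul_left (((m + 3).factorial : ℝ) * Real.exp c / c ^ (m + 3)))
  · have := ksq_nonneg k; positivity
  · have hq : 0 < 1 + ksq k := by linarith [ksq_nonneg k]
    have h1 := Real.pow_div_factorial_le_exp (c * (1 + ksq k)) (by positivity) (m + 3)
    have h2 : Real.exp (c * (1 + ksq k)) * Real.exp (-(c * ksq k)) = Real.exp c := by
      rw [← Real.exp_add]; congr 1; ring
    rw [div_le_iff₀ (by positivity), mul_pow] at h1
    rw [← div_eq_mul_inv, le_div_iff₀ (by positivity), le_div_iff₀ (by positivity)]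
    calc (1 + ksq k) ^ m * Real.exp (-(c * ksq k)) * (1 + ksq k) ^ 3 * c ^ (m + 3)
        = c ^ (m + 3) * (1 + ksq k) ^ (m + 3) * Real.exp (-(c * ksq k)) := by ring
      _ ≤ Real.exp (c * (1 + ksq k)) * (m + 3).factorial * Real.exp (-(c * ksq k)) := by gcongr
      _ = _ := by rw [← h2]; ring

/-- The exponent of the mode `k` of the heat flow, as a linear function of time and position. -/
noncomputable def heatExponent (ν : ℝ) (k : K3) : ℝ × E3 →L[ℝ] ℂ :=
  (-(lam ν k : ℂ)) • Complex.ofRealCLM.comp (ContinuousLinearMap.fst ℝ ℝ E3) +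
    (2 * Real.pi * Complex.I) •
      Complex.ofRealCLM.comp ((innerSL ℝ (freq k)).comp (ContinuousLinearMap.snd ℝ ℝ E3))

theorem heatExponent_apply (ν : ℝ) (k : K3) (z : ℝ × E3) : heatExponent ν k z =
    -(lam ν k * z.1) + 2 * Real.pi * Complex.I * ∑ j, (k j : ℂ) * (z.2 j : ℂ) := by
  simp [heatExponent, freq, PiLp.inner_apply, mul_comm]

theorem exp_heatExponent (ν : ℝ) (k : K3) (t : ℝ) (y : E3) : Complex.exp (heatExponent ν k (t, y))
    = Real.exp (-(lam ν k * t)) * mFourier k (proj y) := by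
  rw [heatExponent_apply, Complex.exp_add, mFourier_proj]
  push_cast; rfl

theorem norm_freq_sq (k : K3) : ‖freq k‖ ^ 2 = ksq k := by
  simp [EuclideanSpace.norm_sq_eq, freq, ksq]

theorem norm_heatExponent_le {ν : ℝ} (hν : 0 ≤ ν) (k : K3) :
    ‖heatExponent ν k‖ ≤ (ν * (2 * Real.pi) ^ 2 + 2 * Real.pi) * (1 + ksq k) := by
  have h0 := ksq_nonneg k
  have h1 : ‖freq k‖ ≤ 1 + ksq k := by
    have := norm_freq_sq k
    nlinarith [norm_nonneg (freq k), sq_nonneg (‖freq k‖ - 1)]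
  refine ContinuousLinearMap.opNorm_le_bound _ (by positivity) fun z => ?_
  have e : heatExponent ν k z = ((-(lam ν k * z.1) : ℝ) : ℂ) +
      2 * Real.pi * Complex.I * ((inner ℝ (freq k) z.2 : ℝ) : ℂ) := by
    rw [heatExponent_apply]; simp [freq, PiLp.inner_apply, mul_comm]
  have h2 : ‖inner ℝ (freq k) z.2‖ ≤ (1 + ksq k) * ‖z‖ :=
    (norm_inner_le_norm _ _).trans (mul_le_mul h1 (norm_snd_le z) (norm_nonneg _) (by linarith))
  have h3 : ‖lam ν k * z.1‖ ≤ ν * (2 * Real.pi) ^ 2 * (1 + ksq k) * ‖z‖ := by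
    rw [norm_mul, Real.norm_of_nonneg (lam_nonneg hν k)]
    refine mul_le_mul ?_ (norm_fst_le z) (norm_nonneg _) (by positivity)
    rw [lam, ← ksq, mul_assoc]
    gcongr
    linarith
  have e2 : ‖(2 * Real.pi * Complex.I : ℂ)‖ = 2 * Real.pi := by simp [abs_of_pos Real.pi_pos]
  rw [e]
  refine (norm_add_le _ _).trans ?_
  rw [Complex.norm_real, norm_neg, norm_mul (_ : ℂ), e2, Complex.norm_real]
  have := mul_le_mul_of_nonneg_left h2 (by positivity : 0 ≤ 2 * Real.pi)
  linarith

/-- The amplitudes may grow like `exp (λ_k ε)`. On `t > 2ε` the heat factor is at most `exp (-2 λ_k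
ε)`, so a Gaussian `exp (-λ_k ε)` remains to beat every polynomial weight. -/
theorem expSummable_heat {ν ε B : ℝ} (hν : 0 < ν) (hε : 0 < ε) {b : K3 → ℂ}
    (hb : ∀ k, ‖b k‖ ≤ B * Real.exp (lam ν k * ε)) :
    ExpSummable (Ioi (2 * ε) ×ˢ (univ : Set E3)) (heatExponent ν)
      (fun k => Real.exp (-(lam ν k * (2 * ε)))) b where
  le k z hz := by
    obtain ⟨t, y⟩ := z
    rw [exp_heatExponent, norm_mul, norm_mFourier_apply, mul_one, Complex.norm_real,
      Real.norm_of_nonneg (Real.exp_nonneg _)]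
    have := lam_nonneg hν.le k
    have := hz.1
    gcongr
    exact this.le
  summable m := by
    have hc : 0 < ν * (2 * Real.pi) ^ 2 * ε := by positivity
    have hB : 0 ≤ B := by
      have := (norm_nonneg _).trans (hb 0)
      simpa [lam] using this
    refine Summable.of_nonneg_of_le (fun k => by positivity) (fun k => ?_)
      ((summable_pow_mul_exp hc m).mul_left (B * (ν * (2 * Real.pi) ^ 2 + 2 * Real.pi) ^ m))
    have h1 : Real.exp (-(ν * (2 * Real.pi) ^ 2 * ε * ksq k))
        = Real.exp (-(lam ν k * (2 * ε))) * Real.exp (lam ν k * ε) := by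
      rw [← Real.exp_add, lam, ← ksq]; congr 1; ring
    calc Real.exp (-(lam ν k * (2 * ε))) * ‖heatExponent ν k‖ ^ m * ‖b k‖
        ≤ Real.exp (-(lam ν k * (2 * ε))) *
          ((ν * (2 * Real.pi) ^ 2 + 2 * Real.pi) * (1 + ksq k)) ^ m *
            (B * Real.exp (lam ν k * ε)) := by
          have h2 := norm_heatExponent_le hν.le k
          have h3 := (norm_nonneg _).trans h2
          gcongr
          exact hb k
      _ = _ := by rw [h1, mul_pow]; ring

/-! ### Absolutely convergent Fourier series -/

/-- The real part of a Fourier series. -/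
noncomputable def fser (c : K3 → ℂ) (x : T3) : ℝ := (∑' k, c k * mFourier k x).re

theorem summable_mul_mFourier {c : K3 → ℂ} (hc : Summable fun k => ‖c k‖) (x : T3) :
    Summable fun k => c k * mFourier k x :=
  Summable.of_norm_bounded hc fun k => by rw [norm_mul, norm_mFourier_apply, mul_one]

theorem continuous_fser {c : K3 → ℂ} (hc : Summable fun k => ‖c k‖) : Continuous (fser c) :=
  Complex.continuous_re.comp <| continuous_tsum
    (fun k => continuous_const.mul (mFourier k).continuous) hc
    fun k x => by rw [norm_mul, norm_mFourier_apply, mul_one]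

theorem fser_add {c d : K3 → ℂ} (hc : Summable fun k => ‖c k‖) (hd : Summable fun k => ‖d k‖)
    (x : T3) : fser (fun k => c k + d k) x = fser c x + fser d x := by
  simp only [fser, add_mul]
  rw [(summable_mul_mFourier hc x).tsum_add (summable_mul_mFourier hd x), Complex.add_re]

theorem fser_smul (r : ℝ) (c : K3 → ℂ) (x : T3) : fser (fun k => r * c k) x = r * fser c x := by
  simp only [fser, mul_assoc, tsum_mul_left, Complex.re_ofReal_mul]

theorem fser_eq_retp {S : Finset K3} {c : K3 → ℂ} (h : ∀ k ∉ S, c k = 0) : fser c = retp S c := by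
  funext x
  rw [fser, retp, tsum_eq_sum fun k hk => by rw [h k hk, zero_mul]]

theorem fourierCoef_fser {c : K3 → ℂ} (hc : Summable fun k => ‖c k‖) (hH : Herm c) (k : K3) :
    fourierCoef (fser c) k = c k := by
  have hre : ∀ x, (fser c x : ℂ) = ∑' l, c l * mFourier l x := fun x => by
    refine Complex.conj_eq_iff_re.1 ?_
    rw [Complex.conj_tsum, ← (Equiv.neg K3).tsum_eq]
    refine tsum_congr fun l => ?_
    rw [Equiv.neg_apply, map_mul, hH, Complex.conj_conj, mFourier_neg, Complex.conj_conj]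
  rw [fourierCoef_eq]
  simp_rw [hre, ← tsum_mul_left]
  have h1 : ∀ l x, mFourier (-k) x * (c l * mFourier l x) = c l * mFourier (l + -k) x :=
    fun l x => by rw [mFourier_add]; ring
  simp_rw [h1]
  have hi : ∀ l, Integrable (fun x => c l * mFourier (l + -k) x) vol := fun l =>
    (continuous_const.mul (mFourier _).continuous).integrable_vol
  have h2 := hasSum_integral_of_summable_integral_norm hi (by
    simpa [norm_mul, norm_mFourier_apply] using hc)
  refine h2.unique ?_
  simp_rw [integral_const_mul, integral_mFourier, add_neg_eq_zero]
  refine (hasSum_ite_eq k (c k)).congr_fun fun l => ?_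
  split_ifs with h
  · rw [h, mul_one]
  · rw [mul_zero]

theorem eq_fser {f : T3 → ℝ} (hf : Continuous f) (hs : Summable fun k => ‖fourierCoef f k‖) :
    f = fser (fourierCoef f) := by
  funext x
  let g : C(T3, ℂ) := ⟨fun x => (f x : ℂ), Complex.continuous_ofReal.comp hf⟩
  have h := hasSum_mFourier_series_apply_of_summable (f := g) (Summable.of_norm hs) x
  have h2 := congrArg Complex.re h.tsum_eq
  simpa [g, fser, fourierCoef] using h2.symm

/-! ### Smoothness in time of the Fourier coefficients -/

theorem contDiffOn_nlc {s : Set ℝ} {n : WithTop ℕ∞} {m : ℝ → K3 → ℝ} {a : ℝ → K3 → Fin 3 → ℂ}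
    (N : ℕ) (hm : ∀ k, ContDiffOn ℝ n (fun t => m t k) s)
    (ha : ∀ k i, ContDiffOn ℝ n (fun t => a t k i) s) (k : K3) (i : Fin 3) :
    ContDiffOn ℝ n (fun t => nlc N (m t) (a t) k i) s := by
  have hm' : ∀ k, ContDiffOn ℝ n (fun t => (m t k : ℂ)) s := fun k =>
    Complex.ofRealCLM.contDiff.comp_contDiffOn (hm k)
  unfold nlc advect
  refine (hm' k).mul (ContDiffOn.sum fun l _ => ContDiffOn.sum fun q _ => ?_)
  split_ifs
  · exact (ContDiffOn.sum fun j _ =>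
      ((hm' l).mul (ha l j)).mul contDiffOn_const).mul ((hm' q).mul (ha q i))
  · exact contDiffOn_const

theorem contDiffOn_leray {s : Set ℝ} {n : WithTop ℕ∞} {c : ℝ → Fin 3 → ℂ}
    (hc : ∀ i, ContDiffOn ℝ n (fun t => c t i) s) (k : K3) (i : Fin 3) :
    ContDiffOn ℝ n (fun t => leray k (c t) i) s := by
  unfold leray
  split_ifs
  · exact contDiffOn_const
  · simp only [div_eq_mul_inv]
    exact (hc i).sub ((contDiffOn_const.mul
      (ContDiffOn.sum fun j _ => contDiffOn_const.mul (hc j))).mul contDiffOn_const)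

theorem contDiffOn_Ioc_of_forall {X : Type*} [NormedAddCommGroup X] [NormedSpace ℝ X] {f : ℝ → X}
    {n : WithTop ℕ∞} (h : ∀ ε ∈ Ioc 0 T, ContDiffOn ℝ n f (Ioc ε T)) :
    ContDiffOn ℝ n f (Ioc 0 T) :=
  contDiffOn_of_locally_contDiffOn fun t ht =>
    ⟨Ioi (t / 2), isOpen_Ioi, half_lt_self ht.1,
      (h (t / 2) ⟨half_pos ht.1, by linarith [ht.1, ht.2]⟩).mono fun _ hs => ⟨hs.2, hs.1.2⟩⟩

theorem contDiff_exp_mul (c : ℝ) {n : WithTop ℕ∞} :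
    ContDiff ℝ n fun t : ℝ => (Real.exp (c * t) : ℂ) :=
  Complex.ofRealCLM.contDiff.comp (Real.contDiff_exp.comp (contDiff_const.mul contDiff_id))

theorem contDiffOn_rhsCoef (hφ : IsCutoff φ) (hΛ : IsWavenumber T Λ) {n : ℕ}
    {a : ℝ → K3 → Fin 3 → ℂ} (ha : ∀ k i, ContDiffOn ℝ n (fun t => a t k i) (Ioc 0 T)) (k : K3)
    (i : Fin 3) : ContDiffOn ℝ n (fun t => rhsCoef ν φ Λ t (a t) k i) (Ioc 0 T) := by
  refine contDiffOn_Ioc_of_forall fun ε hε => ?_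
  have hsub : Ioc ε T ⊆ Ioc 0 T := Ioc_subset_Ioc_left hε.1.le
  have : ContDiffOn ℝ n (fun t => -((Real.exp (lam ν k * t) : ℂ) *
      leray k (nlc (modeBound Λ ε) (cut φ (Λ t)) (a t) k) i)) (Ioc ε T) :=
    ((contDiff_exp_mul _).contDiffOn.mul (contDiffOn_leray (fun i => contDiffOn_nlc _
      (fun k => ((contDiffOn_cut hφ hΛ k).mono hsub).of_le (by exact_mod_cast le_top))
      (fun k i => (ha k i).mono hsub) k i) k i)).neg
  refine this.congr fun t ht => ?_
  exact rhsCoef_eq hφ hΛ (hsub ht) (modeBound_anti hΛ hε (hsub ht) ht.1.le) _ _ _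

/-- Bootstrap: locally in time the derivative of a coefficient is a polynomial in finitely many
coefficients with factors smooth in time, so `C^n` for all of them yields `C^{n+1}`. -/
theorem IsModeSolution.contDiffOn_fc (hφ : IsCutoff φ) (hΛ : IsWavenumber T Λ) {M : ℝ} {v₀ : L2}
    {u : ℝ → L2} (hu : IsModeSolution ν T φ Λ M v₀ u) (k : K3) (i : Fin 3) :
    ContDiffOn ℝ ∞ (fun t => fc (u t) k i) (Ioc 0 T) := by
  refine contDiffOn_infty.2 fun n => ?_
  induction n generalizing k i with
  | zero =>
    rw [Nat.cast_zero, contDiffOn_zero]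
    exact (hu.forced.cont k i).mono Ioc_subset_Icc_self
  | succ n ih =>
    have hd := fun t (ht : t ∈ Ioc 0 T) => hu.forced.hasDerivWithinAt k i ht
    push_cast
    refine (contDiffOn_succ_iff_derivWithin (uniqueDiffOn_Ioc 0 T)).2
      ⟨fun t ht => (hd t ht).differentiableWithinAt, by simp, ?_⟩
    refine ContDiffOn.congr (f₁ := derivWithin (fun t => fc (u t) k i) (Ioc 0 T)) ?_
      fun t ht => (hd t ht).derivWithin (uniqueDiffOn_Ioc 0 T t ht)
    refine ((contDiffOn_const.mul (ih k i)).neg).add (ContDiffOn.mul ?_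
      (contDiffOn_rhsCoef hφ hΛ ih k i))
    simp only [← neg_mul]
    exact (contDiff_exp_mul _).contDiffOn

/-! ### High frequencies -/

/-- A mode outside the box of time `ε` receives no force afterwards and follows the free heat flow.
-/
theorem IsModeSolution.fc_eq_of_notMem (hφ : IsCutoff φ) (hΛ : IsWavenumber T Λ) {M : ℝ} {v₀ : L2}
    {u : ℝ → L2} (hu : IsModeSolution ν T φ Λ M v₀ u) {ε t : ℝ} (hε : ε ∈ Ioc 0 T)
    (ht : t ∈ Icc ε T) {k : K3} (hk : k ∉ box (modeBound Λ ε)) (i : Fin 3) :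
    fc (u t) k i = Real.exp (-(lam ν k * t)) * (Real.exp (lam ν k * ε) * fc (u ε) k i) := by
  have htT : t ∈ Icc 0 T := ⟨hε.1.le.trans ht.1, ht.2⟩
  have hi := hu.forced.intF k i
  rw [hu.forced.fc_eq k i htT, hu.forced.eq k i ε (Ioc_subset_Icc_self hε),
    ← intervalIntegral.integral_add_adjacent_intervals
      (intervalIntegrable_of_mem hi (Ioc_subset_Icc_self hε))
      ((intervalIntegrable_of_mem hi (Ioc_subset_Icc_self hε)).symm.trans
        (intervalIntegrable_of_mem hi htT))]
  have : ∫ s in ε..t, rhsCoef ν φ Λ s (fc (u s)) k i = 0 := by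
    rw [intervalIntegral.integral_of_le ht.1]
    refine setIntegral_eq_zero_of_forall_eq_zero fun s hs => ?_
    have hs' : s ∈ Ioc 0 T := ⟨hε.1.trans hs.1, hs.2.trans ht.2⟩
    exact rhsCoef_eq_zero hφ hΛ hs' (modeBound_anti hΛ hε hs' hs.1.le) hk _ _
  rw [this, add_zero]

/-- The amplitudes of the modes which evolve freely after the time `ε`. -/
noncomputable def freeCoef (ν : ℝ) (Λ : ℝ → ℝ) (u : ℝ → L2) (ε : ℝ) (k : K3) (i : Fin 3) : ℂ :=
  if k ∈ box (modeBound Λ ε) then 0 else Real.exp (lam ν k * ε) * fc (u ε) k i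

theorem IsModeSolution.norm_freeCoef_le {M : ℝ} {v₀ : L2} {u : ℝ → L2}
    (hu : IsModeSolution ν T φ Λ M v₀ u) {ε : ℝ} (hε : ε ∈ Ioc 0 T) (k : K3) (i : Fin 3) :
    ‖freeCoef ν Λ u ε k i‖ ≤ M * Real.exp (lam ν k * ε) := by
  have hM := hu.bound ε (Ioc_subset_Icc_self hε)
  have hM0 := (norm_nonneg _).trans hM
  rw [freeCoef]
  split_ifs
  · simp; positivity
  · rw [norm_mul, Complex.norm_real, Real.norm_of_nonneg (Real.exp_nonneg _), mul_comm]
    gcongr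
    exact (norm_fc_le _ _ _).trans hM

/-- Free evolution from time `t / 2` gives Gaussian decay outside a finite box, and finitely many
exceptions do not affect summability. -/
theorem IsModeSolution.summable_pow (hν : 0 < ν) (hφ : IsCutoff φ) (hΛ : IsWavenumber T Λ) {M : ℝ}
    {v₀ : L2} {u : ℝ → L2} (hu : IsModeSolution ν T φ Λ M v₀ u) {t : ℝ} (ht : t ∈ Ioc 0 T)
    (m : ℕ) (i : Fin 3) : Summable fun k => (1 + ksq k) ^ m * ‖fc (u t) k i‖ := by
  have hε : t / 2 ∈ Ioc 0 T := ⟨half_pos ht.1, by linarith [ht.1, ht.2]⟩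
  have hM := hu.bound _ (Ioc_subset_Icc_self hε)
  have hc : 0 < ν * (2 * Real.pi) ^ 2 * (t / 2) := by have := ht.1; positivity
  refine ((summable_pow_mul_exp hc m).mul_left M).of_norm_bounded_eventually ?_
  filter_upwards [(box (modeBound Λ (t / 2))).finite_toSet.compl_mem_cofinite] with k hk
  have hq := ksq_nonneg k
  rw [hu.fc_eq_of_notMem hφ hΛ hε ⟨by linarith [ht.1], ht.2⟩ hk, ← mul_assoc, ← Complex.ofReal_mul,
    ← Real.exp_add, norm_mul, norm_norm, norm_mul, Complex.norm_real,
    Real.norm_of_nonneg (Real.exp_nonneg _), norm_pow, Real.norm_of_nonneg (by positivity)]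
  have h1 : -(lam ν k * t) + lam ν k * (t / 2) = -(ν * (2 * Real.pi) ^ 2 * (t / 2) * ksq k) := by
    rw [lam, ← ksq]; ring
  have h2 := mul_le_mul_of_nonneg_left ((norm_fc_le (u (t / 2)) k i).trans hM)
    (by positivity : 0 ≤ (1 + ksq k) ^ m * Real.exp (-(ν * (2 * Real.pi) ^ 2 * (t / 2) * ksq k)))
  rw [h1]
  linarith

theorem fser_split {ε : ℝ} (c : K3 → ℂ) (hν : 0 < ν) {B : ℝ} (hε : 0 < ε)
    {b : K3 → ℂ} (hb : ∀ k, ‖b k‖ ≤ B * Real.exp (lam ν k * ε)) {t : ℝ} (ht : 2 * ε < t) (y : E3)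
    (S : Finset K3) : fser (fun k => (if k ∈ S then c k else 0) +
      Real.exp (-(lam ν k * t)) * b k) (proj y) = retp S c (proj y) +
      (∑' k, Complex.exp (heatExponent ν k (t, y)) • b k).re := by
  have hs := (expSummable_heat hν hε hb).summable_apply (z := (t, y)) ⟨ht, mem_univ _⟩
  rw [fser_add]
  · congr 1
    · rw [fser_eq_retp (S := S) fun k hk => if_neg hk, retp, retp]
      congr 1
      exact Finset.sum_congr rfl fun k hk => by rw [if_pos hk]
    · rw [fser]
      congr 1
      refine tsum_congr fun k => ?_
      rw [exp_heatExponent, smul_eq_mul]; ring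
  · refine summable_of_ne_finset_zero (s := S) fun k hk => by rw [if_neg hk, norm_zero]
  · refine hs.norm.congr fun k => ?_
    rw [exp_heatExponent, smul_eq_mul, norm_mul, norm_mul, norm_mul, norm_mFourier_apply, mul_one]

/-! ### The smooth representative -/

/-- The field given by the Fourier series of `v`. -/
noncomputable def series (v : L2) (x : T3) : E3 :=
  WithLp.toLp 2 fun i => fser (fun k => fc v k i) x

theorem series_ae {v : L2} (h : ∀ i, Summable fun k => ‖fc v k i‖) : v =ᵐ[vol] series v := by
  have hc : Continuous (series v) :=
    (PiLp.continuous_toLp 2 _).comp (continuous_pi fun i => continuous_fser (h i))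
  have : v = contL2 hc := L2_ext fun k i => by
    rw [fc_contL2]
    exact (fourierCoef_fser (h i) (herm_fc v i) k).symm
  conv_lhs => rw [this]
  exact coeFn_contL2 hc

theorem contDiffOn_retp {s : Set ℝ} {c : ℝ → K3 → ℂ} (S : Finset K3)
    (hc : ∀ k ∈ S, ContDiffOn ℝ ∞ (fun t => c t k) s) :
    ContDiffOn ℝ ∞ (fun z : ℝ × E3 => retp S (c z.1) (proj z.2)) (s ×ˢ univ) := by
  unfold retp
  refine Complex.reCLM.contDiff.comp_contDiffOn (ContDiffOn.sum fun k hk => ContDiffOn.mul ?_ ?_)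
  · exact (hc k hk).comp contDiff_fst.contDiffOn fun z hz => hz.1
  · exact (ContDiff.comp (smooth_mFourier k) contDiff_snd).contDiffOn

theorem smoothPosTime_of_forall {F : Type*} [NormedAddCommGroup F] [NormedSpace ℝ F]
    {f : ℝ → T3 → F} (h : ∀ ε, 0 < ε → 2 * ε < T →
      ContDiffOn ℝ ∞ (fun z : ℝ × E3 => f z.1 (proj z.2)) (Ioc (2 * ε) T ×ˢ univ)) :
    SmoothPosTime T f := by
  refine contDiffOn_of_locally_contDiffOn fun z hz => ?_
  have h0 := hz.1.1
  have h1 := hz.1.2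
  refine ⟨Ioi (2 * (z.1 / 4)) ×ˢ univ, isOpen_Ioi.prod isOpen_univ,
    ⟨show 2 * (z.1 / 4) < z.1 by linarith, mem_univ _⟩,
    (h (z.1 / 4) (by linarith) (by linarith)).mono ?_⟩
  rintro w ⟨hw, hw'⟩
  exact ⟨⟨hw'.1, hw.1.2⟩, mem_univ _⟩

theorem SmoothPosTime.smooth {F : Type*} [NormedAddCommGroup F] [NormedSpace ℝ F]
    {f : ℝ → T3 → F} (h : SmoothPosTime T f) {t : ℝ} (ht : t ∈ Ioc 0 T) : Smooth (f t) :=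
  contDiffOn_univ.1 (ContDiffOn.comp h (f := fun y : E3 => (t, y)) (s := univ)
    (contDiff_prodMk_right t).contDiffOn fun _ _ => ⟨ht, mem_univ _⟩)

section Solution

variable {M : ℝ} {v₀ : L2} {u : ℝ → L2}

theorem IsModeSolution.fc_eq_split (hφ : IsCutoff φ) (hΛ : IsWavenumber T Λ)
    (hu : IsModeSolution ν T φ Λ M v₀ u) {ε t : ℝ} (hε : ε ∈ Ioc 0 T) (ht : t ∈ Icc ε T) (k : K3)
    (i : Fin 3) : fc (u t) k i = (if k ∈ box (modeBound Λ ε) then fc (u t) k i else 0) +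
      Real.exp (-(lam ν k * t)) * freeCoef ν Λ u ε k i := by
  by_cases hk : k ∈ box (modeBound Λ ε)
  · simp [freeCoef, hk]
  · rw [if_neg hk, freeCoef, if_neg hk, zero_add, hu.fc_eq_of_notMem hφ hΛ hε ht hk]

theorem IsModeSolution.fser_eq (hν : 0 < ν) (hφ : IsCutoff φ) (hΛ : IsWavenumber T Λ)
    (hu : IsModeSolution ν T φ Λ M v₀ u) {ε t : ℝ} (hε : 0 < ε) (ht : t ∈ Ioc (2 * ε) T) (i : Fin 3)
    (y : E3) : fser (fun k => fc (u t) k i) (proj y) =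
      retp (box (modeBound Λ ε)) (fun k => fc (u t) k i) (proj y) +
        (∑' k, Complex.exp (heatExponent ν k (t, y)) • freeCoef ν Λ u ε k i).re := by
  have hε' : ε ∈ Ioc 0 T := ⟨hε, by linarith [ht.1, ht.2]⟩
  rw [← fser_split _ hν hε (hu.norm_freeCoef_le hε' · i) ht.1]
  congr 1
  funext k
  exact hu.fc_eq_split hφ hΛ hε' ⟨by linarith [ht.1], ht.2⟩ k i

/-- For `t > 2ε` the field is a finite sum with coefficients smooth in time plus a smooth series of
exponentials, and `ε` is arbitrary. -/
theorem IsModeSolution.smoothPosTime_series (hν : 0 < ν) (hφ : IsCutoff φ) (hΛ : IsWavenumber T Λ)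
    (hu : IsModeSolution ν T φ Λ M v₀ u) : SmoothPosTime T fun t => series (u t) := by
  refine smoothPosTime_of_forall fun ε hε hεT => contDiffOn_euclidean.2 fun i => ?_
  have hε' : ε ∈ Ioc 0 T := ⟨hε, by linarith⟩
  have h1 := contDiffOn_retp (box (modeBound Λ ε)) fun k _ =>
    (hu.contDiffOn_fc hφ hΛ k i).mono (Ioc_subset_Ioc_left (by linarith : 0 ≤ 2 * ε))
  have h2 := (expSummable_heat hν hε (hu.norm_freeCoef_le hε' · i)).contDiffOn
    (isOpen_Ioi.prod isOpen_univ) (isPreconnected_Ioi.prod isPreconnected_univ)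
  refine (h1.add ((Complex.reCLM.contDiff.comp_contDiffOn h2).mono
    (prod_mono_left Ioc_subset_Ioi_self))).congr fun z hz => ?_
  exact hu.fser_eq hν hφ hΛ hε hz.1 i z.2

/-- The time derivative of a Fourier coefficient. -/
noncomputable def dtCoef (ν : ℝ) (φ : E3 → ℝ) (Λ : ℝ → ℝ) (t : ℝ) (a : K3 → Fin 3 → ℂ) (k : K3)
    (i : Fin 3) : ℂ :=
  -(lam ν k * a k i) + Real.exp (-(lam ν k * t)) * rhsCoef ν φ Λ t a k i

/-- The finite forced part and the free series are differentiated separately and recombined. On free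
modes `dtCoef` reduces to the heat term because the force is zero there. -/
theorem IsModeSolution.hasDerivWithinAt_fser (hν : 0 < ν) (hφ : IsCutoff φ)
    (hΛ : IsWavenumber T Λ) (hu : IsModeSolution ν T φ Λ M v₀ u) {t : ℝ} (ht : t ∈ Ioc 0 T)
    (i : Fin 3) (x : T3) : HasDerivWithinAt (fun s => fser (fun k => fc (u s) k i) x)
      (fser (fun k => dtCoef ν φ Λ t (fc (u t)) k i) x) (Ioc 0 T) t := by
  obtain ⟨y, rfl⟩ := proj_surjective x
  obtain ⟨ε, hε, hεt⟩ : ∃ ε, 0 < ε ∧ 2 * ε < t := ⟨t / 4, by linarith [ht.1], by linarith [ht.1]⟩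
  have hε' : ε ∈ Ioc 0 T := ⟨hε, by linarith [ht.2]⟩
  have htε : t ∈ Icc ε T := ⟨by linarith, ht.2⟩
  set S := box (modeBound Λ ε) with hS
  have hb : ∀ k, ‖freeCoef ν Λ u ε k i‖ ≤ M * Real.exp (lam ν k * ε) :=
    (hu.norm_freeCoef_le hε' · i)
  have hE := expSummable_heat hν hε hb
  have hmem : ((t, y) : ℝ × E3) ∈ Ioi (2 * ε) ×ˢ (univ : Set E3) := ⟨hεt, mem_univ _⟩
  have h1 : HasDerivWithinAt (fun s => retp S (fun k => fc (u s) k i) (proj y))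
      (retp S (fun k => dtCoef ν φ Λ t (fc (u t)) k i) (proj y)) (Ioc 0 T) t := by
    refine Complex.reCLM.hasFDerivAt.comp_hasDerivWithinAt t (HasDerivWithinAt.fun_sum fun k _ => ?_)
    exact (hu.forced.hasDerivWithinAt k i ht).mul_const _
  have h2 : HasDerivWithinAt
      (fun s => (∑' k, Complex.exp (heatExponent ν k (s, y)) • freeCoef ν Λ u ε k i).re)
      (∑' k, (Complex.exp (heatExponent ν k (t, y)) * heatExponent ν k (1, 0)) •
        freeCoef ν Λ u ε k i).re (Ioc 0 T) t := by
    have h3 := hE.hasFDerivAt (isOpen_Ioi.prod isOpen_univ)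
      (isPreconnected_Ioi.prod isPreconnected_univ) hmem
    have h4 : HasDerivAt (fun s : ℝ => ((s, y) : ℝ × E3)) (1, 0) t :=
      (hasDerivAt_id t).prodMk (hasDerivAt_const t y)
    have h5 := h3.comp_hasDerivAt t h4
    rw [hE.fderiv_apply hmem] at h5
    exact (Complex.reCLM.hasFDerivAt.comp_hasDerivAt t h5).hasDerivWithinAt
  have h6 := h1.add h2
  have hev : (fun s => fser (fun k => fc (u s) k i) (proj y)) =ᶠ[𝓝[Ioc 0 T] t]
      (fun s => retp S (fun k => fc (u s) k i) (proj y)) +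
      fun s => (∑' k, Complex.exp (heatExponent ν k (s, y)) • freeCoef ν Λ u ε k i).re := by
    filter_upwards [self_mem_nhdsWithin, mem_nhdsWithin_of_mem_nhds (Ioi_mem_nhds hεt)] with s hs hs'
    exact hu.fser_eq hν hφ hΛ hε ⟨hs', hs.2⟩ i y
  refine (h6.congr_of_eventuallyEq hev (hev.eq_of_nhdsWithin ht)).congr_deriv ?_
  have h7 : ∀ k, dtCoef ν φ Λ t (fc (u t)) k i = (if k ∈ S then dtCoef ν φ Λ t (fc (u t)) k i
      else 0) + Real.exp (-(lam ν k * t)) * -(lam ν k * freeCoef ν Λ u ε k i) := fun k => by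
    by_cases hk : k ∈ S
    · rw [if_pos hk, freeCoef, if_pos hk]; simp
    · rw [if_neg hk, dtCoef, rhsCoef_eq_zero hφ hΛ ht (modeBound_anti hΛ hε' ht htε.1) hk,
        hu.fc_eq_split hφ hΛ hε' htε, if_neg hk]
      ring
  have h8 := (hE.smulRight ⟨_, hmem⟩).summable_apply hmem
  have h0 : ∀ k, heatExponent ν k (1, 0) = -lam ν k := fun k => by simp [heatExponent_apply]
  have h10 : ∀ k, (Complex.exp (heatExponent ν k (t, y)) * heatExponent ν k (1, 0)) •
      freeCoef ν Λ u ε k i = Real.exp (-(lam ν k * t)) * -(lam ν k * freeCoef ν Λ u ε k i) *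
      mFourier k (proj y) := fun k => by
    rw [exp_heatExponent, h0, smul_eq_mul]; ring
  have h9 : Summable fun k => Real.exp (-(lam ν k * t)) * -(lam ν k * freeCoef ν Λ u ε k i) *
      mFourier k (proj y) := by
    refine ((ContinuousLinearMap.apply ℝ ℂ ((1, 0) : ℝ × E3)).summable h8).congr fun k => ?_
    rw [← h10]
    simp [mul_assoc]
  simp_rw [h10]
  have h11 := fser_add (x := proj y)
    (c := fun k => if k ∈ S then dtCoef ν φ Λ t (fc (u t)) k i else 0)
    (d := fun k => Real.exp (-(lam ν k * t)) * -(lam ν k * freeCoef ν Λ u ε k i))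
    (summable_of_ne_finset_zero (s := S) fun k hk => by rw [if_neg hk, norm_zero])
    (h9.norm.congr fun k => by rw [norm_mul, norm_mFourier_apply, mul_one])
  simp only [← h7] at h11
  rw [h11, fser_eq_retp (S := S) fun k hk => if_neg hk, fser, retp, retp]
  congr 2
  exact Finset.sum_congr rfl fun k hk => by rw [if_pos hk]

end Solution

/-! ### The pressure and the pointwise equation -/

/-- Fourier coefficients of the pressure which balances a force with coefficients `c`. -/
noncomputable def pressCoef (k : K3) (c : Fin 3 → ℂ) : ℂ :=
  -(∑ j, (k j : ℂ) * c j) / (2 * Real.pi * Complex.I * ksq k)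

/-- The Leray projection removes a gradient, and the pressure is chosen to supply exactly that
gradient. At `k = 0` there is none, so the force must have zero mean. -/
theorem add_grad_pressCoef {k : K3} {c : Fin 3 → ℂ} (h : k = 0 → ∀ i, c i = 0) (i : Fin 3) :
    -leray k c i + c i + 2 * Real.pi * Complex.I * k i * pressCoef k c = 0 := by
  by_cases hk : k = 0
  · simp [h hk, hk, leray]
  · have h0 : ksq k ≠ 0 := (sum_sq_pos hk).ne'
    have h1 : (ksq k : ℂ) ≠ 0 := by exact_mod_cast h0
    have h2 : (Real.pi : ℂ) ≠ 0 := by exact_mod_cast Real.pi_ne_zero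
    rw [leray, if_neg hk, ← ksq, pressCoef]
    field_simp [Complex.I_ne_zero]
    ring

theorem pressCoef_zero (k : K3) : pressCoef k 0 = 0 := by simp [pressCoef]

/-- The pressure of the `Λ`-NSE. -/
noncomputable def pressure (φ : E3 → ℝ) (Λ : ℝ → ℝ) (u : ℝ → L2) (t : ℝ) : T3 → ℝ :=
  retp (box (modeBound Λ t)) fun k => pressCoef k (nlc (modeBound Λ t) (cut φ (Λ t)) (fc (u t)) k)

theorem retp_mono {S S' : Finset K3} (h : S ⊆ S') {c : K3 → ℂ} (hc : ∀ k ∉ S, c k = 0) :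
    retp S c = retp S' c := by
  funext x
  rw [retp, retp, Finset.sum_subset h fun k _ hk => by rw [hc k hk, zero_mul]]

theorem pressure_eq (hφ : IsCutoff φ) (hΛ : IsWavenumber T Λ) (u : ℝ → L2) {t : ℝ}
    (ht : t ∈ Ioc 0 T) {N : ℕ} (hN : modeBound Λ t ≤ N) :
    pressure φ Λ u t = retp (box N) fun k => pressCoef k (nlc N (cut φ (Λ t)) (fc (u t)) k) := by
  have hc := fun k hk => cut_eq_zero hφ (hΛ.pos ht) (le_modeBound Λ t) (k := k) hk
  have h : ∀ k, nlc N (cut φ (Λ t)) (fc (u t)) k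
      = nlc (modeBound Λ t) (cut φ (Λ t)) (fc (u t)) k := fun k =>
    funext fun i => nlc_congr_box hN hc _ k i
  simp_rw [h]
  refine retp_mono (box_mono hN) fun k hk => ?_
  have : nlc (modeBound Λ t) (cut φ (Λ t)) (fc (u t)) k = 0 :=
    funext fun i => nlc_eq_zero (hc k hk) _ i
  rw [this, pressCoef_zero]

theorem smoothPosTime_pressure (hφ : IsCutoff φ) (hΛ : IsWavenumber T Λ) {u : ℝ → L2}
    (hu : ∀ k i, ContDiffOn ℝ ∞ (fun t => fc (u t) k i) (Ioc 0 T)) :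
    SmoothPosTime T (pressure φ Λ u) := by
  refine smoothPosTime_of_forall fun ε hε hεT => ?_
  have hsub : Ioc (2 * ε) T ⊆ Ioc 0 T := Ioc_subset_Ioc_left (by linarith)
  refine (contDiffOn_retp (c := fun t k => pressCoef k (nlc (modeBound Λ (2 * ε)) (cut φ (Λ t))
    (fc (u t)) k)) (box (modeBound Λ (2 * ε))) fun k _ => ?_).congr fun z hz => ?_
  · unfold pressCoef
    simp only [div_eq_mul_inv]
    exact (ContDiffOn.sum fun j _ => contDiffOn_const.mul (contDiffOn_nlc _
      (fun k => (contDiffOn_cut hφ hΛ k).mono hsub) (fun k i => (hu k i).mono hsub) k j)).neg.mul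
      contDiffOn_const
  · rw [pressure_eq hφ hΛ u (hsub hz.1)
      (modeBound_anti hΛ ⟨by linarith, hεT.le⟩ (hsub hz.1) hz.1.1.le)]

section Solution

variable {M : ℝ} {v₀ : L2} {u : ℝ → L2}

theorem IsModeSolution.summable_fc (hν : 0 < ν) (hφ : IsCutoff φ) (hΛ : IsWavenumber T Λ)
    (hu : IsModeSolution ν T φ Λ M v₀ u) {t : ℝ} (ht : t ∈ Ioc 0 T) (i : Fin 3) :
    Summable fun k => ‖fc (u t) k i‖ := by
  simpa using hu.summable_pow hν hφ hΛ ht 0 i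

theorem IsModeSolution.summable_lam (hν : 0 < ν) (hφ : IsCutoff φ) (hΛ : IsWavenumber T Λ)
    (hu : IsModeSolution ν T φ Λ M v₀ u) {t : ℝ} (ht : t ∈ Ioc 0 T) (i : Fin 3) :
    Summable fun k => ‖-(lam ν k * fc (u t) k i)‖ := by
  refine Summable.of_nonneg_of_le (fun k => norm_nonneg _) (fun k => ?_)
    ((hu.summable_pow hν hφ hΛ ht 1 i).mul_left (ν * (2 * Real.pi) ^ 2))
  have := ksq_nonneg k
  rw [norm_neg, norm_mul, Complex.norm_real, Real.norm_of_nonneg (lam_nonneg hν.le k), lam, ← ksq,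
    pow_one, ← mul_assoc, ← mul_assoc]
  gcongr
  linarith

theorem fourierCoef_series {v : L2} (h : ∀ i, Summable fun k => ‖fc v k i‖) (k : K3) (i : Fin 3) :
    fourierCoef (fun x => series v x i) k = fc v k i :=
  fourierCoef_fser (h i) (herm_fc v i) k

/-- The divergence is continuous with vanishing Fourier coefficients, so it vanishes at every point.
-/
theorem dvg_series {v : L2} (h : ∀ i, Summable fun k => ‖fc v k i‖) (hs : Smooth (series v))
    (hdiv : WeaklyDivFree v) (x : T3) : dvg (series v) x = 0 := by
  have hs' := smooth_vec.1 hs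
  have h1 : Continuous fun x => ∑ j, pd j (fun x => series v x j) x :=
    continuous_finsetSum _ fun j _ => ((hs' j).pd j).continuous
  have h2 : ∀ k, fourierCoef (fun x => ∑ j, pd j (fun x => series v x j) x) k = 0 := fun k => by
    rw [fourierCoef_finsetSum _ fun j _ => ((hs' j).pd j).continuous.integrable_vol]
    simp_rw [fourierCoef_pd (hs' _), fourierCoef_series h, mul_assoc, ← Finset.mul_sum]
    rw [(weaklyDivFree_iff v).1 hdiv]; simp
  have h3 := congrFun (eq_fser h1 (by simp [h2, summable_zero])) x
  rw [dvg, Finset.sum_congr rfl fun j _ => hs.pd_comp j j x, h3]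
  simp [fser, h2]

theorem IsModeSolution.lap_series (hν : 0 < ν) (hφ : IsCutoff φ) (hΛ : IsWavenumber T Λ)
    (hu : IsModeSolution ν T φ Λ M v₀ u) {t : ℝ} (ht : t ∈ Ioc 0 T) (i : Fin 3) (x : T3) :
    ν * lap (series (u t)) x i = fser (fun k => -(lam ν k * fc (u t) k i)) x := by
  have hs : Smooth (series (u t)) := (hu.smoothPosTime_series hν hφ hΛ).smooth ht
  have h1 : Continuous fun x => lap (series (u t)) x i := (smooth_vec.1 hs.lap i).continuous
  have h2 : ∀ k, fourierCoef (fun x => lap (series (u t)) x i) k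
      = ((ν⁻¹ : ℝ) : ℂ) * -(lam ν k * fc (u t) k i) := fun k => by
    have : (ν : ℂ) ≠ 0 := by exact_mod_cast hν.ne'
    rw [fourierCoef_lap hs, fourierCoef_series (hu.summable_fc hν hφ hΛ ht), lam]
    push_cast
    field_simp
  have h3 := congrFun (eq_fser h1 (by
    simp_rw [h2, norm_mul _ (-(_ : ℂ))]
    exact (hu.summable_lam hν hφ hΛ ht i).mul_left _)) x
  beta_reduce at h3
  rw [h3, funext h2, fser_smul, mul_inv_cancel_left₀ hν.ne']

/-- Solutions are smooth for positive times and solve the equation pointwise. -/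
theorem IsModeSolution.isSmoothSolution (hν : 0 < ν) (hφ : IsCutoff φ) (hΛ : IsWavenumber T Λ)
    (hu : IsModeSolution ν T φ Λ M v₀ u) (hdiv : ∀ t ∈ Icc 0 T, WeaklyDivFree (u t)) :
    IsSmoothSolution ν T φ Λ u := by
  refine ⟨fun t => series (u t), pressure φ Λ u,
    fun t ht => series_ae (hu.summable_fc hν hφ hΛ ht), hu.smoothPosTime_series hν hφ hΛ,
    smoothPosTime_pressure hφ hΛ (hu.contDiffOn_fc hφ hΛ), fun t ht x => ?_⟩
  have hsum := hu.summable_fc hν hφ hΛ ht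
  have hd := hdiv t (Ioc_subset_Icc_self ht)
  have hs : Smooth (series (u t)) := (hu.smoothPosTime_series hν hφ hΛ).smooth ht
  refine ⟨dvg_series hsum hs hd x, ?_⟩
  set N := modeBound Λ t with hN
  set c := nlc N (cut φ (Λ t)) (fc (u t)) with hc
  have h1 : HasDerivWithinAt (fun s => series (u s) x)
      (WithLp.toLp 2 fun i => fser (fun k => dtCoef ν φ Λ t (fc (u t)) k i) x) (Ioc 0 T) t :=
    (PiLp.continuousLinearEquiv 2 ℝ fun _ : Fin 3 => ℝ).symm.hasFDerivAt.comp_hasDerivWithinAt t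
      (hasDerivWithinAt_pi.2 fun i => hu.hasDerivWithinAt_fser hν hφ hΛ ht i x)
  rw [h1.derivWithin (uniqueDiffOn_Ioc 0 T t ht)]
  have h2 : nonlin φ Λ t (series (u t)) = vtp (box N) c := by
    rw [nonlin_eq hφ ht.1 (hΛ.pos ht) (le_modeBound Λ t)]
    simp_rw [fourierCoef_series hsum]
    rfl
  have h3 : ∀ i, fser (fun k => dtCoef ν φ Λ t (fc (u t)) k i) x
      = ν * lap (series (u t)) x i + retp (box N) (fun k => -leray k (c k) i) x := fun i => by
    have hz : ∀ k ∉ box N, -leray k (c k) i = 0 := fun k hk => by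
      have : c k = 0 := funext fun i =>
        nlc_eq_zero (cut_eq_zero hφ (hΛ.pos ht) (le_modeBound Λ t) hk) _ i
      rw [this, leray_zero, neg_zero]
    simp only [dtCoef, exp_mul_rhsCoef]
    rw [fser_add (hu.summable_lam hν hφ hΛ ht i)
      (summable_of_ne_finset_zero (s := box N) fun k hk => by rw [hz k hk, norm_zero]),
      hu.lap_series hν hφ hΛ ht, fser_eq_retp hz]
  ext i
  have h4 : grad (pressure φ Λ u t) x i =
      retp (box N) (fun k => 2 * Real.pi * Complex.I * k i * pressCoef k (c k)) x :=
    congrFun (pd_retp _ _ i) x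
  simp only [h2, h3, PiLp.add_apply, PiLp.sub_apply, PiLp.smul_apply, smul_eq_mul, h4,
    PiLp.zero_apply, vtp]
  have h5 : retp (box N) (fun k => -leray k (c k) i) x + retp (box N) (fun k => c k i) x +
      retp (box N) (fun k => 2 * Real.pi * Complex.I * k i * pressCoef k (c k)) x = 0 := by
    simp only [retp, ← Complex.add_re, ← Finset.sum_add_distrib, ← add_mul]
    rw [Finset.sum_eq_zero fun k _ => ?_, Complex.zero_re]
    rw [add_grad_pressCoef, zero_mul]
    rintro rfl i
    exact nlc_zero_mode ((weaklyDivFree_iff _).1 hd) i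
  linarith

end Solution

/-! ### Trigonometric polynomials and the `L¹` bound for the frequency truncation -/

/-- Real trigonometric polynomials. -/
def IsTrig (f : T3 → ℝ) : Prop := ∃ g ∈ mFourierSubalgebra (Fin 3), ∀ x, g x = (f x : ℂ)

theorem IsTrig.mul {f g : T3 → ℝ} (hf : IsTrig f) (hg : IsTrig g) : IsTrig fun x => f x * g x := by
  obtain ⟨F, hF, hF'⟩ := hf
  obtain ⟨G, hG, hG'⟩ := hg
  exact ⟨F * G, mul_mem hF hG, fun x => by simp [hF', hG']⟩

theorem IsTrig.add {f g : T3 → ℝ} (hf : IsTrig f) (hg : IsTrig g) : IsTrig fun x => f x + g x := by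
  obtain ⟨F, hF, hF'⟩ := hf
  obtain ⟨G, hG, hG'⟩ := hg
  exact ⟨F + G, add_mem hF hG, fun x => by simp [hF', hG']⟩

theorem IsTrig.const_mul {f : T3 → ℝ} (hf : IsTrig f) (c : ℝ) : IsTrig fun x => c * f x := by
  obtain ⟨F, hF, hF'⟩ := hf
  exact ⟨(c : ℂ) • F, SMulMemClass.smul_mem _ hF, fun x => by simp [hF']⟩

theorem IsTrig.zero : IsTrig fun _ => 0 := ⟨0, zero_mem _, fun x => by simp⟩

theorem IsTrig.sub {f g : T3 → ℝ} (hf : IsTrig f) (hg : IsTrig g) : IsTrig fun x => f x - g x := by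
  simpa [sub_eq_add_neg] using hf.add (hg.const_mul (-1))

theorem IsTrig.continuous {f : T3 → ℝ} (hf : IsTrig f) : Continuous f := by
  obtain ⟨F, -, hF⟩ := hf
  have : f = fun x => (F x).re := by funext x; simp [hF]
  rw [this]
  exact Complex.continuous_re.comp F.continuous

theorem isTrig_retp {N : ℕ} {c : K3 → ℂ} (hc : Herm c) : IsTrig (retp (box N) c) := by
  refine ⟨∑ k ∈ box N, c k • mFourier k, sum_mem fun k _ => ?_, fun x => ?_⟩
  · exact SMulMemClass.smul_mem _ (Algebra.subset_adjoin ⟨k, rfl⟩)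
  · rw [ofReal_retp hc]; simp

theorem mFourierCoeff_mFourier (l k : K3) :
    mFourierCoeff (mFourier l) k = if l = k then 1 else 0 := by
  have h : ∀ x, mFourier (-k) x * mFourier l x = mFourier (l + -k) x := fun x => by
    rw [mFourier_add]; ring
  have h2 : mFourierCoeff (mFourier l) k = ∫ x, mFourier (-k) x * mFourier l x ∂vol := rfl
  rw [h2]
  simp_rw [h]
  rw [integral_mFourier]
  simp [add_neg_eq_zero]

/-- The complex form of the frequency truncation, as a linear map. -/
noncomputable def cutOp (φ : E3 → ℝ) (L : ℝ) (N : ℕ) (x : T3) : C(T3, ℂ) →ₗ[ℂ] ℂ where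
  toFun g := ∑ k ∈ box N, cut φ L k * mFourierCoeff g k * mFourier k x
  map_add' f g := by
    have : ∀ k, mFourierCoeff (f + g : C(T3, ℂ)) k = mFourierCoeff f k + mFourierCoeff g k :=
      fun k => by
        have h : ∀ f : C(T3, ℂ), Integrable (fun x => mFourier (-k) x * f x) vol := fun f =>
          ((mFourier (-k)).continuous.mul f.continuous).integrable_vol
        rw [mFourierCoeff, mFourierCoeff, mFourierCoeff]
        simp only [ContinuousMap.add_apply, smul_eq_mul, mul_add]
        exact integral_add (h f) (h g)
    simp only [this, mul_add, add_mul, Finset.sum_add_distrib]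
  map_smul' c g := by
    have : ∀ k, mFourierCoeff (c • g : C(T3, ℂ)) k = c * mFourierCoeff g k := fun k => by
      rw [mFourierCoeff, mFourierCoeff, ← integral_const_mul]
      refine integral_congr_ae (Eventually.of_forall fun x => ?_)
      simp only [ContinuousMap.smul_apply, smul_eq_mul]; ring
    simp only [this, RingHom.id_apply, smul_eq_mul, Finset.mul_sum]
    exact Finset.sum_congr rfl fun k _ => by ring

theorem lowPass_eq_cutOp (hφ : IsCutoff φ) {L : ℝ} (hL : 0 < L) {N : ℕ} (hN : 2 * L ≤ N)
    {f : T3 → ℝ} {g : C(T3, ℂ)} (h : ∀ x, g x = (f x : ℂ)) (x : T3) :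
    lowPass φ L f x = (cutOp φ L N x g).re := by
  rw [lowPass_eq hφ hL hN, retp]
  have : ∀ k, mFourierCoeff g k = fourierCoef f k := fun k => by
    rw [fourierCoef, show ⇑g = fun x => (f x : ℂ) from funext h]
  simp only [cutOp, LinearMap.coe_mk, AddHom.coe_mk, this]

theorem cutOp_mFourier (hφ : IsCutoff φ) {L : ℝ} (hL : 0 < L) {N : ℕ} (hN : 2 * L ≤ N) (x : T3)
    (l : K3) : cutOp φ L N x (mFourier l) = cut φ L l * mFourier l x := by
  simp only [cutOp, LinearMap.coe_mk, AddHom.coe_mk, mFourierCoeff_mFourier]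
  by_cases hl : l ∈ box N
  · simp [hl]
  · simp [hl, cut_eq_zero hφ hL hN hl]

theorem trig_induction {p : C(T3, ℂ) → Prop} {g : C(T3, ℂ)} (hg : g ∈ mFourierSubalgebra (Fin 3))
    (h1 : ∀ k, p (mFourier k)) (h0 : p 0) (ha : ∀ f g, p f → p g → p (f + g))
    (hs : ∀ (c : ℂ) f, p f → p (c • f)) : p g := by
  have hg' : g ∈ Submodule.span ℂ (range (mFourier (d := Fin 3))) := by
    rw [← mFourierSubalgebra_coe]; exact hg
  refine Submodule.span_induction (p := fun g _ => p g) ?_ h0 (fun _ _ _ _ => ha _ _)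
    (fun c _ _ => hs c _) hg'
  rintro _ ⟨k, rfl⟩
  exact h1 k

/-- The truncation leaves a trigonometric polynomial unchanged once the wavenumber is large. -/
theorem IsTrig.lowPass_eventually_eq (hφ : IsCutoff φ) {f : T3 → ℝ} (hf : IsTrig f) :
    ∀ᶠ L in atTop, lowPass φ L f = f := by
  obtain ⟨g, hg, hgf⟩ := hf
  have key : ∀ᶠ L : ℝ in atTop, ∀ x, cutOp φ L ⌈2 * L⌉₊ x g = g x := by
    refine trig_induction (p := fun g => ∀ᶠ L : ℝ in atTop, ∀ x, cutOp φ L ⌈2 * L⌉₊ x g = g x) hg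
      (fun k => ?_) ?_ ?_ ?_
    · filter_upwards [eventually_gt_atTop ‖freq k‖] with L hL x
      have hL0 : 0 < L := (norm_nonneg _).trans_lt hL
      rw [cutOp_mFourier hφ hL0 (Nat.le_ceil _), cut, hφ.eq_one, Complex.ofReal_one, one_mul]
      rwa [norm_smul, norm_inv, Real.norm_of_nonneg hL0.le, inv_mul_lt_one₀ hL0]
    · exact Eventually.of_forall fun L x => by simp
    · intro f g hf hg
      filter_upwards [hf, hg] with L h1 h2 x
      rw [map_add, h1, h2]; rfl
    · intro c f hf
      filter_upwards [hf] with L h1 x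
      rw [map_smul, h1]; rfl
  filter_upwards [key, eventually_gt_atTop 0] with L hL hL0
  funext x
  rw [lowPass_eq_cutOp hφ hL0 (Nat.le_ceil _) hgf, hL, hgf, Complex.ofReal_re]

/-- The profile is the inverse Fourier transform of an integrable function. -/
theorem IsCutoff.exists_kernel (hφ : IsCutoff φ) : ∃ Ψ : E3 → ℂ, Continuous Ψ ∧ Integrable Ψ ∧
    ∀ (L : ℝ) (k : K3), (cut φ L k : ℂ) = ∫ v, mFourier k (proj (L⁻¹ • v)) * Ψ v := by
  have h1 : HasCompactSupport fun x => (φ x : ℂ) := by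
    refine HasCompactSupport.of_support_subset_isCompact (isCompact_closedBall (0 : E3) 2)
      fun x hx => ?_
    rw [mem_closedBall_zero_iff]
    by_contra h
    exact hx (by simp [hφ.eq_zero x (not_le.1 h).le])
  have h2 : ContDiff ℝ ∞ fun x => (φ x : ℂ) := Complex.ofRealCLM.contDiff.comp hφ.smooth
  let f : SchwartzMap E3 ℂ := h1.toSchwartzMap h2
  refine ⟨FourierTransform.fourier f, (FourierTransform.fourier f).continuous,
    (FourierTransform.fourier f).integrable, fun L k => ?_⟩
  -- The profile is a Schwartz function; Fourier inversion is evaluated at `k / L`, and the scale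
  -- passes into the argument of the character.
  have h3 : FourierTransformInv.fourierInv (FourierTransform.fourier f) = f :=
    FourierTransform.fourierInv_fourier_eq f
  have h4 := congrArg (fun g : SchwartzMap E3 ℂ => g (L⁻¹ • freq k)) h3
  have h5 : f (L⁻¹ • freq k) = (cut φ L k : ℂ) := rfl
  simp only [h5] at h4
  rw [← h4, SchwartzMap.fourierInv_coe, Real.fourierInv_eq']
  refine integral_congr_ae (Eventually.of_forall fun v => ?_)
  beta_reduce
  rw [mFourier_proj, smul_eq_mul]
  congr 2
  simp only [PiLp.inner_apply, freq, PiLp.smul_apply, RCLike.inner_apply, conj_trivial, smul_eq_mul]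
  push_cast
  rw [Finset.mul_sum, Finset.mul_sum, Finset.sum_mul]
  exact Finset.sum_congr rfl fun j _ => by ring

theorem continuous_proj : Continuous proj := isOpenQuotientMap_proj.continuous

/-- The truncation operators are uniformly bounded on `L¹`. -/
theorem IsCutoff.exists_eLpNorm_lowPass_le (hφ : IsCutoff φ) : ∃ C : ℝ≥0, ∀ L : ℝ, 0 < L →
    ∀ f : T3 → ℝ, IsTrig f → eLpNorm (lowPass φ L f) 1 vol ≤ C * eLpNorm f 1 vol := by
  obtain ⟨Ψ, hΨc, hΨ, hk⟩ := hφ.exists_kernel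
  refine ⟨(∫⁻ v, ‖Ψ v‖ₑ).toNNReal, fun L hL f hf => ?_⟩
  have hfin : ∫⁻ v, ‖Ψ v‖ₑ ≠ ⊤ := hΨ.2.ne
  have hfc := hf.continuous
  obtain ⟨g, hg, hgf⟩ := hf
  -- The truncation is an average of translates of `g` with weight `Ψ`. By linearity this is checked
  -- on characters; the constant `∫ ‖Ψ‖` does not depend on `L`.
  have key : ∀ x, cutOp φ L ⌈2 * L⌉₊ x g = ∫ v, g (x + proj (L⁻¹ • v)) * Ψ v := by
    have hi : ∀ (g : C(T3, ℂ)) x, Integrable fun v => g (x + proj (L⁻¹ • v)) * Ψ v := fun g x =>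
      hΨ.bdd_mul (c := ‖g‖) (g.continuous.comp (continuous_const.add
        (continuous_proj.comp (continuous_const_smul L⁻¹)))).aestronglyMeasurable
        (Eventually.of_forall fun v => g.norm_coe_le_norm _)
    refine trig_induction
      (p := fun g => ∀ x, cutOp φ L ⌈2 * L⌉₊ x g = ∫ v, g (x + proj (L⁻¹ • v)) * Ψ v) hg
      (fun k x => ?_) (fun x => by simp) (fun f g hf hg x => ?_) (fun c f hf x => ?_)
    · rw [cutOp_mFourier hφ hL (Nat.le_ceil _), hk, mul_comm, ← integral_const_mul]
      refine integral_congr_ae (Eventually.of_forall fun v => ?_)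
      simp only [mFourier_apply_add]; ring
    · rw [map_add, hf, hg, ← integral_add (hi f x) (hi g x)]
      refine integral_congr_ae (Eventually.of_forall fun v => ?_)
      simp only [ContinuousMap.add_apply]; ring
    · rw [map_smul, hf, smul_eq_mul, ← integral_const_mul]
      refine integral_congr_ae (Eventually.of_forall fun v => ?_)
      simp only [ContinuousMap.smul_apply, smul_eq_mul]; ring
  have hm : Measurable fun z : T3 × E3 => ‖f (z.1 + proj (L⁻¹ • z.2))‖ₑ * ‖Ψ z.2‖ₑ := by
    have h1 : Continuous fun z : T3 × E3 => f (z.1 + proj (L⁻¹ • z.2)) :=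
      hfc.comp (continuous_fst.add (continuous_proj.comp (continuous_snd.const_smul L⁻¹)))
    exact h1.enorm.measurable.mul (hΨc.comp continuous_snd).enorm.measurable
  rw [eLpNorm_one_eq_lintegral_enorm, eLpNorm_one_eq_lintegral_enorm, ENNReal.coe_toNNReal hfin]
  calc ∫⁻ x, ‖lowPass φ L f x‖ₑ ∂vol
      ≤ ∫⁻ x, (∫⁻ v, ‖f (x + proj (L⁻¹ • v))‖ₑ * ‖Ψ v‖ₑ) ∂vol := by
        refine lintegral_mono fun x => ?_
        rw [lowPass_eq_cutOp hφ hL (Nat.le_ceil _) hgf, key]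
        refine le_trans ?_ ((enorm_integral_le_lintegral_enorm
          fun v => g (x + proj (L⁻¹ • v)) * Ψ v).trans
          (le_of_eq (lintegral_congr fun v => ?_)))
        · rw [← ofReal_norm, ← ofReal_norm]
          exact ENNReal.ofReal_le_ofReal (Complex.abs_re_le_norm _)
        · rw [enorm_mul, hgf, ← ofReal_norm, Complex.norm_real, ofReal_norm]
    _ = ∫⁻ v, (∫⁻ x, ‖f (x + proj (L⁻¹ • v))‖ₑ * ‖Ψ v‖ₑ ∂vol) :=
        lintegral_lintegral_swap hm.aemeasurable
    _ = ∫⁻ v, ‖Ψ v‖ₑ * (∫⁻ x, ‖f x‖ₑ ∂vol) := by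
        refine lintegral_congr fun v => ?_
        rw [lintegral_mul_const' _ _ enorm_ne_top, mul_comm,
          lintegral_add_right_eq_self (fun x => ‖f x‖ₑ)]
    _ = _ := lintegral_mul_const _ hΨc.enorm.measurable

/-! ### The frequency truncation on `L²` -/

theorem isMult_one : IsMult fun _ => 1 := ⟨fun _ => rfl, fun _ => by simp⟩

theorem mulOp_one (v : L2) : mulOp (fun _ => 1) v = v :=
  L2_ext fun k i => by simp [fc_mulOp isMult_one]

/-- The multiplier of `P_{<Λ(t)}`. -/
noncomputable def lowMult (φ : E3 → ℝ) (Λ : ℝ → ℝ) (t : ℝ) (k : K3) : ℝ :=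
  if 0 < t then cut φ (Λ t) k else 1

theorem isMult_lowMult (hφ : IsCutoff φ) (t : ℝ) : IsMult (lowMult φ Λ t) := by
  by_cases h : 0 < t
  · have : lowMult φ Λ t = cut φ (Λ t) := funext fun k => if_pos h
    rw [this]; exact isMult_cut hφ _
  · have : lowMult φ Λ t = fun _ => 1 := funext fun k => if_neg h
    rw [this]; exact isMult_one

theorem mulOp_lowMult_ae (hφ : IsCutoff φ) (hΛ : IsWavenumber T Λ) {t : ℝ} (ht : t ∈ Icc 0 T)
    (v : L2) : mulOp (lowMult φ Λ t) v =ᵐ[vol] low φ Λ t v := by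
  by_cases h : 0 < t
  · have hL := hΛ.pos ⟨h, ht.2⟩
    have e : mulOp (lowMult φ Λ t) v = contL2 (smooth_vtp (box (modeBound Λ t)) fun k i =>
        cut φ (Λ t) k * fc v k i).continuous := L2_ext fun k i => by
      rw [fc_mulOp (isMult_lowMult hφ t), fc_contL2, lowMult, if_pos h]
      refine Eq.trans ?_ (fourierCoef_retp (herm_cut_mul (isMult_cut hφ _) (herm_fc v i)) k).symm
      split_ifs with hk
      · rfl
      · rw [cut_eq_zero hφ hL (le_modeBound Λ t) hk]; simp
    rw [e, low_eq hφ h hL (le_modeBound Λ t)]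
    exact coeFn_contL2 _
  · have e1 : lowMult φ Λ t = fun _ => 1 := funext fun k => if_neg h
    have e2 : low φ Λ t v = v := by
      funext x; ext i; simp [low, lowS, h]
    rw [e1, e2, mulOp_one]

/-- At `t = 0`, each fixed frequency is eventually below `Λ(s)`, where the multiplier already equals
its limit `1`. -/
theorem tendsto_lowMult (hφ : IsCutoff φ) (hΛ : IsWavenumber T Λ) {t : ℝ} (ht : t ∈ Icc 0 T)
    (k : K3) : Tendsto (fun s => lowMult φ Λ s k) (𝓝[Icc 0 T] t) (𝓝 (lowMult φ Λ t k)) := by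
  rcases ht.1.eq_or_lt with h | h
  · subst h
    refine tendsto_const_nhds.congr' ?_
    have h1 : ∀ᶠ s in 𝓝[>] (0 : ℝ), ‖freq k‖ < Λ s := hΛ.tendsto.eventually_gt_atTop _
    filter_upwards [eventually_nhdsWithin_iff.1 h1 |>.filter_mono inf_le_left] with s hs
    rw [lowMult, if_neg (lt_irrefl _), lowMult]
    split_ifs with hs0
    · have hL0 : 0 < Λ s := (norm_nonneg _).trans_lt (hs hs0)
      rw [cut, hφ.eq_one]
      rw [norm_smul, norm_inv, Real.norm_of_nonneg hL0.le, inv_mul_lt_one₀ hL0]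
      exact hs hs0
    · rfl
  · have h1 : ContinuousWithinAt (fun s => cut φ (Λ s) k) (Ioc 0 T) t :=
      (contDiffOn_cut hφ hΛ k).continuousOn t ⟨h, ht.2⟩
    have h2 : Ioc 0 T ∈ 𝓝[Icc 0 T] t := by
      filter_upwards [self_mem_nhdsWithin, mem_nhdsWithin_of_mem_nhds (Ioi_mem_nhds h)] with s hs hs'
        using ⟨hs', hs.2⟩
    rw [lowMult, if_pos h]
    refine (h1.mono_of_mem_nhdsWithin h2).tendsto.congr' ?_
    filter_upwards [h2] with s hs
    rw [lowMult, if_pos hs.1]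

theorem continuousOn_mulOp_lowMult (hφ : IsCutoff φ) (hΛ : IsWavenumber T Λ) {u : ℝ → L2}
    (hu : ContinuousOn u (Icc 0 T)) :
    ContinuousOn (fun t => mulOp (lowMult φ Λ t) (u t)) (Icc 0 T) := fun t ht =>
  tendsto_mulOp (Eventually.of_forall fun s => isMult_lowMult hφ s) (isMult_lowMult hφ t)
    (tendsto_lowMult hφ hΛ ht) (hu t ht)

/-- The approximant is the sharp Fourier truncation of `v` to a large box. -/
theorem exists_trig_approx (v : L2) {δ : ℝ} (hδ : 0 < δ) :
    ∃ (a : T3 → E3), (∀ i, IsTrig fun x => a x i) ∧ ∃ w : L2, w =ᵐ[vol] a ∧ ‖w - v‖ < δ := by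
  classical
  have hm : ∀ N : ℕ, IsMult fun k => if k ∈ box N then 1 else 0 := fun N =>
    ⟨fun k => by simp only [neg_mem_box], fun k => by split_ifs <;> simp⟩
  have h := tendsto_mulOp (l := atTop) (y := fun _ => v) (Eventually.of_forall hm) isMult_one
    (fun k => ?_) tendsto_const_nhds
  · rw [mulOp_one] at h
    obtain ⟨N, hN⟩ := ((tendsto_iff_norm_sub_tendsto_zero.1 h).eventually_lt_const hδ).exists
    refine ⟨vtp (box N) (fc v), fun i => isTrig_retp (herm_fc v i), _, ?_, hN⟩
    have e : mulOp (fun k => if k ∈ box N then 1 else 0) v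
        = contL2 (smooth_vtp (box N) (fc v)).continuous := L2_ext fun k i => by
      rw [fc_mulOp (hm N), fc_contL2]
      refine Eq.trans ?_ (fourierCoef_retp (herm_fc v i) k).symm
      split_ifs <;> simp
    rw [e]
    exact coeFn_contL2 _
  · obtain ⟨N, hN⟩ : ∃ N : ℕ, k ∈ box N := by
      refine ⟨(∑ i, |k i|).toNat, mem_box.2 fun i => ?_⟩
      rw [Int.toNat_of_nonneg (Finset.sum_nonneg fun _ _ => abs_nonneg _)]
      exact Finset.single_le_sum (f := fun i => |k i|) (fun _ _ => abs_nonneg _) (Finset.mem_univ i)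
    refine tendsto_const_nhds.congr' ?_
    filter_upwards [eventually_ge_atTop N] with n hn
    rw [if_pos (box_mono hn hN)]

/-! ### The traceless tensor product -/

/-- The component `p` of `a ⊗̊ a`. -/
noncomputable def ttComp (p : Fin 3 × Fin 3) (a : T3 → E3) (x : T3) : ℝ :=
  tracelessTensor (a x) (a x) p.1 p.2

/-- The product term contributes `1` and the trace term `1/3`, which is rounded up to `2`. -/
theorem abs_tracelessTensor_sub_le (a b : E3) (i j : Fin 3) :
    |tracelessTensor a a i j - tracelessTensor b b i j| ≤ 2 * ((‖a‖ + ‖b‖) * ‖a - b‖) := by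
  have hn : ∀ (c : E3) i, |c i| ≤ ‖c‖ := fun c i => PiLp.norm_apply_le c i
  have h1 : |a i * a j - b i * b j| ≤ (‖a‖ + ‖b‖) * ‖a - b‖ := by
    have e : a i * a j - b i * b j = a i * (a - b) j + (a - b) i * b j := by
      simp only [PiLp.sub_apply]; ring
    rw [e]
    refine (abs_add_le _ _).trans ?_
    rw [abs_mul, abs_mul]
    have := mul_le_mul (hn a i) (hn (a - b) j) (abs_nonneg _) (norm_nonneg _)
    have := mul_le_mul (hn (a - b) i) (hn b j) (abs_nonneg _) (norm_nonneg _)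
    linarith
  have h2 : |(∑ l, a l * a l) - ∑ l, b l * b l| ≤ (‖a‖ + ‖b‖) * ‖a - b‖ := by
    have e : ∀ c : E3, ∑ l, c l * c l = ‖c‖ ^ 2 := fun c => by
      rw [EuclideanSpace.norm_sq_eq]
      exact Finset.sum_congr rfl fun l _ => by rw [Real.norm_eq_abs, sq_abs, sq]
    rw [e, e, sq_sub_sq, abs_mul, abs_of_nonneg (by positivity)]
    gcongr
    exact abs_norm_sub_norm_le a b
  have h0 : 0 ≤ (‖a‖ + ‖b‖) * ‖a - b‖ := by positivity
  rw [abs_le] at h1 h2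
  rw [tracelessTensor, tracelessTensor, abs_le]
  split_ifs <;> constructor <;> linarith [h1.1, h1.2, h2.1, h2.2]

theorem ttComp_ae {p : Fin 3 × Fin 3} {a b : T3 → E3} (h : a =ᵐ[vol] b) :
    ttComp p a =ᵐ[vol] ttComp p b :=
  h.mono fun x hx => by simp only [ttComp, hx]

theorem isTrig_ttComp {a : T3 → E3} (ha : ∀ i, IsTrig fun x => a x i) (p : Fin 3 × Fin 3) :
    IsTrig (ttComp p a) := by
  have h1 := (ha p.1).mul (ha p.2)
  have h2 := ((ha 0).mul (ha 0)).add (((ha 1).mul (ha 1)).add ((ha 2).mul (ha 2)))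
  unfold ttComp tracelessTensor
  refine h1.sub ?_
  split_ifs
  · have := h2.const_mul (1 / 3)
    refine (congrArg IsTrig ?_).mp this
    funext x
    rw [Fin.sum_univ_three]; ring
  · exact IsTrig.zero

/-- Lipschitz bound in `L¹` for the traceless tensor product on `L²`. -/
theorem eLpNorm_ttComp_sub_le (p : Fin 3 × Fin 3) (v w : L2) :
    eLpNorm (ttComp p v - ttComp p w) 1 vol
      ≤ ENNReal.ofReal (2 * ((‖v‖ + ‖w‖) * ‖v - w‖)) := by
  have h1 : ∀ a b : L2, Integrable (fun x => ‖a x‖ * ‖b x‖) vol ∧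
      ∫ x, ‖a x‖ * ‖b x‖ ∂vol ≤ ‖a‖ * ‖b‖ := fun a b => by
    have ha := (Lp.memLp a).norm
    have hb := (Lp.memLp b).norm
    refine ⟨ha.integrable_mul hb, ?_⟩
    have := real_inner_le_norm (ha.toLp _) (hb.toLp _)
    rw [L2.inner_def] at this
    have e : ∫ x, inner ℝ (ha.toLp _ x) (hb.toLp _ x) ∂vol = ∫ x, ‖a x‖ * ‖b x‖ ∂vol := by
      refine integral_congr_ae ?_
      filter_upwards [ha.coeFn_toLp, hb.coeFn_toLp] with x h1 h2
      rw [h1, h2]; simp [mul_comm]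
    rw [e, Lp.norm_toLp, Lp.norm_toLp, eLpNorm_norm, eLpNorm_norm] at this
    exact this
  have h2 := h1 v (v - w)
  have h3 := h1 w (v - w)
  rw [eLpNorm_one_eq_lintegral_enorm]
  calc ∫⁻ x, ‖(ttComp p v - ttComp p w) x‖ₑ ∂vol
      ≤ ∫⁻ x, ENNReal.ofReal (2 * (‖v x‖ * ‖(v - w) x‖ + ‖w x‖ * ‖(v - w) x‖)) ∂vol := by
        refine lintegral_mono_ae ?_
        filter_upwards [Lp.coeFn_sub v w] with x hx
        rw [hx, ← ofReal_norm, ← add_mul]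
        exact ENNReal.ofReal_le_ofReal (abs_tracelessTensor_sub_le _ _ _ _)
    _ = ENNReal.ofReal (∫ x, 2 * (‖v x‖ * ‖(v - w) x‖ + ‖w x‖ * ‖(v - w) x‖) ∂vol) :=
        (ofReal_integral_eq_lintegral_ofReal ((h2.1.add h3.1).const_mul 2)
          (Eventually.of_forall fun x => by
            change (0 : ℝ) ≤ 2 * (‖v x‖ * ‖(v - w) x‖ + ‖w x‖ * ‖(v - w) x‖)
            positivity)).symm
    _ ≤ _ := by
        refine ENNReal.ofReal_le_ofReal ?_
        rw [integral_const_mul, integral_add h2.1 h3.1]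
        linarith [h2.2, h3.2]

/-! ### High modes of the nonlinearity -/

theorem fourierCoef_sub {f g : T3 → ℝ} (hf : Continuous f) (hg : Continuous g) (k : K3) :
    fourierCoef (f - g) k = fourierCoef f k - fourierCoef g k := by
  have h : ∀ f : T3 → ℝ, Continuous f → Integrable (fun x => mFourier (-k) x * (f x : ℂ)) vol :=
    fun f hf => ((mFourier (-k)).continuous.mul (Complex.continuous_ofReal.comp hf)).integrable_vol
  rw [fourierCoef_eq, fourierCoef_eq, fourierCoef_eq, ← integral_sub (h f hf) (h g hg)]
  refine integral_congr_ae (Eventually.of_forall fun x => ?_)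
  simp [mul_sub]

theorem retp_sub (S : Finset K3) (c d : K3 → ℂ) :
    retp S c - retp S d = retp S fun k => c k - d k := by
  funext x
  simp only [Pi.sub_apply, retp, sub_mul, Finset.sum_sub_distrib, Complex.sub_re]

theorem lowPass_sub (hφ : IsCutoff φ) {L : ℝ} (hL : 0 < L) {f g : T3 → ℝ} (hf : Continuous f)
    (hg : Continuous g) : lowPass φ L (f - g) = lowPass φ L f - lowPass φ L g := by
  rw [lowPass_eq hφ hL (Nat.le_ceil _), lowPass_eq hφ hL (Nat.le_ceil _),
    lowPass_eq hφ hL (Nat.le_ceil _), retp_sub]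
  congr 1
  funext k
  rw [fourierCoef_sub hf hg, mul_sub]

theorem lowPass_continuous (hφ : IsCutoff φ) {L : ℝ} (hL : 0 < L) (f : T3 → ℝ) :
    Continuous (lowPass φ L f) := by
  rw [lowPass_eq hφ hL (Nat.le_ceil _)]
  exact (smooth_retp _ _).continuous

theorem highS_eq {t : ℝ} (ht : 0 < t) (f : T3 → ℝ) :
    highS φ Λ t f = f - lowPass φ (Λ t) f := by
  funext x; simp [highS, lowS, ht]

/-- The operators `P_{≥Λ(t)}` are uniformly bounded on `L¹`. -/
theorem exists_eLpNorm_highS_le (hφ : IsCutoff φ) (hΛ : IsWavenumber T Λ) :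
    ∃ C : ℝ≥0, ∀ t ∈ Ioc 0 T, ∀ f : T3 → ℝ, IsTrig f →
      eLpNorm (highS φ Λ t f) 1 vol ≤ C * eLpNorm f 1 vol := by
  obtain ⟨C, hC⟩ := hφ.exists_eLpNorm_lowPass_le
  refine ⟨1 + C, fun t ht f hf => ?_⟩
  rw [highS_eq ht.1]
  refine (eLpNorm_sub_le hf.continuous.aestronglyMeasurable
    (lowPass_continuous hφ (hΛ.pos ht) f).aestronglyMeasurable le_rfl).trans ?_
  rw [ENNReal.coe_add, ENNReal.coe_one, add_mul, one_mul]
  gcongr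
  exact hC _ (hΛ.pos ht) f hf

theorem highS_sub (hφ : IsCutoff φ) (hΛ : IsWavenumber T Λ) {t : ℝ} (ht : t ∈ Ioc 0 T)
    {f g : T3 → ℝ} (hf : Continuous f) (hg : Continuous g) :
    highS φ Λ t (f - g) = highS φ Λ t f - highS φ Λ t g := by
  rw [highS_eq ht.1, highS_eq ht.1, highS_eq ht.1, lowPass_sub hφ (hΛ.pos ht) hf hg]; abel

/-- Near `t > 0` all truncations live on the box of time `t / 2`, so the difference is bounded
pointwise by a finite sum of continuous functions of `s`. -/
theorem tendsto_eLpNorm_lowPass_sub (hφ : IsCutoff φ) (hΛ : IsWavenumber T Λ) {t : ℝ}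
    (ht : t ∈ Ioc 0 T) (f : T3 → ℝ) :
    Tendsto (fun s => eLpNorm (lowPass φ (Λ t) f - lowPass φ (Λ s) f) 1 vol) (𝓝[Ioc 0 T] t)
      (𝓝 0) := by
  set N := modeBound Λ (t / 2) with hN
  have ht2 : t / 2 ∈ Ioc 0 T := ⟨half_pos ht.1, by linarith [ht.1, ht.2]⟩
  have hNs : ∀ s ∈ Ioc 0 T, t / 2 ≤ s → 2 * Λ s ≤ N := fun s hs hts =>
    (le_modeBound Λ s).trans (by exact_mod_cast modeBound_anti hΛ ht2 hs hts)
  have hcut : ∀ k, ContinuousWithinAt (fun s => cut φ (Λ s) k) (Ioc 0 T) t := fun k =>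
    (contDiffOn_cut hφ hΛ k).continuousOn t ht
  have h1 : Tendsto (fun s => ∑ k ∈ box N, ‖((cut φ (Λ t) k - cut φ (Λ s) k : ℝ) : ℂ) *
      fourierCoef f k‖) (𝓝[Ioc 0 T] t) (𝓝 0) := by
    have : Tendsto (fun s => ∑ k ∈ box N, ‖((cut φ (Λ t) k - cut φ (Λ s) k : ℝ) : ℂ) *
        fourierCoef f k‖) (𝓝[Ioc 0 T] t) (𝓝 (∑ k ∈ box N,
          ‖((cut φ (Λ t) k - cut φ (Λ t) k : ℝ) : ℂ) * fourierCoef f k‖)) :=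
      tendsto_finsetSum _ fun k _ => (((Complex.continuous_ofReal.tendsto _).comp
        ((hcut k).tendsto.const_sub _)).mul_const _).norm
    simpa using this
  have h2 := ENNReal.tendsto_ofReal h1
  rw [ENNReal.ofReal_zero] at h2
  refine tendsto_of_tendsto_of_tendsto_of_le_of_le' tendsto_const_nhds h2
    (Eventually.of_forall fun _ => zero_le) ?_
  filter_upwards [self_mem_nhdsWithin,
    mem_nhdsWithin_of_mem_nhds (Ioi_mem_nhds (half_lt_self ht.1))] with s hs hs'
  rw [lowPass_eq hφ (hΛ.pos ht) (hNs t ht (half_lt_self ht.1).le),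
    lowPass_eq hφ (hΛ.pos hs) (hNs s hs (le_of_lt hs')), retp_sub]
  refine (eLpNorm_le_of_ae_bound (C := ∑ k ∈ box N,
    ‖((cut φ (Λ t) k - cut φ (Λ s) k : ℝ) : ℂ) * fourierCoef f k‖)
    (Eventually.of_forall fun x => ?_)).trans (by simp)
  refine (Complex.abs_re_le_norm _).trans ((norm_sum_le _ _).trans (Finset.sum_le_sum fun k _ => ?_))
  beta_reduce
  rw [norm_mul, norm_mFourier_apply, mul_one, ← sub_mul, Complex.ofReal_sub]

theorem isTrig_low (hφ : IsCutoff φ) (hΛ : IsWavenumber T Λ) {t : ℝ} (ht : t ∈ Ioc 0 T)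
    (w : T3 → E3) (i : Fin 3) : IsTrig fun x => low φ Λ t w x i := by
  rw [low_eq hφ ht.1 (hΛ.pos ht) (le_modeBound Λ t)]
  exact isTrig_retp (herm_cut_mul (isMult_cut hφ _) (herm_fourierCoef _))

theorem highModes_apply (t : ℝ) (w : T3 → E3) (x : T3) (p : Fin 3 × Fin 3) :
    highModes φ Λ t w x p = highS φ Λ t (ttComp p (low φ Λ t w)) x := rfl

theorem highModes_zero (w : T3 → E3) : highModes φ Λ 0 w = 0 := by
  funext x; ext p
  simp [highModes_apply, highS, lowS]

theorem highModes_continuous (hφ : IsCutoff φ) (hΛ : IsWavenumber T Λ) {t : ℝ} (ht : t ∈ Icc 0 T)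
    (w : T3 → E3) : Continuous (highModes φ Λ t w) := by
  rcases ht.1.eq_or_lt with rfl | h
  · rw [highModes_zero]; exact continuous_const
  · have ht' : t ∈ Ioc 0 T := ⟨h, ht.2⟩
    refine (PiLp.continuous_toLp 2 _).comp (continuous_pi fun p => ?_)
    change Continuous (highS φ Λ t (ttComp p (low φ Λ t w)))
    rw [highS_eq h]
    exact (isTrig_ttComp (isTrig_low hφ hΛ ht' w) p).continuous.sub
      (lowPass_continuous hφ (hΛ.pos ht') _)

theorem eLpNorm_le_sum_comp {f : T3 → M3} (hf : Continuous f) :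
    eLpNorm f 1 vol ≤ ∑ p, eLpNorm (fun x => f x p) 1 vol := by
  have hfp : ∀ p, Continuous fun x => f x p := fun p =>
    (EuclideanSpace.proj p : M3 →L[ℝ] ℝ).continuous.comp hf
  simp only [eLpNorm_one_eq_lintegral_enorm]
  rw [← lintegral_finsetSum _ fun p _ => (hfp p).enorm.measurable]
  refine lintegral_mono fun x => ?_
  have h : f x = ∑ p, (f x p) • EuclideanSpace.single p (1 : ℝ) := by
    ext q
    simp [Finset.sum_apply, Pi.single_apply]
  conv_lhs => rw [h]
  refine (enorm_sum_le _ _).trans (Finset.sum_le_sum fun p _ => ?_)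
  rw [enorm_smul]
  simp [← ofReal_norm]

/-- The high modes of the nonlinearity are bounded in `L¹` by the energy. -/
theorem exists_eLpNorm_highModes_le (hφ : IsCutoff φ) (hΛ : IsWavenumber T Λ) :
    ∃ C : ℝ≥0, ∀ t ∈ Icc 0 T, ∀ v : L2,
      eLpNorm (highModes φ Λ t v) 1 vol ≤ C * ENNReal.ofReal (‖v‖ ^ 2) := by
  obtain ⟨C, hC⟩ := exists_eLpNorm_highS_le hφ hΛ
  -- Nine tensor components, each with the factor `2` of the tensor bound.
  refine ⟨18 * C, fun t ht v => ?_⟩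
  rcases ht.1.eq_or_lt with rfl | h
  · rw [highModes_zero]; simp
  have ht' : t ∈ Ioc 0 T := ⟨h, ht.2⟩
  refine (eLpNorm_le_sum_comp (highModes_continuous hφ hΛ ht v)).trans ?_
  have hp : ∀ p : Fin 3 × Fin 3, eLpNorm (fun x => highModes φ Λ t v x p) 1 vol
      ≤ C * ENNReal.ofReal (2 * ‖v‖ ^ 2) := fun p => by
    refine (hC t ht' _ (isTrig_ttComp (isTrig_low hφ hΛ ht' v) p)).trans ?_
    gcongr
    have h1 := eLpNorm_ttComp_sub_le p (mulOp (lowMult φ Λ t) v) 0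
    have h2 := norm_mulOp_le (isMult_lowMult (Λ := Λ) hφ t) v
    have h3 : ttComp p (mulOp (lowMult φ Λ t) v) - ttComp p (0 : L2) =ᵐ[vol]
        ttComp p (low φ Λ t v) := by
      filter_upwards [ttComp_ae (p := p) (mulOp_lowMult_ae hφ hΛ ht v),
        ttComp_ae (p := p) (Lp.coeFn_zero E3 2 vol)] with x hx hx'
      rw [Pi.sub_apply, hx, hx']
      simp [ttComp, tracelessTensor]
    rw [eLpNorm_congr_ae h3, norm_zero, add_zero, sub_zero] at h1
    refine h1.trans (ENNReal.ofReal_le_ofReal ?_)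
    rw [sq]
    gcongr
  refine (Finset.sum_le_sum fun p _ => hp p).trans (le_of_eq ?_)
  rw [ENNReal.ofReal_mul zero_le_two]
  simp only [Finset.sum_const, Finset.card_univ, Fintype.card_prod, Fintype.card_fin, nsmul_eq_mul]
  push_cast
  rw [ENNReal.ofReal_ofNat]
  ring

theorem eLpNorm_ttComp_low_sub_le (hφ : IsCutoff φ) (hΛ : IsWavenumber T Λ) (p : Fin 3 × Fin 3)
    {t : ℝ} (ht : t ∈ Icc 0 T) (v w : L2) {a : T3 → E3} (ha : w =ᵐ[vol] a) :
    eLpNorm (ttComp p (low φ Λ t v) - ttComp p a) 1 vol ≤ ENNReal.ofReal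
      (2 * ((‖mulOp (lowMult φ Λ t) v‖ + ‖w‖) * ‖mulOp (lowMult φ Λ t) v - w‖)) := by
  rw [← eLpNorm_congr_ae ((ttComp_ae (p := p) (mulOp_lowMult_ae hφ hΛ ht v)).sub
    (ttComp_ae (p := p) ha))]
  exact eLpNorm_ttComp_sub_le p _ _

/-- The increment splits into the varying operator on the change of the tensor, controlled by the
uniform `L¹` bound, and the change of the operator on one fixed function. -/
theorem tendsto_highS_pos (hφ : IsCutoff φ) (hΛ : IsWavenumber T Λ) {u : ℝ → L2}
    (hu : ContinuousOn u (Icc 0 T)) (p : Fin 3 × Fin 3) {t : ℝ} (ht : t ∈ Ioc 0 T) :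
    Tendsto (fun s => eLpNorm (highS φ Λ s (ttComp p (low φ Λ s (u s))) -
      highS φ Λ t (ttComp p (low φ Λ t (u t)))) 1 vol) (𝓝[Icc 0 T] t) (𝓝 0) := by
  obtain ⟨C, hC⟩ := exists_eLpNorm_highS_le hφ hΛ
  have htI : t ∈ Icc 0 T := Ioc_subset_Icc_self ht
  have hmem : Ioc 0 T ∈ 𝓝[Icc 0 T] t := by
    filter_upwards [self_mem_nhdsWithin, mem_nhdsWithin_of_mem_nhds (Ioi_mem_nhds ht.1)]
      with s hs hs' using ⟨hs', hs.2⟩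
  set A : ℝ → T3 → ℝ := fun s => ttComp p (low φ Λ s (u s)) with hA
  set W : ℝ → L2 := fun s => mulOp (lowMult φ Λ s) (u s) with hW
  have hWc : Tendsto W (𝓝[Icc 0 T] t) (𝓝 (W t)) := continuousOn_mulOp_lowMult hφ hΛ hu t htI
  have hAt : ∀ s ∈ Ioc 0 T, IsTrig (A s) := fun s hs => isTrig_ttComp (isTrig_low hφ hΛ hs _) p
  have h1 : Tendsto (fun s => ENNReal.ofReal (2 * ((‖W s‖ + ‖W t‖) * ‖W s - W t‖)))
      (𝓝[Icc 0 T] t) (𝓝 0) := by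
    have := ENNReal.tendsto_ofReal (((hWc.norm.add_const ‖W t‖).mul
      (hWc.sub_const (W t)).norm).const_mul 2)
    rwa [sub_self, norm_zero, mul_zero, mul_zero, ENNReal.ofReal_zero] at this
  have h2 := ((tendsto_eLpNorm_lowPass_sub hφ hΛ ht (A t)).mono_left
    (nhdsWithin_le_of_mem hmem))
  have h3 := (ENNReal.Tendsto.const_mul (a := (C : ℝ≥0∞)) h1 (Or.inr ENNReal.coe_ne_top)).add h2
  rw [mul_zero, add_zero] at h3
  refine tendsto_of_tendsto_of_tendsto_of_le_of_le' tendsto_const_nhds h3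
    (Eventually.of_forall fun _ => zero_le) ?_
  filter_upwards [hmem] with s hs
  have hd : IsTrig (A s - A t) := (hAt s hs).sub (hAt t ht)
  have e : highS φ Λ s (A s) - highS φ Λ t (A t) = highS φ Λ s (A s - A t) +
      (lowPass φ (Λ t) (A t) - lowPass φ (Λ s) (A t)) := by
    rw [highS_sub hφ hΛ hs (hAt s hs).continuous (hAt t ht).continuous, highS_eq hs.1 (A t),
      highS_eq ht.1 (A t)]
    abel
  have hc1 : Continuous (highS φ Λ s (A s - A t)) := by
    rw [highS_eq hs.1]
    exact hd.continuous.sub (lowPass_continuous hφ (hΛ.pos hs) _)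
  rw [e]
  refine (eLpNorm_add_le hc1.aestronglyMeasurable ((lowPass_continuous hφ (hΛ.pos ht) _).sub
    (lowPass_continuous hφ (hΛ.pos hs) _)).aestronglyMeasurable le_rfl).trans ?_
  gcongr
  refine (hC s hs _ hd).trans ?_
  gcongr
  exact eLpNorm_ttComp_low_sub_le hφ hΛ p (Ioc_subset_Icc_self hs) _ _
    (mulOp_lowMult_ae hφ hΛ htI _)

/-- No rate is available for `L²` data, so a density argument is used: the tensor is compared with
that of a trigonometric polynomial `a` close to `u 0`. The high-pass operator annihilates the latter
for small `s`, and the remainder is small by the uniform `L¹` bound. -/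
theorem tendsto_highS_zero (hφ : IsCutoff φ) (hΛ : IsWavenumber T Λ) (hT : 0 < T) {u : ℝ → L2}
    (hu : ContinuousOn u (Icc 0 T)) (p : Fin 3 × Fin 3) :
    Tendsto (fun s => eLpNorm (highS φ Λ s (ttComp p (low φ Λ s (u s)))) 1 vol) (𝓝[Icc 0 T] 0)
      (𝓝 0) := by
  obtain ⟨C, hC⟩ := exists_eLpNorm_highS_le hφ hΛ
  have h0I : (0 : ℝ) ∈ Icc 0 T := ⟨le_rfl, hT.le⟩
  set v := mulOp (lowMult φ Λ 0) (u 0) with hv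
  have hWc := (continuousOn_mulOp_lowMult hφ hΛ hu 0 h0I).tendsto
  rw [← hv] at hWc
  rw [ENNReal.tendsto_nhds_zero]
  intro ε hε
  obtain ⟨δ, ⟨hδ0, hδ1⟩, hδ⟩ : ∃ δ ∈ Ioo (0 : ℝ) 1, C * ENNReal.ofReal
      (2 * (((‖v‖ + 1) + (‖v‖ + 1)) * (2 * δ))) < ε := by
    have h1 : Tendsto (fun δ : ℝ => C * ENNReal.ofReal
        (2 * (((‖v‖ + 1) + (‖v‖ + 1)) * (2 * δ)))) (𝓝[>] 0) (𝓝 0) := by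
      have h2 : Continuous fun δ : ℝ => 2 * (((‖v‖ + 1) + (‖v‖ + 1)) * (2 * δ)) := by fun_prop
      have h3 := ENNReal.Tendsto.const_mul (a := (C : ℝ≥0∞))
        (ENNReal.tendsto_ofReal (h2.tendsto 0)) (Or.inr ENNReal.coe_ne_top)
      simp only [mul_zero, ENNReal.ofReal_zero] at h3
      exact h3.mono_left inf_le_left
    obtain ⟨δ, h, h'⟩ := ((h1.eventually_lt_const hε).and
      (Ioo_mem_nhdsGT (zero_lt_one (α := ℝ)))).exists
    exact ⟨δ, h', h⟩
  obtain ⟨a, ha, b, hb, hbv⟩ := exists_trig_approx v hδ0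
  have hB := isTrig_ttComp ha p
  have hlow : ∀ᶠ s in 𝓝[>] (0 : ℝ), lowPass φ (Λ s) (ttComp p a) = ttComp p a :=
    hΛ.tendsto.eventually (hB.lowPass_eventually_eq hφ)
  have hnear : ∀ᶠ s in 𝓝[Icc 0 T] (0 : ℝ), ‖mulOp (lowMult φ Λ s) (u s) - v‖ < δ :=
    (tendsto_iff_norm_sub_tendsto_zero.1 hWc).eventually_lt_const hδ0
  filter_upwards [self_mem_nhdsWithin, hnear,
    (eventually_nhdsWithin_iff.1 hlow).filter_mono inf_le_left] with s hs hsδ hslow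
  rcases hs.1.eq_or_lt with h | h
  · have : highS φ Λ s (ttComp p (low φ Λ s (u s))) = 0 := by
      funext x; simp [highS, lowS, ← h]
    rw [this]; simp
  have hs' : s ∈ Ioc 0 T := ⟨h, hs.2⟩
  have hA : IsTrig (ttComp p (low φ Λ s (u s))) := isTrig_ttComp (isTrig_low hφ hΛ hs' _) p
  have e : highS φ Λ s (ttComp p (low φ Λ s (u s))) =
      highS φ Λ s (ttComp p (low φ Λ s (u s)) - ttComp p a) := by
    rw [highS_sub hφ hΛ hs' hA.continuous hB.continuous, highS_eq h (ttComp p a), hslow h, sub_self,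
      sub_zero]
  rw [e]
  refine (hC s hs' _ (hA.sub hB)).trans (le_trans ?_ hδ.le)
  gcongr
  refine (eLpNorm_ttComp_low_sub_le hφ hΛ p hs _ b hb).trans (ENNReal.ofReal_le_ofReal ?_)
  have h1 : ‖mulOp (lowMult φ Λ s) (u s)‖ ≤ ‖v‖ + 1 := by
    have := norm_le_norm_add_norm_sub' (mulOp (lowMult φ Λ s) (u s)) v
    linarith
  have h2 : ‖b‖ ≤ ‖v‖ + 1 := by
    have := norm_le_norm_add_norm_sub' b v
    linarith
  have h3 : ‖mulOp (lowMult φ Λ s) (u s) - b‖ ≤ 2 * δ := by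
    have := norm_sub_le_norm_sub_add_norm_sub (mulOp (lowMult φ Λ s) (u s)) v b
    rw [norm_sub_rev v b] at this
    linarith
  gcongr

/-- The high modes of the nonlinearity form a continuous curve in `L¹`. -/
theorem contInLq_highModes (hφ : IsCutoff φ) (hΛ : IsWavenumber T Λ) (hT : 0 < T) {u : ℝ → L2}
    (hu : ContinuousOn u (Icc 0 T)) : ContInLq T 1 fun t => highModes φ Λ t (u t) := by
  refine ⟨fun t ht => (highModes_continuous hφ hΛ ht _).memLp_vol 1, fun t ht => ?_⟩
  have h1 : ∀ p, Tendsto (fun s => eLpNorm (highS φ Λ s (ttComp p (low φ Λ s (u s))) -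
      highS φ Λ t (ttComp p (low φ Λ t (u t)))) 1 vol) (𝓝[Icc 0 T] t) (𝓝 0) := fun p => by
    rcases ht.1.eq_or_lt with rfl | h
    · have : highS φ Λ 0 (ttComp p (low φ Λ 0 (u 0))) = 0 := by
        funext x; simp [highS, lowS]
      simp only [this, sub_zero]
      exact tendsto_highS_zero hφ hΛ hT hu p
    · exact tendsto_highS_pos hφ hΛ hu p ⟨h, ht.2⟩
  have h2 := tendsto_finsetSum Finset.univ fun p _ => h1 p
  rw [Finset.sum_const_zero] at h2
  refine tendsto_of_tendsto_of_tendsto_of_le_of_le' tendsto_const_nhds h2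
    (Eventually.of_forall fun _ => zero_le) ?_
  filter_upwards [self_mem_nhdsWithin] with s hs
  exact eLpNorm_le_sum_comp
    ((highModes_continuous hφ hΛ hs _).sub (highModes_continuous hφ hΛ ht _))

end LambdaNSE

namespace LambdaNSE

variable {ν T : ℝ} {φ : E3 → ℝ} {Λ : ℝ → ℝ}

/-! ### From pathwise limits to norms over the probability space -/

theorem tendsto_iSup_Icc {f : ℝ → ℝ≥0∞} (hT : 0 < T) (h : Tendsto f (𝓝[Icc 0 T] 0) (𝓝 0)) :
    Tendsto (fun τ => ⨆ t ∈ Icc 0 τ, f t) (𝓝[>] 0) (𝓝 0) := by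
  rw [ENNReal.tendsto_nhds_zero] at h ⊢
  intro ε hε
  have h1 := h ε hε
  rw [nhdsWithin_Icc_eq_nhdsGE hT, Filter.Eventually, mem_nhdsGE_iff_exists_Icc_subset] at h1
  obtain ⟨η, hη, hsub⟩ := h1
  filter_upwards [Ioc_mem_nhdsGT hη] with τ hτ
  exact iSup₂_le fun t ht => hsub ⟨ht.1, ht.2.trans hτ.2⟩

/-- Bounded convergence in `L^ρ(Ω; C([0,τ]; L^q))` as `τ → 0`. -/
theorem tendsto_normLC {Ω : Type*} {mΩ : MeasurableSpace Ω} (P : Measure Ω) [IsFiniteMeasure P]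
    {F : Type*} [NormedAddCommGroup F] {q : ℝ≥0∞} {f : ℝ → Ω → T3 → F} (hT : 0 < T) {K : ℝ≥0∞}
    (hK : K ≠ ⊤) (hb : ∀ᵐ ω ∂P, ∀ t ∈ Icc 0 T, eLpNorm (f t ω) q vol ≤ K)
    (h0 : ∀ᵐ ω ∂P, Tendsto (fun t => eLpNorm (f t ω) q vol) (𝓝[Icc 0 T] 0) (𝓝 0)) {ρ : ℝ}
    (hρ : 1 ≤ ρ) : Tendsto (fun τ => normLC P ρ τ q f) (𝓝[>] 0) (𝓝 0) := by
  have hρ0 : 0 < ρ := by linarith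
  set G : ℝ → Ω → ℝ≥0∞ := fun τ ω => (⨆ t ∈ Icc 0 τ, eLpNorm (f t ω) q vol) ^ ρ with hG
  -- The supremum over uncountably many times need not be measurable; measurable minorants with the
  -- same integral make dominated convergence applicable.
  choose g hgm hgle hgeq using fun τ => exists_measurable_le_lintegral_eq P (G τ)
  have hz : (0 : ℝ≥0∞) ^ ρ = 0 := ENNReal.zero_rpow_of_pos hρ0
  have hlim : Tendsto (fun τ => ∫⁻ ω, g τ ω ∂P) (𝓝[>] 0) (𝓝 (∫⁻ _, 0 ∂P)) := by
    refine tendsto_lintegral_filter_of_dominated_convergence (fun _ => K ^ ρ)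
      (Eventually.of_forall hgm) ?_ ?_ ?_
    · filter_upwards [Ioc_mem_nhdsGT hT] with τ hτ
      filter_upwards [hb] with ω hω
      refine (hgle τ ω).trans (ENNReal.rpow_le_rpow ?_ hρ0.le)
      exact iSup₂_le fun t ht => hω t ⟨ht.1, ht.2.trans hτ.2⟩
    · rw [lintegral_const]
      exact ENNReal.mul_ne_top (ENNReal.rpow_ne_top_of_nonneg hρ0.le hK) (measure_ne_top _ _)
    · filter_upwards [h0] with ω hω
      have h1 := ((ENNReal.continuous_rpow_const (y := ρ)).tendsto 0).comp (tendsto_iSup_Icc hT hω)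
      rw [hz] at h1
      exact tendsto_of_tendsto_of_tendsto_of_le_of_le tendsto_const_nhds h1 (fun _ => zero_le)
        fun τ => hgle τ ω
  have h2 := ((ENNReal.continuous_rpow_const (y := 1 / ρ)).tendsto _).comp hlim
  rw [lintegral_zero, ENNReal.zero_rpow_of_pos (by positivity)] at h2
  refine h2.congr fun τ => ?_
  rw [normLC, eLpNorm_eq_lintegral_rpow_enorm_toReal (by simpa using hρ0) ENNReal.ofReal_ne_top,
    ENNReal.toReal_ofReal hρ0.le]
  simp only [Function.comp, ← hgeq, hG, enorm_eq_self]

theorem eLpNorm_coeFn_L2 (v : L2) : eLpNorm v 2 vol = ENNReal.ofReal ‖v‖ := by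
  rw [Lp.norm_def, ENNReal.ofReal_toReal (Lp.eLpNorm_ne_top v)]

end LambdaNSE

/-! ### The main theorem for random data -/

open LambdaNSE
theorem theorem2p1 {Ω : Type*} {mΩ : MeasurableSpace Ω} (P : Measure Ω) [IsProbabilityMeasure P]
    (𝓕 : Filtration ℝ≥0 mΩ) (ν T M : ℝ) (hν : 0 < ν) (hT : 0 < T) (hM : 1 ≤ M)
    (φ : E3 → ℝ) (hφ : IsCutoff φ) (Λ : ℝ → ℝ) (hΛ : IsWavenumber T Λ)
    (v₀ : Ω → L2) (hmeas : StronglyMeasurable[𝓕 0] v₀)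
    (hdiv : ∀ᵐ ω ∂P, WeaklyDivFree (v₀ ω)) (hmean : ∀ᵐ ω ∂P, MeanFree (v₀ ω))
    (hbound : ∀ᵐ ω ∂P, ‖v₀ ω‖ ≤ M) :
    ∃ u : ℝ → Ω → L2,
      -- (i) existence, regularity, energy balance
      AdaptedOn 𝓕 T u ∧
      (∀ᵐ ω ∂P,
        IsWeakSolution ν T φ Λ (v₀ ω) (fun t => u t ω) ∧
        u 0 ω = v₀ ω ∧
        IsSmoothSolution ν T φ Λ (fun t => u t ω) ∧
        Tendsto (fun t => u t ω) (𝓝[>] 0) (𝓝 (v₀ ω)) ∧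
        EnergyBalance ν T (v₀ ω) (fun t => u t ω)) ∧
      (∀ ρ : ℝ, 1 ≤ ρ →
        Tendsto (fun τ : ℝ => normLC P ρ τ 2 (fun t ω => ⇑(u t ω - v₀ ω))) (𝓝[>] 0) (𝓝 0)) ∧
      -- (ii) uniqueness
      (∀ v : ℝ → Ω → L2, AdaptedOn 𝓕 T v →
        (∀ᵐ ω ∂P, IsWeakSolution ν T φ Λ (v₀ ω) (fun t => v t ω) ∧
          EnergyInequality ν T (v₀ ω) (fun t => v t ω)) →
        ∀ᵐ ω ∂P, ∀ t ∈ Icc 0 T, v t ω = u t ω) ∧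
      (∀ v : ℝ → Ω → L2, AdaptedOn 𝓕 T v →
        (∀ᵐ ω ∂P, IsLerayHopf ν T φ Λ (v₀ ω) (fun t => v t ω)) →
        ∀ᵐ ω ∂P, ∀ t ∈ Icc 0 T, v t ω = u t ω) ∧
      -- (iii) vanishing of the nonlinearity on high modes at the initial time
      (∀ᵐ ω ∂P, ContInLq T 1 (fun t => highModes φ Λ t (u t ω))) ∧
      (∀ ρ : ℝ, 1 ≤ ρ →
        Tendsto (fun τ : ℝ => normLC P ρ τ 1 (fun t ω => highModes φ Λ t (u t ω)))
          (𝓝[>] 0) (𝓝 0)) := by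
  have hM0 : 0 < M := by linarith
  -- The solution map is chosen once, independently of `ω`. Since `U t` is continuous, `U t (v₀ ω)`
  -- is measurable with respect to the initial information.
  obtain ⟨U, hUc, hU⟩ := exists_modeSolution hν.le hT hφ hΛ hM0
  have h0T : (0 : ℝ) ∈ Icc 0 T := ⟨le_rfl, hT.le⟩
  have hsol : ∀ᵐ ω ∂P, ‖v₀ ω‖ ≤ M ∧ (WeaklyDivFree (v₀ ω) ∧ MeanFree (v₀ ω)) ∧
      IsModeSolution ν T φ Λ M (v₀ ω) (fun t => U t (v₀ ω)) ∧
      ContinuousOn (fun t => U t (v₀ ω)) (Icc 0 T) ∧ U 0 (v₀ ω) = v₀ ω ∧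
      EnergyBalance ν T (v₀ ω) (fun t => U t (v₀ ω)) ∧
      ∀ t ∈ Icc 0 T, WeaklyDivFree (U t (v₀ ω)) ∧ MeanFree (U t (v₀ ω)) := by
    filter_upwards [hdiv, hmean, hbound] with ω h1 h2 h3
    exact ⟨h3, ⟨h1, h2⟩, hU (v₀ ω) h1 h2 h3⟩
  -- The common core of both uniqueness claims: the energy inequality supplies the bound `M`, and
  -- strong or weak continuity in time both give continuity of the coefficients.
  have huniq : ∀ v : ℝ → Ω → L2, (∀ᵐ ω ∂P, SolvesWeakly ν T φ Λ (v₀ ω) (fun t => v t ω) ∧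
      EnergyInequality ν T (v₀ ω) (fun t => v t ω) ∧
      ∀ k i, ContinuousOn (fun t => fc (v t ω) k i) (Icc 0 T)) →
      ∀ᵐ ω ∂P, ∀ t ∈ Icc 0 T, v t ω = U t (v₀ ω) := fun v hv => by
    filter_upwards [hv, hsol] with ω ⟨hw, he, hc⟩ ⟨hb, hd, hu, _⟩ t ht
    exact (hw.isModeSolution hν.le hT hφ hΛ hd.1 hd.2 hc
      fun t ht => (he.norm_le ht).trans hb).unique hν.le hφ hΛ hu ht
  refine ⟨fun t ω => U t (v₀ ω), ?_, ?_, ?_, ?_, ?_, ?_, ?_⟩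
  · intro t ht
    exact (hUc t ⟨t.2, ht⟩).comp_stronglyMeasurable (hmeas.mono (𝓕.mono zero_le))
  · filter_upwards [hsol] with ω ⟨_, _, hu, hc, h0, he, hdm⟩
    refine ⟨⟨hu.solvesWeakly hν.le hφ hΛ (fun t ht => (hdm t ht).1) fun t ht => (hdm t ht).2, hc⟩,
      h0, hu.isSmoothSolution hν hφ hΛ fun t ht => (hdm t ht).1, ?_, he⟩
    have h1 := (hc 0 h0T).tendsto
    rw [h0, nhdsWithin_Icc_eq_nhdsGE hT] at h1
    exact h1.mono_left (nhdsWithin_mono _ Ioi_subset_Ici_self)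
  · intro ρ hρ
    refine tendsto_normLC P hT (K := ENNReal.ofReal (2 * M)) ENNReal.ofReal_ne_top ?_ ?_ hρ
    · filter_upwards [hsol] with ω ⟨hb, _, hu, _⟩ t ht
      rw [eLpNorm_coeFn_L2]
      refine ENNReal.ofReal_le_ofReal ((norm_sub_le _ _).trans ?_)
      linarith [hu.bound t ht]
    · filter_upwards [hsol] with ω ⟨_, _, _, hc, h0, _⟩
      have h1 := (hc 0 h0T).tendsto
      rw [h0] at h1
      simp only [eLpNorm_coeFn_L2]
      simpa using ENNReal.tendsto_ofReal (tendsto_iff_norm_sub_tendsto_zero.1 h1)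
  · intro v _ hv
    refine huniq v ?_
    filter_upwards [hv] with ω ⟨hw, he⟩
    exact ⟨hw.toSolvesWeakly, he, fun k i =>
      (continuous_fc k i).comp_continuousOn hw.continuousOn⟩
  · intro v _ hv
    refine huniq v ?_
    filter_upwards [hv] with ω hw
    exact ⟨hw.toSolvesWeakly, hw.energy, continuousOn_fc_of_weakly hw.weaklyContinuousOn⟩
  · filter_upwards [hsol] with ω ⟨_, _, _, hc, _⟩
    exact contInLq_highModes hφ hΛ hT hc
  · intro ρ hρ
    obtain ⟨C, hC⟩ := exists_eLpNorm_highModes_le hφ hΛ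
    refine tendsto_normLC P hT (K := C * ENNReal.ofReal (M ^ 2))
      (ENNReal.mul_ne_top ENNReal.coe_ne_top ENNReal.ofReal_ne_top) ?_ ?_ hρ
    · filter_upwards [hsol] with ω ⟨_, _, hu, _⟩ t ht
      refine (hC t ht _).trans ?_
      have := hu.bound t ht
      gcongr
    · filter_upwards [hsol] with ω ⟨_, _, _, hc, _⟩
      have h1 := (contInLq_highModes hφ hΛ hT hc).2 0 h0T
      simpa only [highModes_zero, sub_zero] using h1
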